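/- Let $k$ be a field of characteristic $\neq 2$ and let $R$ be a normal Noetherian ring that is essentially of finite type over $k$ (normal: all localizations at primes are integrally closed domains). Then $\operatorname{Spec} R$ has a quasi-Gorenstein finite cover. More precisely, there is a finite field extension $k'/k$, with $k'=k$ if $k$ is infinite, such that $R' = R\otimes_k k'$ is again normal and Noetherian and the following holds. Call a Weil divisor $K$ on $\operatorname{Spec} R'$ canonical if $\mathcal O_{R'}(K)\cong\omega_{R'}$. Canonical divisors on $\operatorname{Spec} R'$ exist, and for every canonical divisor $K$: 1. There are a reduced effective Weil divisor $H$ and an invertible element $f$ of the total ring of fractions of $R'$ with $\operatorname{div} f = H + 2K$; in particular $H\sim -2K$. 2. For every reduced effective Weil divisor $H$ and every such $f$ with $\operatorname{div} f = H+2K$, the $R'$-module $S = R'\oplus\mathcal O_{R'}(K)\cong R'\oplus\omega_{R'}$ becomes, with the multiplication $$(a,b)(x,y) = (ax+byf,\; ay+bx),$$ where in particular $byf\in R'$, a commutative $R'$-algebra. This $S$ is normal and quasi-Gorenstein, i.e. $\omega_S\cong S$ as $S$-modules, and the maps $\operatorname{Spec} S\to\operatorname{Spec} R'$ and $\operatorname{Spec}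 S\to\operatorname{Spec} R$ are finite and surjective. Here the canonical module $\omega_T$ of a $k$-algebra $T$ essentially of finite type with connected spectrum is the lowest non-vanishing cohomology module of its dualizing complex: if $T=A/I$ with $A$ a localization of a polynomial ring $k[x_1,\dots,x_n]$ and $c$ is the height of $I$, then $\omega_T=\operatorname{Ext}^c_A(T,A)$. If the spectrum is not connected, $\omega_T$ is formed on each connected component. -/

import Mathlib

open scoped nonZeroDivisors TensorProduct
open CategoryTheory

universe u

/-- A commutative ring is normal if all its localizations at prime ideals are integrally closed
domains. A Noetherian ring is normal exactly if it is a finite product of normal domains. -/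
class IsNormalRing (R : Type u) [CommRing R] : Prop where
  isDomain : ∀ (p : Ideal R) [p.IsPrime], IsDomain (Localization.AtPrime p)
  isIntegrallyClosed : ∀ (p : Ideal R) [p.IsPrime], IsIntegrallyClosed (Localization.AtPrime p)

/-- The prime (Weil) divisors of `Spec R`: the prime ideals of height one. -/
structure PrimeDivisor (R : Type u) [CommRing R] where
  asIdeal : Ideal R
  isPrime : asIdeal.IsPrime
  height_eq_one : asIdeal.height = 1

/-- Integral Weil divisors on `Spec R`. -/
abbrev WeilDivisor (R : Type u) [CommRing R] : Type u := PrimeDivisor R →₀ ℤ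

namespace PrimeDivisor

section

variable {R : Type u} [CommRing R] (p : PrimeDivisor R)

instance : p.asIdeal.IsPrime := p.isPrime

/-- The local ring of `Spec R` at the generic point of a prime divisor. -/
abbrev localRing : Type u := Localization.AtPrime p.asIdeal

variable [IsNormalRing R]

instance : IsDomain p.localRing := IsNormalRing.isDomain p.asIdeal

instance : IsIntegrallyClosed p.localRing := IsNormalRing.isIntegrallyClosed p.asIdeal

instance [IsNoetherianRing R] : IsDiscreteValuationRing p.localRing := by
  have hdim : ringKrullDim p.localRing = 1 := by
    rw [IsLocalization.AtPrime.ringKrullDim_eq_height p.asIdeal p.localRing, p.height_eq_one]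
    rfl
  have hnf : ¬ IsField p.localRing := fun h => by
    rw [ringKrullDim_eq_zero_of_isField h] at hdim
    exact zero_ne_one hdim
  have hle : Ring.KrullDimLE 1 p.localRing := Ring.krullDimLE_iff.mpr hdim.le
  have h := (tfae_of_isNoetherianRing_of_isLocalRing_of_isDomain p.localRing).out 3 0
  have hpir : IsPrincipalIdealRing p.localRing := h.mp ⟨inferInstance, fun P hP hP' =>
    IsLocalRing.eq_maximalIdeal (Ring.krullDimLE_one_iff_of_isPrime_bot.mp hle P hP hP')⟩
  exact { hpir with not_a_field' := (IsLocalRing.isField_iff_maximalIdeal_eq.not.mp hnf) }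

lemma nonZeroDivisors_le :
    R⁰ ≤ (p.localRing⁰).comap (algebraMap R p.localRing) := fun s hs => by
  refine mem_nonZeroDivisors_of_ne_zero fun h0 => ?_
  obtain ⟨t, ht⟩ := (IsLocalization.map_eq_zero_iff p.asIdeal.primeCompl p.localRing s).mp h0
  have : (t : R) = 0 := (mem_nonZeroDivisors_iff_right.mp hs) _ ht
  exact t.2 (this ▸ p.asIdeal.zero_mem)

/-- The canonical map from the total ring of fractions of `R` to the field of fractions of the
local ring at a prime divisor. -/
noncomputable def toLocalFractions : FractionRing R →+* FractionRing p.localRing :=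
  IsLocalization.map (FractionRing p.localRing) (algebraMap R p.localRing) p.nonZeroDivisors_le

/-- The discrete valuation on the total ring of fractions of `R` attached to a prime divisor,
written multiplicatively: `p.valuation g = WithZero.exp (- ord_p g)`. -/
noncomputable def valuation [IsNoetherianRing R] :
    Valuation (FractionRing R) (WithZero (Multiplicative ℤ)) :=
  ((IsDiscreteValuationRing.maximalIdeal p.localRing).valuation
    (FractionRing p.localRing)).comap p.toLocalFractions

lemma valuation_algebraMap_le_one [IsNoetherianRing R] (r : R) :
    p.valuation (algebraMap R (FractionRing R) r) ≤ 1 := by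
  have : p.toLocalFractions (algebraMap R (FractionRing R) r) =
      algebraMap p.localRing (FractionRing p.localRing) (algebraMap R p.localRing r) :=
    IsLocalization.map_eq p.nonZeroDivisors_le r
  rw [valuation, Valuation.comap_apply, this]
  exact IsDedekindDomain.HeightOneSpectrum.valuation_le_one _ _

end

end PrimeDivisor

namespace WeilDivisor

section

variable {R : Type u} [CommRing R] [IsNoetherianRing R] [IsNormalRing R]

/-- The (global sections of the) divisorial sheaf `𝒪(D)`:
all `g` in the total ring of fractions with `ord_p g + D p ≥ 0` for every prime divisor `p`. -/
noncomputable def sections (D : WeilDivisor R) : Submodule R (FractionRing R) where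
  carrier := {g | ∀ p : PrimeDivisor R, p.valuation g ≤ WithZero.exp (D p)}
  zero_mem' := fun p => by simp
  add_mem' := fun ha hb p => Valuation.map_add_le _ (ha p) (hb p)
  smul_mem' := fun r g hg p => by
    rw [Algebra.smul_def, map_mul]
    exact (mul_le_mul' (p.valuation_algebraMap_le_one r) (hg p)).trans (one_mul _).le

/-- `D = div f`, for an invertible rational function `f`. -/
def IsDivOf (D : WeilDivisor R) (f : (FractionRing R)ˣ) : Prop :=
  ∀ p : PrimeDivisor R, p.valuation (f : FractionRing R) = WithZero.exp (-(D p))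

end

/-- A reduced effective divisor: all multiplicities are `0` or `1`. -/
def IsReduced {R : Type u} [CommRing R] (D : WeilDivisor R) : Prop :=
  ∀ p : PrimeDivisor R, D p = 0 ∨ D p = 1

end WeilDivisor

/-- `M` is the canonical module of `T`, for a `k`-algebra `T` essentially of finite type with
connected spectrum: if `T` is a quotient of a localization `A` of a polynomial ring over `k`, with
kernel of height `c`, then `M ≅ Ext_A^c(T, A)`, the lowest non-vanishing cohomology module of the
dualizing complex `RHom_A(T, A)`. (The surjection `φ` makes `T`-modules into `A`-modules, and
`A`-linear isomorphisms of `T`-modules are the same as `T`-linear ones.) -/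
def IsCanonicalModuleOfConnected (k T M : Type u) [Field k] [CommRing T] [Algebra k T]
    [AddCommGroup M] [Module T M] : Prop :=
  ∃ (n : ℕ) (W : Submonoid (MvPolynomial (Fin n) k)) (φ : Localization W →ₐ[k] T) (c : ℕ),
    Function.Surjective φ ∧ (RingHom.ker φ).height = c ∧
    Nonempty ((ModuleCat.restrictScalars.{u} φ.toRingHom).obj (ModuleCat.of T M) ≅
      ModuleCat.of (Localization W) (Abelian.Ext.{u}
        ((ModuleCat.restrictScalars.{u} φ.toRingHom).obj (ModuleCat.of T T))
        (ModuleCat.of (Localization W) (Localization W)) c))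

/-- `M` is the canonical module of `R`, for a `k`-algebra `R` essentially of finite type: its
restriction to every connected component of `Spec R` is the canonical module there. The connected
components are the `Spec (R ⧸ (e))`, with `e` idempotent, that are connected. -/
def IsCanonicalModule (k R M : Type u) [Field k] [CommRing R] [Algebra k R]
    [AddCommGroup M] [Module R M] : Prop :=
  ∀ e : R, IsIdempotentElem e → ConnectedSpace (PrimeSpectrum (R ⧸ Ideal.span {e})) →
    IsCanonicalModuleOfConnected k (R ⧸ Ideal.span {e})
      (M ⧸ (Ideal.span {e} • ⊤ : Submodule R M))

/-- `K` is a canonical divisor of `Spec R`: `𝒪(K) ≅ ω_R`. -/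
def IsCanonicalDivisor (k : Type u) {R : Type u} [Field k] [CommRing R] [Algebra k R]
    [IsNoetherianRing R] [IsNormalRing R] (K : WeilDivisor R) : Prop :=
  IsCanonicalModule k R K.sections

/-- `R` is quasi-Gorenstein: `ω_R ≅ R`. -/
def IsQuasiGorenstein (k R : Type u) [Field k] [CommRing R] [Algebra k R] : Prop :=
  IsCanonicalModule k R R

/-- `Spec S → Spec R` is a finite cover, that is, finite and surjective. -/
def IsFiniteCover (R S : Type u) [CommRing R] [CommRing S] [Algebra R S] : Prop :=
  Module.Finite R S ∧ Function.Surjective (PrimeSpectrum.comap (algebraMap R S))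

/-- The `R`-algebra `S` is `R ⊕ 𝒪(K)` with the multiplication
`(a, b) (x, y) = (a x + b y f, a y + b x)`, where `b y f` is computed in the total ring of
fractions of `R` and has to lie in `R`. -/
def IsTwistedDouble {R : Type u} [CommRing R] [IsNoetherianRing R] [IsNormalRing R]
    (K : WeilDivisor R) (f : (FractionRing R)ˣ) (S : Type u) [CommRing S] [Algebra R S] : Prop :=
  ∃ Φ : (R × K.sections) ≃ₗ[R] S, ∀ (a x : R) (b y : K.sections), ∃ c : R,
    algebraMap R (FractionRing R) c =
      algebraMap R (FractionRing R) (a * x) + (b : FractionRing R) * (y : FractionRing R) * f ∧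
    Φ (a, b) * Φ (x, y) = Φ (c, a • y + x • b)

/-!
The base field need not be extended: everything below works over an arbitrary field `k` in which `2`
is invertible, so that `k' = k`.

*The divisor `H`.* A rational function `f` with `div f = H + 2K` is a section of `𝒪(-2K)` with divisor
of zeros `H`. To find one with `H` reduced on a component of the spectrum, take a pencil `G₁ + c G₂` of
sections of `𝒪(-2K)` (up to a common denominator), and a nonzero `k`-derivation `D` of the coordinate
ring of the component. If `D c = 0`, then a section that vanishes to second order along a prime makes the
Wronskian `G₂ D G₁ - G₁ D G₂` vanish there (`wronskian_mem`). As this Wronskian is not zero, only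
finitely many primes are critical, and at these the section is made nonvanishing by the choice of `c`:
an integer in characteristic zero, an `ℓ`-th power in characteristic `ℓ`
(`exists_constant_ringValuation_eq`). As `ℓ`-th powers of all functions are available, finite fields
pose no problem. This gives `exists_reduced_residual_of_component` and `exists_isReduced_isDivOf`.

*The algebra `S`.* Let `Q` be the total ring of fractions of `R`. The algebra `S = R ⊕ 𝒪(K) ω` lives
inside `Q[ω] ⧸ (ω² - f)` (`twistedDouble`). It is normal: if `a + b ω` is integral over `R`, then its
trace `2a` and its norm `a² - b² f` are in `R`; so `a` and `b² f` are in `R`, as `2` is a unit, and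
`b ∈ 𝒪(K)`, as `H` is reduced (`isNormalRing_twistedDouble`). Since `End_R 𝒪(K) = R`, the `S`-module
`Hom_R(S, 𝒪(K))` is free on the projection to the second summand
(`existsUnique_twistedDoubleSnd_mul`). For `𝒪(K) ≅ ω_R` this is the dual
`ω_S = Hom_R(S, ω_R)`, and hence `ω_S ≅ S` (`isQuasiGorenstein_of_frobenius`).

*Canonical modules.* The definition of `ω_T` through `Ext^c(T, B)`, with `B → T` surjective, `B` a
localization of a polynomial ring, is brought into an elementary form: the kernel contains a weakly
regular sequence `xs` of length its height `c` (`exists_isWeaklyRegular_height_eq`), and then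
`Ext^c(T, B) = Hom_B(T, B ⧸ (xs))` (`ext_of_isWeaklyRegular`). Such a description of a module as
`Hom_B(T, B ⧸ (xs))` is called `DualizingData`, and it makes sense for maps `B → T` that are finite but
not surjective. Adjoining to `B` a variable, mapped to the root `y ∈ T` of a monic polynomial `F`, and
appending `F` to `xs`, does not change `Hom_B(T, B ⧸ (xs))`, because `A[X] ⧸ (F)` has the top coefficient
as a Frobenius form over `A` (`Represents.exists_adjoinRoot`); so one can always return to surjective
maps (`DualizingData.exists_surjective`). This proves the duality `ω_S = Hom_R(S, ω_R)` for
components of `S` over components of `R`, and no comparison of different presentations is needed.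

*Canonical divisors.* A domain of finite type over `k` is finite over a polynomial ring `N`, and
`Hom_N(T, N)` is a fractional ideal of `T`, a codifferent (`exists_represents_codifferent`); the case of
domains essentially of finite type follows by localization
(`exists_isCanonicalModuleOfConnected_submodule`). This fractional ideal satisfies Serre's condition `S₂`,
so that it is of the form `𝒪(K)` if `T` is normal (`exists_sections_eq`). For a general normal ring the
fractional ideals of the components are put together (`exists_isCanonicalDivisor`).
-/

namespace QuasiGorenstein

/-! ### Ext modules and regular sequences -/

section Ext

open Abelian RingTheory.Sequence

variable {A : Type u} [CommRing A] {N : ModuleCat.{u} A}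

lemma smul_ext_eq_zero {r : A} (hr : r ∈ Module.annihilator A N) {M : ModuleCat.{u} A} {n : ℕ}
    (x : Ext N M n) : r • x = 0 := by
  have h0 : r • 𝟙 N = 0 := by
    simp [← ModuleCat.lsmul_eq_smul_id, Module.mem_annihilator_iff_lsmul_eq_zero.mp hr]
  have h : r • x = (Ext.mk₀ (r • 𝟙 N)).comp x (zero_add n) := by simp [Ext.mk₀_smul]
  rw [h, h0, Ext.mk₀_zero, Ext.zero_comp]

/-- If `r` is regular on `M` and kills `N`, the connecting homomorphism of
`0 → M → M → M ⧸ rM → 0` is onto `Ext N M (n + 1)`. -/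
lemma connecting_surjective {r : A} (hr : r ∈ Module.annihilator A N) {M : ModuleCat.{u} A}
    (reg : IsSMulRegular M r) (n : ℕ) :
    Function.Surjective
      (reg.smulShortComplex_shortExact.extClass.postcompOfLinear A N (a := n) rfl) := fun x =>
  Ext.covariant_sequence_exact₁ N reg.smulShortComplex_shortExact x
    ((Ext.smul_eq_comp_mk₀ (Y := M) x r).symm.trans (smul_ext_eq_zero hr x)) rfl

/-- The connecting homomorphism `Ext N (M ⧸ rM) n → Ext N M (n + 1)` is injective if `Ext N M n`
vanishes. -/
lemma connecting_injective {r : A} {M : ModuleCat.{u} A}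
    (reg : IsSMulRegular M r) (n : ℕ) [Subsingleton (Ext N M n)] :
    Function.Injective
      (reg.smulShortComplex_shortExact.extClass.postcompOfLinear A N (a := n) rfl) := by
  rw [injective_iff_map_eq_zero]
  intro x hx
  obtain ⟨y, rfl⟩ := Ext.covariant_sequence_exact₃ N reg.smulShortComplex_shortExact x rfl hx
  have : y = 0 := Subsingleton.elim (α := Ext N M n) _ _
  rw [this, Ext.zero_comp]

/-- Rees: a weakly `M`-regular sequence that kills `N` shifts `Ext` down to degree zero. -/
theorem ext_of_isWeaklyRegular (xs : List A) : ∀ (M : ModuleCat.{u} A),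
    IsWeaklyRegular M xs → (∀ x ∈ xs, x ∈ Module.annihilator A N) →
    (∀ i < xs.length, Subsingleton (Ext N M i)) ∧
    Nonempty (Ext N M xs.length ≃ₗ[A] (N →ₗ[A] M ⧸ (Ideal.ofList xs • ⊤ : Submodule A M))) := by
  induction xs with
  | nil =>
    refine fun M _ _ => ⟨fun i hi => absurd hi (Nat.not_lt_zero i), ⟨?_⟩⟩
    have h0 : (Ideal.ofList ([] : List A) • ⊤ : Submodule A M) = ⊥ := by simp
    exact (Ext.linearEquiv₀.trans ModuleCat.homLinearEquiv).trans
      (LinearEquiv.congrRight (Submodule.quotEquivOfEqBot _ h0).symm)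
  | cons r xs ih =>
    intro M hM hann
    obtain ⟨hr, hxs⟩ := (isWeaklyRegular_cons_iff M r xs).mp hM
    have hrN := hann r List.mem_cons_self
    obtain ⟨hvan, ⟨e⟩⟩ := ih (ModuleCat.of A (QuotSMulTop r M)) hxs
      fun x hx => hann x (List.mem_cons_of_mem _ hx)
    have hvan' : ∀ i < (r :: xs).length, Subsingleton (Ext N M i) := by
      intro i hi
      cases i with
      | zero =>
        have hsub : ∀ f : N ⟶ M, f = 0 := fun f => by
          ext x
          refine hr ?_
          change r • f.hom x = r • (0 : M)
          rw [← map_smul, Module.mem_annihilator.mp hrN, map_zero, smul_zero]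
        have : Subsingleton (N ⟶ M) := ⟨fun f g => by rw [hsub f, hsub g]⟩
        exact Ext.homEquiv₀.subsingleton
      | succ i =>
        have : Subsingleton (Ext N (ModuleCat.of A (QuotSMulTop r M)) i) :=
          hvan i (by simpa using hi)
        exact Function.Surjective.subsingleton (β := Ext N M (i + 1))
          (α := Ext N (ModuleCat.of A (QuotSMulTop r M)) i) (connecting_surjective hrN hr i)
    refine ⟨hvan', ⟨?_⟩⟩
    have := hvan' xs.length (by simp)
    exact (LinearEquiv.ofBijective _ ⟨connecting_injective hr xs.length,
        connecting_surjective hrN hr xs.length⟩).symm.trans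
      (e.trans (LinearEquiv.congrRight (Submodule.quotOfListConsSMulTopEquivQuotSMulTopInner M r xs).symm))

end Ext

/-! ### The Frobenius form of a monic extension -/

section Frobenius

open Polynomial

variable {B A U N : Type*} [CommRing B] [CommRing A] [CommRing U] [AddCommGroup N] [Module U N]

/-- The top coefficient `A[X] ⧸ (f) → A`, the Frobenius form of a monic extension. -/
noncomputable def topCoeff {f : A[X]} (hf : f.Monic) : AdjoinRoot f →ₗ[A] A :=
  (Polynomial.lcoeff A (f.natDegree - 1)).comp (AdjoinRoot.modByMonicHom hf)

lemma topCoeff_mk {f : A[X]} (hf : f.Monic) {p : A[X]} (hp : p.degree < f.degree) :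
    topCoeff hf (AdjoinRoot.mk f p) = p.coeff (f.natDegree - 1) := by
  cases subsingleton_or_nontrivial A
  · exact Subsingleton.elim _ _
  simp [topCoeff, AdjoinRoot.modByMonicHom_mk, (Polynomial.modByMonic_eq_self_iff hf).mpr hp]

/-- The top coefficient is a nondegenerate form: a power of the root moves the leading coefficient of
`z` to the top. -/
lemma eq_zero_of_topCoeff {f : A[X]} (hf : f.Monic) {z : AdjoinRoot f}
    (hz : ∀ j, topCoeff hf (AdjoinRoot.root f ^ j * z) = 0) : z = 0 := by
  cases subsingleton_or_nontrivial A
  · have := Module.subsingleton A (AdjoinRoot f)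
    exact Subsingleton.elim _ _
  obtain ⟨p, hp, rfl⟩ : ∃ p : A[X], p.degree < f.degree ∧ AdjoinRoot.mk f p = z := by
    obtain ⟨q, rfl⟩ := AdjoinRoot.mk_surjective z
    exact ⟨q %ₘ f, Polynomial.degree_modByMonic_lt _ hf, by
      rw [← AdjoinRoot.modByMonicHom_mk hf, AdjoinRoot.mk_leftInverse hf]⟩
  by_contra h0
  have hp0 : p ≠ 0 := fun h => h0 (by rw [h, map_zero])
  have hdeg : p.natDegree < f.natDegree := Polynomial.natDegree_lt_natDegree hp0 hp
  have h := hz (f.natDegree - 1 - p.natDegree)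
  rw [← AdjoinRoot.mk_X, ← map_pow, ← map_mul, topCoeff_mk] at h
  · have hx : f.natDegree - 1 = p.natDegree + (f.natDegree - 1 - p.natDegree) := by omega
    rw [Polynomial.coeff_X_pow_mul', if_pos (by omega)] at h
    have h2 : f.natDegree - 1 - (f.natDegree - 1 - p.natDegree) = p.natDegree := by omega
    rw [h2] at h
    exact hp0 (Polynomial.leadingCoeff_eq_zero.mp h)
  · rw [Polynomial.degree_eq_natDegree hf.ne_zero]
    refine lt_of_le_of_lt (Polynomial.degree_mul_le _ _) ?_
    rw [Polynomial.degree_X_pow, Polynomial.degree_eq_natDegree hp0]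
    norm_cast
    omega

lemma coeff_iterate_divX (p : A[X]) (i n : ℕ) : (divX^[i] p).coeff n = p.coeff (n + i) := by
  induction i generalizing n with
  | zero => simp
  | succ i ih => rw [Function.iterate_succ_apply', coeff_divX, ih, Nat.add_right_comm]; rfl

variable (ψ : B →+* U) (π : B →+* A) (y : U) (F : B[X])

/-- `B[X] → A[X] ⧸ (F)`, induced by `π : B → A`. -/
noncomputable def toAdjoinRoot : B[X] →+* AdjoinRoot (F.map π) :=
  (AdjoinRoot.mk (F.map π)).comp (mapRingHom π)

variable {ψ π y F}

lemma toAdjoinRoot_C (b : B) : toAdjoinRoot π F (C b) = AdjoinRoot.of (F.map π) (π b) := by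
  simp [toAdjoinRoot]

lemma toAdjoinRoot_X : toAdjoinRoot π F X = AdjoinRoot.root (F.map π) := by
  simp [toAdjoinRoot]

/-- An additive map that is linear over `B` and commutes with the variable is linear over `B[X]`. -/
lemma linear_of_C_of_X {E : Type*} [CommRing E] {π' : B[X] →+* E} {g : N →+ E}
    (hC : ∀ b n, g (ψ b • n) = π' (C b) * g n) (hX : ∀ n, g (y • n) = π' X * g n)
    (p : B[X]) (n : N) : g (eval₂RingHom ψ y p • n) = π' p * g n := by
  induction p using Polynomial.induction_on generalizing n with
  | C b => simpa using hC b n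
  | add p q hp hq => rw [map_add, add_smul, map_add, hp, hq, map_add, add_mul]
  | monomial m b ih =>
    have : (C b * X ^ (m + 1) : B[X]) = C b * X ^ m * X := by ring
    rw [this, map_mul, mul_smul, ih, coe_eval₂RingHom, eval₂_X, hX, ← mul_assoc, ← map_mul]

/-- Every `B`-linear map `h : N → A` lifts to a `B[X]`-linear map `g : N → A[X] ⧸ (F)` whose top
coefficient is `h`: with `b i` the `i`-th Horner quotient of `F`,
`g n = ∑ h (yⁱ n) b (i + 1)`. -/
lemma exists_lift (hF : F.Monic) (hd : 0 < F.natDegree) (hy : F.eval₂ ψ y = 0) (h : N →+ A)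
    (hh : ∀ b n, h (ψ b • n) = π b * h n) :
    ∃ g : N →+ AdjoinRoot (F.map π),
      (∀ p n, g (eval₂RingHom ψ y p • n) = toAdjoinRoot π F p * g n) ∧
      ∀ n, topCoeff (hF.map π) (g n) = h n := by
  cases subsingleton_or_nontrivial A
  · have := Module.subsingleton A (AdjoinRoot (F.map π))
    exact ⟨0, fun _ _ => Subsingleton.elim _ _, fun _ => Subsingleton.elim _ _⟩
  set f := F.map π with hf
  have hfm : f.Monic := hF.map π
  have hfd : f.natDegree = F.natDegree := hF.natDegree_map π
  set d := F.natDegree with hdef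
  set b : ℕ → AdjoinRoot f := fun i => AdjoinRoot.mk f (divX^[i] f) with hb
  have b0 : b 0 = 0 := by simp [hb]
  have bd : b d = 1 := by
    have : divX^[d] f = 1 := by
      ext n
      rw [coeff_iterate_divX, coeff_one]
      rcases n with _ | n
      · simpa [← hfd] using hfm.coeff_natDegree
      · rw [if_neg (by omega), coeff_eq_zero_of_natDegree_lt (by omega)]
    simp [hb, this]
  have brec : ∀ i, b i = b (i + 1) * AdjoinRoot.root f + AdjoinRoot.of f (π (F.coeff i)) := by
    intro i
    have h1 := Polynomial.divX_mul_X_add (divX^[i] f)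
    rw [coeff_iterate_divX, zero_add, ← Function.iterate_succ_apply' divX] at h1
    simp only [hb]
    conv_lhs => rw [← h1]
    simp [hf]
  let g : N →+ AdjoinRoot f :=
    { toFun := fun n => ∑ i ∈ Finset.range d, AdjoinRoot.of f (h (y ^ i • n)) * b (i + 1)
      map_zero' := by simp
      map_add' := fun m n => by
        rw [← Finset.sum_add_distrib]
        exact Finset.sum_congr rfl fun i _ => by rw [smul_add, map_add, map_add, add_mul] }
  have hgdef : ∀ n, g n = ∑ i ∈ Finset.range d, AdjoinRoot.of f (h (y ^ i • n)) * b (i + 1) :=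
    fun n => rfl
  refine ⟨g, linear_of_C_of_X ?_ ?_, ?_⟩
  · intro c n
    rw [toAdjoinRoot_C, hgdef, hgdef, Finset.mul_sum]
    refine Finset.sum_congr rfl fun i _ => ?_
    rw [smul_comm, hh, map_mul, mul_assoc]
  · intro n
    rw [toAdjoinRoot_X]
    have hyd : ∑ i ∈ Finset.range d, π (F.coeff i) * h (y ^ i • n) + h (y ^ d • n) = 0 := by
      have h1 : h (F.eval₂ ψ y • n) = 0 := by rw [hy, zero_smul, map_zero]
      rw [eval₂_eq_sum_range, ← hdef, Finset.sum_smul, map_sum, Finset.sum_range_succ] at h1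
      simp only [mul_smul, hh] at h1
      rwa [hF.coeff_natDegree, map_one, one_mul] at h1
    have hyd' : AdjoinRoot.of f (h (y ^ d • n)) =
        - ∑ i ∈ Finset.range d, AdjoinRoot.of f (π (F.coeff i)) * AdjoinRoot.of f (h (y ^ i • n)) := by
      rw [eq_neg_of_add_eq_zero_right hyd, map_neg, map_sum]
      simp only [map_mul]
    have key := Finset.sum_range_succ' (fun i => AdjoinRoot.of f (h (y ^ i • n)) * b i) d
    rw [Finset.sum_range_succ, b0, mul_zero, add_zero, bd, mul_one, hyd'] at key
    have lhs : g (y • n) = ∑ i ∈ Finset.range d,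
        AdjoinRoot.of f (h (y ^ (i + 1) • n)) * b (i + 1) :=
      (hgdef _).trans (Finset.sum_congr rfl fun i _ => by rw [pow_succ, mul_smul])
    rw [lhs, ← key, hgdef, Finset.mul_sum, ← sub_eq_add_neg, ← Finset.sum_sub_distrib]
    refine Finset.sum_congr rfl fun i _ => ?_
    rw [brec i]
    ring
  · intro n
    rw [hgdef, map_sum]
    have hterm : ∀ i, topCoeff hfm (AdjoinRoot.of f (h (y ^ i • n)) * b (i + 1)) =
        h (y ^ i • n) * f.coeff (d - 1 + (i + 1)) := by
      intro i
      rw [← AdjoinRoot.algebraMap_eq, ← Algebra.smul_def, map_smul, smul_eq_mul]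
      congr 1
      rw [topCoeff_mk, hfd, coeff_iterate_divX]
      rw [degree_eq_natDegree hfm.ne_zero, hfd]
      refine (degree_lt_iff_coeff_zero _ _).mpr fun m hm => ?_
      rw [coeff_iterate_divX]
      exact coeff_eq_zero_of_natDegree_lt (by omega)
    simp only [hterm]
    rw [Finset.sum_eq_single_of_mem 0 (Finset.mem_range.mpr hd)]
    · have : d - 1 + (0 + 1) = f.natDegree := by omega
      rw [this, hfm.coeff_natDegree]
      simp
    · intro i _ hi
      rw [coeff_eq_zero_of_natDegree_lt (by omega), mul_zero]

/-- A `B[X]`-linear map to `A[X] ⧸ (F)` is determined by its top coefficient. -/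
lemma lift_unique (hF : F.Monic) {g₁ g₂ : N →+ AdjoinRoot (F.map π)}
    (h₁ : ∀ p n, g₁ (eval₂RingHom ψ y p • n) = toAdjoinRoot π F p * g₁ n)
    (h₂ : ∀ p n, g₂ (eval₂RingHom ψ y p • n) = toAdjoinRoot π F p * g₂ n)
    (h : ∀ n, topCoeff (hF.map π) (g₁ n) = topCoeff (hF.map π) (g₂ n)) (n : N) : g₁ n = g₂ n := by
  rw [← sub_eq_zero]
  refine eq_zero_of_topCoeff (hF.map π) fun j => ?_
  have e1 := h₁ (X ^ j) n
  have e2 := h₂ (X ^ j) n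
  rw [map_pow (toAdjoinRoot π F), toAdjoinRoot_X] at e1 e2
  rw [mul_sub, ← e1, ← e2, map_sub, h, sub_self]

end Frobenius

/-! ### Modules that represent linear maps -/

section Represents

open Polynomial

variable {B A U M : Type*} [CommRing B] [CommRing A] [CommRing U] [AddCommGroup M] [Module U M]

/-- For ring homomorphisms `ψ : B → U` and `π : B → A`, the `U`-module `M` represents the
`B`-linear maps `U → A`, with `μ : M → A` in the role of evaluation at `1`. -/
structure Represents (ψ : B →+* U) (π : B →+* A) (μ : M →+ A) : Prop where
  map_smul : ∀ b m, μ (ψ b • m) = π b * μ m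
  existsUnique : ∀ h : U →+ A, (∀ b u, h (ψ b * u) = π b * h u) → ∃! m : M, ∀ u, h u = μ (u • m)

/-- A module that represents `Hom_B(U, A)` also represents `Hom_{B[X]}(U, A[X] ⧸ (F))`, where the
variable acts on `U` as a root `y` of the monic polynomial `F`. -/
lemma Represents.exists_adjoinRoot {ψ : B →+* U} {π : B →+* A} {μ : M →+ A}
    (hμ : Represents ψ π μ) {F : B[X]} (hF : F.Monic) (hd : 0 < F.natDegree) {y : U}
    (hy : F.eval₂ ψ y = 0) :
    ∃ μ' : M →+ AdjoinRoot (F.map π), Represents (eval₂RingHom ψ y) (toAdjoinRoot π F) μ' := by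
  obtain ⟨μ', hlin, htop⟩ := exists_lift (N := M) hF hd hy μ hμ.map_smul
  refine ⟨μ', hlin, fun h hh => ?_⟩
  let t : AdjoinRoot (F.map π) →+ A := (topCoeff (hF.map π)).toAddMonoidHom
  obtain ⟨m, hm, huniq⟩ := hμ.existsUnique (t.comp h) (fun b u => by
    have h1 := hh (C b) u
    rw [toAdjoinRoot_C, coe_eval₂RingHom, eval₂_C] at h1
    rw [AddMonoidHom.comp_apply, h1, ← AdjoinRoot.algebraMap_eq, ← Algebra.smul_def]
    exact (topCoeff (hF.map π)).map_smul _ _)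
  refine ⟨m, fun u => ?_, fun m' hm' => huniq m' fun u => ?_⟩
  · refine lift_unique (N := U) (ψ := ψ) (y := y) hF (g₁ := h)
      (g₂ := μ'.comp (LinearMap.toSpanSingleton U M m).toAddMonoidHom) hh (fun p u => ?_)
      (fun u => ?_) u
    · change μ' ((eval₂RingHom ψ y p • u) • m) = _ * μ' (u • m)
      rw [smul_assoc, hlin]
    · exact (hm u).trans (htop _).symm
  · exact (congrArg t (hm' u)).trans (htop _)

end Represents

/-! ### Heights of primes in polynomial rings -/

section Height

open Polynomial

/-- A prime of `R[X]` that contains a monic polynomial has height one more than its contraction. -/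
lemma height_eq_height_comap_add_one {R : Type*} [CommRing R] [IsNoetherianRing R]
    (P : Ideal R[X]) [P.IsPrime] {F : R[X]} (hF : F.Monic) (hFP : F ∈ P) :
    P.height = (P.comap C).height + 1 := by
  set p := P.comap C with hp
  have : P.LiesOver p := ⟨rfl⟩
  let Rₚ := Localization.AtPrime p
  let p' : Ideal Rₚ := p.map (algebraMap R Rₚ)
  have hmax : p'.IsMaximal := by
    have h : p' = IsLocalRing.maximalIdeal Rₚ := Localization.AtPrime.map_eq_maximalIdeal
    rw [h]
    exact IsLocalRing.maximalIdeal.isMaximal Rₚ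
  let _ : Algebra R[X] Rₚ[X] := Polynomial.algebra R Rₚ
  have : IsLocalization (p.primeCompl.map C) Rₚ[X] := Polynomial.isLocalization p.primeCompl Rₚ
  let P' : Ideal Rₚ[X] := P.map (algebraMap R[X] Rₚ[X])
  have disj : Disjoint (p.primeCompl.map C : Set R[X]) P := by
    refine Set.disjoint_left.mpr fun a ⟨b, hb⟩ ha ↦ hb.1 ?_
    have : C b ∈ P := by rw [hb.2]; exact ha
    exact this
  have hP' : P'.IsPrime := IsLocalization.isPrime_of_isPrime_disjoint _ _ P ‹_› disj
  have : P'.LiesOver p' := IsLocalization.liesOver_of_isPrime_of_disjoint p.primeCompl _ _ disj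
  have eq1 : p.height = p'.height := by
    rw [IsLocalization.height_map_of_disjoint p.primeCompl]
    exact Disjoint.symm <| Set.disjoint_left.mpr fun _ a b ↦ b a
  have eq2 : P.height = P'.height := by
    rw [IsLocalization.height_map_of_disjoint (Submonoid.map C <| p.primeCompl) _ disj]
  have hmax' : P'.IsMaximal := by
    have hF' : F.map (algebraMap R Rₚ) ∈ P' := Ideal.mem_map_of_mem (algebraMap R[X] Rₚ[X]) hFP
    have hint := (hF.map (algebraMap R Rₚ)).quotient_isIntegral hF'
    have hcm : (P'.comap (algebraMap Rₚ Rₚ[X])).IsMaximal := by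
      have : P'.comap (algebraMap Rₚ Rₚ[X]) = p' := (Ideal.over_def P' p').symm
      rw [this]; exact hmax
    have hbot : (⊥ : Ideal (Rₚ[X] ⧸ P')).IsMaximal :=
      Ideal.isMaximal_of_isIntegral_of_isMaximal_comap' _ hint ⊥ (by
        have h : (⊥ : Ideal (Rₚ[X] ⧸ P')).comap
            ((Ideal.Quotient.mkₐ Rₚ P').comp (Algebra.ofId Rₚ Rₚ[X])).toRingHom =
            P'.comap (algebraMap Rₚ Rₚ[X]) := by
          ext x
          exact Ideal.Quotient.eq_zero_iff_mem
        rwa [h])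
    exact Ideal.bot_quotient_isMaximal_iff P' |>.mp hbot
  rw [eq1, eq2]
  exact Polynomial.height_eq_height_add_one p' P'

end Height

/-! ### Localizations of polynomial rings -/

section LocPoly

open Polynomial RingTheory.Sequence

/-- `B` is a localization of the polynomial ring over `k` in `n` variables. -/
def IsLocPoly (k : Type u) (n : ℕ) (B : Type u) [Field k] [CommRing B] [Algebra k B] : Prop :=
  ∃ W : Submonoid (MvPolynomial (Fin n) k), Nonempty (Localization W ≃ₐ[k] B)

variable {k : Type u} [Field k]

lemma isLocPoly_of_isLocalization {n : ℕ} {B : Type u} [CommRing B] [Algebra k B]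
    [Algebra (MvPolynomial (Fin n) k) B] [IsScalarTower k (MvPolynomial (Fin n) k) B]
    (W : Submonoid (MvPolynomial (Fin n) k)) [IsLocalization W B] : IsLocPoly k n B :=
  ⟨W, ⟨(IsLocalization.algEquiv W (Localization W) B).restrictScalars k⟩⟩

lemma isLocPoly_mvPolynomial (n : ℕ) : IsLocPoly k n (MvPolynomial (Fin n) k) :=
  ⟨⊥, ⟨(IsLocalization.atUnits _ ⊥ (S := Localization (⊥ : Submonoid (MvPolynomial (Fin n) k)))
    bot_le).symm.restrictScalars k⟩⟩

namespace IsLocPoly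

variable {n : ℕ} {B : Type u} [CommRing B] [Algebra k B]

lemma exists_algebra (h : IsLocPoly k n B) :
    ∃ (_ : Algebra (MvPolynomial (Fin n) k) B) (_ : IsScalarTower k (MvPolynomial (Fin n) k) B)
      (W : Submonoid (MvPolynomial (Fin n) k)), IsLocalization W B := by
  obtain ⟨W, ⟨e⟩⟩ := h
  let _ : Algebra (MvPolynomial (Fin n) k) B :=
    (e.toRingEquiv.toRingHom.comp (algebraMap _ (Localization W))).toAlgebra
  have hst : IsScalarTower k (MvPolynomial (Fin n) k) B := IsScalarTower.of_algebraMap_eq fun r => by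
    rw [RingHom.algebraMap_toAlgebra, RingHom.comp_apply, ← IsScalarTower.algebraMap_apply]
    exact (e.commutes r).symm
  exact ⟨inferInstance, hst, W, IsLocalization.isLocalization_of_algEquiv W
    (AlgEquiv.ofRingEquiv (f := e.toRingEquiv) fun _ => rfl)⟩

lemma isNoetherianRing (h : IsLocPoly k n B) : IsNoetherianRing B := by
  obtain ⟨_, _, W, _⟩ := h.exists_algebra
  exact IsLocalization.isNoetherianRing W B inferInstance

lemma localization (h : IsLocPoly k n B) (W : Submonoid B) (B' : Type u) [CommRing B']
    [Algebra k B'] [Algebra B B'] [IsScalarTower k B B'] [IsLocalization W B'] :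
    IsLocPoly k n B' := by
  obtain ⟨_, _, V, _⟩ := h.exists_algebra
  let _ : Algebra (MvPolynomial (Fin n) k) B' :=
    ((algebraMap B B').comp (algebraMap (MvPolynomial (Fin n) k) B)).toAlgebra
  have : IsScalarTower (MvPolynomial (Fin n) k) B B' := IsScalarTower.of_algebraMap_eq fun _ => rfl
  have : IsScalarTower k (MvPolynomial (Fin n) k) B' := IsScalarTower.of_algebraMap_eq fun r => by
    rw [IsScalarTower.algebraMap_apply (MvPolynomial (Fin n) k) B B',
      ← IsScalarTower.algebraMap_apply k (MvPolynomial (Fin n) k) B,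
      ← IsScalarTower.algebraMap_apply k B B']
  have := IsLocalization.localization_localization_isLocalization V W B'
  exact isLocPoly_of_isLocalization (IsLocalization.localizationLocalizationSubmodule V W)

lemma polynomial (h : IsLocPoly k n B) : IsLocPoly k (n + 1) B[X] := by
  obtain ⟨_, _, V, _⟩ := h.exists_algebra
  let _ : Algebra (MvPolynomial (Fin n) k)[X] B[X] := Polynomial.algebra _ _
  have : IsLocalization (V.map (C : _ →+* (MvPolynomial (Fin n) k)[X])) B[X] :=
    Polynomial.isLocalization V B
  let e := (MvPolynomial.finSuccEquiv k n).symm.toRingEquiv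
  let _ : Algebra (MvPolynomial (Fin (n + 1)) k) B[X] :=
    ((algebraMap (MvPolynomial (Fin n) k)[X] B[X]).comp e.symm.toRingHom).toAlgebra
  have : IsLocalization ((V.map (C : _ →+* (MvPolynomial (Fin n) k)[X])).map e) B[X] :=
    IsLocalization.isLocalization_of_base_ringEquiv _ _ e
  have : IsScalarTower k (MvPolynomial (Fin (n + 1)) k) B[X] :=
    IsScalarTower.of_algebraMap_eq fun r => by
      have h1 : e.symm (algebraMap k _ r) = C (MvPolynomial.C r) :=
        (MvPolynomial.finSuccEquiv k n).commutes r
      rw [RingHom.algebraMap_toAlgebra, RingHom.comp_apply]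
      change _ = algebraMap (MvPolynomial (Fin n) k)[X] B[X] (e.symm _)
      rw [h1, Polynomial.algebraMap_def, coe_mapRingHom, map_C, ← MvPolynomial.algebraMap_eq,
        ← IsScalarTower.algebraMap_apply]
      rfl
  exact isLocPoly_of_isLocalization ((V.map (C : _ →+* (MvPolynomial (Fin n) k)[X])).map e)

end IsLocPoly

/-- Appending a monic polynomial keeps a sequence weakly regular. -/
lemma isWeaklyRegular_append_monic {B : Type*} [CommRing B] {xs : List B}
    (h : IsWeaklyRegular B xs) {F : B[X]} (hF : F.Monic) :
    IsWeaklyRegular B[X] (xs.map C ++ [F]) := by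
  rw [isWeaklyRegular_append_iff]
  refine ⟨h.of_flat (S := B[X]), ?_⟩
  rw [isWeaklyRegular_cons_iff]
  refine ⟨?_, .nil _ _⟩
  have hI : (Ideal.ofList (xs.map C) • ⊤ : Submodule B[X] B[X]) =
      RingHom.ker (mapRingHom (Ideal.Quotient.mk (Ideal.ofList xs))) := by
    rw [Polynomial.ker_mapRingHom, Ideal.mk_ker, Ideal.map_ofList, Ideal.smul_eq_mul, Ideal.mul_top]
  intro a b hab
  obtain ⟨p, rfl⟩ := Submodule.Quotient.mk_surjective _ a
  obtain ⟨q, rfl⟩ := Submodule.Quotient.mk_surjective _ b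
  simp only [← Submodule.Quotient.mk_smul] at hab
  rw [Submodule.Quotient.eq, hI, RingHom.mem_ker] at hab ⊢
  rw [← smul_sub, smul_eq_mul, map_mul] at hab
  exact (hF.map _).isRegular.left (by simpa using hab)

lemma toAdjoinRoot_surjective {B A : Type*} [CommRing B] [CommRing A] {π : B →+* A}
    (hπ : Function.Surjective π) (F : B[X]) : Function.Surjective (toAdjoinRoot π F) :=
  AdjoinRoot.mk_surjective.comp (Polynomial.map_surjective π hπ)

lemma ker_toAdjoinRoot {B A : Type*} [CommRing B] [CommRing A] {π : B →+* A}
    (hπ : Function.Surjective π) {xs : List B} (hker : RingHom.ker π = Ideal.ofList xs)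
    (F : B[X]) : RingHom.ker (toAdjoinRoot π F) = Ideal.ofList (xs.map C ++ [F]) := by
  rw [toAdjoinRoot, ← RingHom.comap_ker]
  have h1 : RingHom.ker (AdjoinRoot.mk (F.map π)) = Ideal.span {F.map π} := Ideal.mk_ker
  have h2 : Ideal.span {F.map π} = (Ideal.span {F}).map (mapRingHom π) := by
    rw [Ideal.map_span, Set.image_singleton, coe_mapRingHom]
  rw [h1, h2, Ideal.comap_map_of_surjective _ (Polynomial.map_surjective π hπ),
    ← RingHom.ker_eq_comap_bot, Polynomial.ker_mapRingHom, hker, Ideal.map_ofList,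
    Ideal.ofList_append, Ideal.ofList_singleton, sup_comm]

end LocPoly

/-! ### Presentations of canonical modules -/

section Presentation

open Polynomial RingTheory.Sequence

/-- A presentation of the module `M` over the `k`-algebra `U` as `Hom_B(U, A)`, where `A` is the
quotient of a localization `B` of a polynomial ring by a weakly regular sequence `xs` that dies
in `U`, of the maximal possible length. The map `ψ : B → U` need not be surjective. -/
structure DualizingData (k U M : Type u) [Field k] [CommRing U] [Algebra k U]
    [AddCommGroup M] [Module U M] where
  n : ℕ
  B : Type u
  [commRingB : CommRing B]
  [algebraB : Algebra k B]
  isLocPoly : IsLocPoly k n B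
  A : Type u
  [commRingA : CommRing A]
  xs : List B
  isWeaklyRegular : IsWeaklyRegular B xs
  π : B →+* A
  π_surjective : Function.Surjective π
  ker_π : RingHom.ker π = Ideal.ofList xs
  ψ : B →ₐ[k] U
  ψ_xs : ∀ x ∈ xs, ψ x = 0
  height_ker : (RingHom.ker ψ).height = xs.length
  μ : M →+ A
  represents : Represents (ψ : B →+* U) π μ

namespace DualizingData

attribute [instance] commRingB algebraB commRingA

variable {k U M : Type u} [Field k] [CommRing U] [Algebra k U] [AddCommGroup M] [Module U M]

/-- Adjoining to `B` a variable that maps to a root `y` of a monic polynomial. -/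
lemma exists_adjoin [IsDomain U] (D : DualizingData k U M) {y : U}
    (hy : (D.ψ : D.B →+* U).IsIntegralElem y) :
    ∃ (D' : DualizingData k U M) (ι : D.B →+* D'.B),
      (D'.ψ : D'.B →+* U).comp ι = D.ψ ∧ ∃ b, D'.ψ b = y := by
  obtain ⟨F₀, hF₀, hy₀⟩ := hy
  have : Nontrivial D.B := RingHom.domain_nontrivial (D.ψ : D.B →+* U)
  -- The factor `X` ensures positive degree.
  obtain ⟨F, hF, hd, hFy⟩ : ∃ F : D.B[X], F.Monic ∧ 0 < F.natDegree ∧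
      F.eval₂ (D.ψ : D.B →+* U) y = 0 :=
    ⟨F₀ * X, hF₀.mul monic_X, by rw [hF₀.natDegree_mul monic_X, natDegree_X]; omega, by
      rw [eval₂_mul, hy₀, zero_mul]⟩
  obtain ⟨μ', hμ'⟩ := D.represents.exists_adjoinRoot hF hd hFy
  let ψ' : D.B[X] →ₐ[k] U := { eval₂RingHom (D.ψ : D.B →+* U) y with
    commutes' := fun r => by
      change eval₂ (D.ψ : D.B →+* U) y (C (algebraMap k D.B r)) = _
      rw [eval₂_C]
      exact D.ψ.commutes r }
  have hψ' : (ψ' : D.B[X] →+* U) = eval₂RingHom (D.ψ : D.B →+* U) y := rfl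
  have hψC : ∀ b, ψ' (C b) = D.ψ b := fun b => eval₂_C _ _
  have hψF : ψ' F = 0 := hFy
  have := D.isLocPoly.isNoetherianRing
  have hprime : (RingHom.ker ψ').IsPrime := RingHom.ker_isPrime ψ'
  refine ⟨{
    n := D.n + 1
    B := D.B[X]
    isLocPoly := D.isLocPoly.polynomial
    A := AdjoinRoot (F.map D.π)
    xs := D.xs.map C ++ [F]
    isWeaklyRegular := isWeaklyRegular_append_monic D.isWeaklyRegular hF
    π := toAdjoinRoot D.π F
    π_surjective := toAdjoinRoot_surjective D.π_surjective F
    ker_π := ker_toAdjoinRoot D.π_surjective D.ker_π F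
    ψ := ψ'
    ψ_xs := fun x hx => by
      rcases List.mem_append.mp hx with h | h
      · obtain ⟨b, hb, rfl⟩ := List.mem_map.mp h
        rw [hψC, D.ψ_xs b hb]
      · rw [List.mem_singleton.mp h, hψF]
    height_ker := by
      rw [height_eq_height_comap_add_one _ hF (RingHom.mem_ker.mpr hψF)]
      have : (RingHom.ker ψ').comap C = RingHom.ker D.ψ := by
        ext b
        rw [Ideal.mem_comap, RingHom.mem_ker, RingHom.mem_ker, hψC]
      rw [this, D.height_ker]
      simp
    μ := μ'
    represents := hμ' }, C, ?_, X, eval₂_X _ _⟩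
  ext b
  exact hψC b

/-- Finitely many integral elements can be put into the image of `B → U`. -/
lemma exists_forall_mem_range [IsDomain U] (l : List U) : ∀ D : DualizingData k U M,
    (∀ y ∈ l, (D.ψ : D.B →+* U).IsIntegralElem y) →
    ∃ (D' : DualizingData k U M) (ι : D.B →+* D'.B),
      (D'.ψ : D'.B →+* U).comp ι = D.ψ ∧ ∀ y ∈ l, ∃ b, D'.ψ b = y := by
  induction l with
  | nil => exact fun D _ => ⟨D, RingHom.id _, rfl, by simp⟩
  | cons y l ih =>
    intro D hD
    obtain ⟨D₁, ι₁, h₁, b₁, hb₁⟩ := D.exists_adjoin (hD y List.mem_cons_self)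
    obtain ⟨D₂, ι₂, h₂, hl⟩ := ih D₁ fun z hz => by
      obtain ⟨p, hp, hpz⟩ := hD z (List.mem_cons_of_mem _ hz)
      refine ⟨p.map ι₁, hp.map _, ?_⟩
      rw [eval₂_map, h₁, hpz]
    refine ⟨D₂, ι₂.comp ι₁, by rw [← RingHom.comp_assoc, h₂, h₁], fun z hz => ?_⟩
    rcases List.mem_cons.mp hz with rfl | hz
    · exact ⟨ι₂ b₁, (RingHom.congr_fun h₂ b₁).trans hb₁⟩
    · exact hl z hz

/-- If `U` is finite over `B`, enough variables can be adjoined to make `B → U` surjective. -/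
lemma exists_surjective [IsDomain U] (D : DualizingData k U M) (hfin : D.ψ.toRingHom.Finite) :
    ∃ D' : DualizingData k U M, Function.Surjective D'.ψ := by
  algebraize [D.ψ.toRingHom]
  obtain ⟨s, hs⟩ := Module.Finite.fg_top (R := D.B) (M := U)
  obtain ⟨D', ι, hι, hl⟩ := exists_forall_mem_range s.toList D fun y _ => hfin.to_isIntegral y
  refine ⟨D', fun u => ?_⟩
  have hu : u ∈ Submodule.span D.B (s : Set U) := hs ▸ Submodule.mem_top
  induction hu using Submodule.span_induction with
  | mem x hx => exact hl x (Finset.mem_toList.mpr hx)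
  | zero => exact ⟨0, map_zero _⟩
  | add x y _ _ hx hy =>
    obtain ⟨⟨a, rfl⟩, b, rfl⟩ := And.intro hx hy
    exact ⟨a + b, map_add _ _ _⟩
  | smul b x _ hx =>
    obtain ⟨a, rfl⟩ := hx
    refine ⟨ι b * a, ?_⟩
    rw [map_mul, Algebra.smul_def]
    congr 1
    exact RingHom.congr_fun hι b

end DualizingData

end Presentation

/-! ### Comparison with Ext modules -/

section Canonical

open RingTheory.Sequence

variable {k U M : Type u} [Field k] [CommRing U] [Algebra k U] [AddCommGroup M] [Module U M]

/-- For surjective `ψ`, a linear map out of `U` is determined by the image of `1`, and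
representability describes the image of `μ`. -/
lemma Represents.of_surjective {B A : Type*} [CommRing B] [CommRing A] {ψ : B →+* U} {π : B →+* A}
    {μ : M →+ A} (hψ : Function.Surjective ψ) (hsmul : ∀ b m, μ (ψ b • m) = π b * μ m)
    (hinj : Function.Injective μ)
    (hrange : ∀ a, (∀ b, ψ b = 0 → π b * a = 0) → ∃ m, μ m = a) : Represents ψ π μ := by
  refine ⟨hsmul, fun h hh => ?_⟩
  obtain ⟨m, hm⟩ := hrange (h 1) fun b hb => by rw [← hh, hb, zero_mul, map_zero]
  refine ⟨m, fun u => ?_, fun m' hm' => hinj ?_⟩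
  · obtain ⟨b, rfl⟩ := hψ u
    rw [hsmul, hm, ← hh, mul_one]
  · rw [hm, hm', one_smul]

lemma Represents.injective {B A : Type*} [CommRing B] [CommRing A] {ψ : B →+* U} {π : B →+* A}
    {μ : M →+ A} (hμ : Represents ψ π μ) (hψ : Function.Surjective ψ) : Function.Injective μ := by
  rw [injective_iff_map_eq_zero]
  intro m hm
  obtain ⟨m₀, _, h0⟩ := hμ.existsUnique 0 fun b u => by simp
  rw [h0 m fun u => ?_, h0 0 fun u => by simp]
  obtain ⟨b, rfl⟩ := hψ u
  simp [hμ.map_smul, hm]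

/-- For a surjective `ψ : B → U`, a linear map `U → A` can be prescribed at `1` by any element that is
killed by the kernel of `ψ`. -/
lemma exists_addMonoidHom_one {B A : Type*} [CommRing B] [CommRing A] {ψ : B →+* U} {π : B →+* A}
    (hψ : Function.Surjective ψ) {a : A} (ha : ∀ b, ψ b = 0 → π b * a = 0) :
    ∃ h : U →+ A, (∀ b u, h (ψ b * u) = π b * h u) ∧ h 1 = a := by
  have hwd : ∀ b b', ψ b = ψ b' → π b * a = π b' * a := fun b b' h => by
    rw [← sub_eq_zero, ← sub_mul, ← map_sub]
    exact ha _ (by rw [map_sub, h, sub_self])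
  have hs := Function.surjInv_eq hψ
  let h : U →+ A :=
    { toFun := fun u => π (Function.surjInv hψ u) * a
      map_zero' := ha _ (hs 0)
      map_add' := fun u v => by
        rw [← add_mul, ← map_add]
        exact hwd _ _ (by rw [map_add, hs, hs, hs]) }
  refine ⟨h, fun b u => ?_, (hwd _ 1 (by rw [hs, map_one])).trans (by rw [map_one, one_mul])⟩
  change π _ * a = π b * (π _ * a)
  rw [← mul_assoc, ← map_mul]
  exact hwd _ _ (by rw [map_mul, hs, hs])

lemma Represents.exists_eq {B A : Type*} [CommRing B] [CommRing A] {ψ : B →+* U} {π : B →+* A}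
    {μ : M →+ A} (hμ : Represents ψ π μ) (hψ : Function.Surjective ψ) {a : A}
    (ha : ∀ b, ψ b = 0 → π b * a = 0) : ∃ m, μ m = a := by
  obtain ⟨h, hh, h1⟩ := exists_addMonoidHom_one hψ ha
  obtain ⟨m, hm, _⟩ := hμ.existsUnique h hh
  exact ⟨m, by rw [← h1, hm, one_smul]⟩

/-- For a surjective `ψ : B → U`, representing the `B`-linear maps `U → B ⧸ (xs)` is the same as
being isomorphic to `Ext^c(U, B)`, where `c` is the length of the weakly regular sequence `xs`. -/
lemma exists_represents_iff {B : Type u} [CommRing B] {A : Type u} [CommRing A] {ψ : B →+* U}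
    (hψ : Function.Surjective ψ) {xs : List B} (hxs : IsWeaklyRegular B xs)
    (hψxs : ∀ x ∈ xs, ψ x = 0) {π : B →+* A} (hπ : Function.Surjective π)
    (hker : RingHom.ker π = Ideal.ofList xs) :
    (∃ μ : M →+ A, Represents ψ π μ) ↔
      Nonempty ((ModuleCat.restrictScalars.{u} ψ).obj (ModuleCat.of U M) ≅
        ModuleCat.of B (Abelian.Ext.{u} ((ModuleCat.restrictScalars.{u} ψ).obj (ModuleCat.of U U))
          (ModuleCat.of B B) xs.length)) := by
  let _ : Module B A := Module.compHom A π
  obtain ⟨-, ⟨e₀⟩⟩ := ext_of_isWeaklyRegular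
    (N := (ModuleCat.restrictScalars.{u} ψ).obj (ModuleCat.of U U)) xs (ModuleCat.of B B) hxs
    (fun x hx => Module.mem_annihilator.mpr fun u => by
      rw [ModuleCat.restrictScalars.smul_def, hψxs x hx]
      exact zero_smul U u)
  let πl : B →ₗ[B] A :=
    { toFun := π, map_add' := map_add π, map_smul' := fun b c => map_mul π b c }
  have hk : (Ideal.ofList xs • ⊤ : Submodule B B) = LinearMap.ker πl := by
    rw [Ideal.smul_eq_mul, Ideal.mul_top, ← hker]
    rfl
  let e := e₀.trans (LinearEquiv.congrRight ((Submodule.quotEquivOfEq _ _ hk).trans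
    (πl.quotKerEquivOfSurjective hπ)))
  constructor
  · rintro ⟨μ, hμ⟩
    let θ : (ModuleCat.restrictScalars.{u} ψ).obj (ModuleCat.of U M) →ₗ[B]
        ((ModuleCat.restrictScalars.{u} ψ).obj (ModuleCat.of U U) →ₗ[B] A) :=
      { toFun := fun m : M =>
          { toFun := fun u : U => μ (u • m)
            map_add' := fun u v : U => (congrArg μ (add_smul u v m)).trans (map_add μ _ _)
            map_smul' := fun (b : B) (u : U) => (congrArg μ (mul_smul (ψ b) u m)).trans
              (hμ.map_smul b _) }
        map_add' := fun m n : M => LinearMap.ext fun u : U =>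
          (congrArg μ (smul_add u m n)).trans (map_add μ _ _)
        map_smul' := fun (b : B) (m : M) => LinearMap.ext fun u : U =>
          (congrArg μ (smul_comm u (ψ b) m)).trans (hμ.map_smul b _) }
    have hθ : Function.Bijective θ := by
      refine ⟨fun m n hmn => ?_, fun h => ?_⟩
      · refine hμ.injective hψ ?_
        have := LinearMap.congr_fun hmn (1 : U)
        change μ ((1 : U) • (m : M)) = μ ((1 : U) • (n : M)) at this
        rwa [one_smul, one_smul] at this
      · obtain ⟨m, hm, -⟩ := hμ.existsUnique h.toAddMonoidHom fun b u => h.map_smul b u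
        exact ⟨m, LinearMap.ext fun u => (hm u).symm⟩
    exact ⟨((LinearEquiv.ofBijective θ hθ).trans e.symm).toModuleIso⟩
  · rintro ⟨i⟩
    let θ := i.toLinearEquiv.trans e
    have hθ : ∀ (m : M) (b : B), θ m (ψ b) = π b * θ m (1 : U) := fun m b => by
      rw [← mul_one (ψ b)]
      exact (θ m).map_smul b (1 : U)
    let μ : M →+ A :=
      { toFun := fun m => θ m (1 : U)
        map_zero' := by
          have : θ (0 : M) = 0 := map_zero θ
          rw [this]
          rfl
        map_add' := fun m n => by
          have : θ (m + n) = θ m + θ n := map_add θ _ _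
          rw [this]
          rfl }
    refine ⟨μ, .of_surjective hψ (fun b m => ?_) (fun m n hmn => ?_) fun a ha => ?_⟩
    · have : θ (ψ b • m) = b • θ m := θ.map_smul b m
      change θ (ψ b • m) (1 : U) = _
      rw [this]
      rfl
    · refine θ.injective (LinearMap.ext fun u => ?_)
      obtain ⟨b, hb⟩ := hψ u
      have hmn' : θ m (1 : U) = θ n (1 : U) := hmn
      have := hθ m b
      rw [hmn', ← hθ n b, hb] at this
      exact this
    · obtain ⟨h, hh, h1⟩ := exists_addMonoidHom_one hψ ha
      let h' : (ModuleCat.restrictScalars.{u} ψ).obj (ModuleCat.of U U) →ₗ[B] A :=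
        { toFun := h, map_add' := map_add h, map_smul' := hh }
      refine ⟨θ.symm h', ?_⟩
      change θ (θ.symm h') (1 : U) = a
      rw [θ.apply_symm_apply]
      exact h1

/-- A module with a presentation that comes from a surjective map is a canonical module. -/
lemma DualizingData.isCanonicalModuleOfConnected (D : DualizingData k U M)
    (hD : Function.Surjective D.ψ) : IsCanonicalModuleOfConnected k U M := by
  obtain ⟨W, ⟨e⟩⟩ := D.isLocPoly
  let φ : Localization W →ₐ[k] U := D.ψ.comp e.toAlgHom
  have hφ : Function.Surjective φ := hD.comp e.surjective
  have hw : IsWeaklyRegular (Localization W) (D.xs.map e.symm) := by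
    refine (AddEquiv.isWeaklyRegular_congr (e := e.symm.toRingEquiv.toAddEquiv)
      (List.forall₂_map_right_iff.mpr (List.forall₂_same.mpr fun r _ x => ?_))).mp D.isWeaklyRegular
    exact map_mul e.symm r x
  refine ⟨D.n, W, φ, D.xs.length, hφ, ?_, ?_⟩
  · rw [← D.height_ker, ← RingEquiv.height_comap e.toRingEquiv]
    rfl
  · have hlen : D.xs.length = (D.xs.map e.symm).length := (List.length_map _).symm
    rw [hlen]
    refine (exists_represents_iff (A := D.A) (ψ := φ.toRingHom)
      (π := D.π.comp e.toRingEquiv.toRingHom) hφ hw ?_ (D.π_surjective.comp e.surjective) ?_).mp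
      ⟨D.μ, fun b m => D.represents.map_smul (e b) m, fun h hh =>
        D.represents.existsUnique h fun b u => ?_⟩
    · intro x hx
      obtain ⟨y, hy, rfl⟩ := List.mem_map.mp hx
      change D.ψ (e (e.symm y)) = 0
      rw [e.apply_symm_apply, D.ψ_xs y hy]
    · rw [← RingHom.comap_ker, D.ker_π]
      have h1 : D.xs.map e.symm = D.xs.map (e.symm.toRingEquiv.toRingHom) := rfl
      rw [h1, ← Ideal.map_ofList]
      exact Ideal.comap_symm (f := e.symm.toRingEquiv)
    · have := hh (e.symm b) u
      change h (D.ψ (e (e.symm b)) * u) = D.π (e (e.symm b)) * h u at this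
      rwa [e.apply_symm_apply] at this

end Canonical

/-! ### Nagata's change of variables -/

section Nagata

open MvPolynomial

variable {k : Type*} [Field k] {n : ℕ}

/-- Nagata's substitution `X₀ ↦ X₀`, `Xᵢ ↦ Xᵢ + c X₀ ^ (Nⁱ)`. -/
noncomputable def nagataHom (N : ℕ) (c : k) :
    MvPolynomial (Fin (n + 1)) k →ₐ[k] MvPolynomial (Fin (n + 1)) k :=
  aeval fun i ↦ if i = 0 then X 0 else X i + c • X 0 ^ (N ^ (i : ℕ))

lemma nagataHom_X_zero (N : ℕ) (c : k) : nagataHom (n := n) N c (X 0) = X 0 := by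
  simp [nagataHom]

lemma nagataHom_X_succ (N : ℕ) (c : k) (i : Fin n) :
    nagataHom N c (X i.succ) = X i.succ + c • X 0 ^ (N ^ (i.succ : ℕ)) := by
  rw [nagataHom, aeval_X, if_neg (Fin.succ_ne_zero i)]

lemma nagataHom_comp_neg (N : ℕ) (c : k) :
    (nagataHom (n := n) N c).comp (nagataHom N (-c)) = AlgHom.id _ _ := by
  ext1 i
  rw [AlgHom.comp_apply]
  cases i using Fin.cases with
  | zero => rw [nagataHom_X_zero, nagataHom_X_zero, AlgHom.id_apply]
  | succ i =>
    rw [nagataHom_X_succ, map_add, map_smul, map_pow, nagataHom_X_zero, nagataHom_X_succ,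
      AlgHom.id_apply, neg_smul, add_neg_cancel_right]

/-- Nagata's substitution as an automorphism of the polynomial ring. -/
noncomputable def nagataEquiv (N : ℕ) :
    MvPolynomial (Fin (n + 1)) k ≃ₐ[k] MvPolynomial (Fin (n + 1)) k :=
  AlgEquiv.ofAlgHom (nagataHom N 1) (nagataHom N (-1)) (nagataHom_comp_neg N 1)
    (by simpa using nagataHom_comp_neg (n := n) N (-1 : k))

lemma finSuccEquiv_nagataEquiv_X {N : ℕ} (hN : 0 < N) (i : Fin (n + 1)) :
    (finSuccEquiv k n (nagataEquiv N (X i))).Monic ∧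
      (finSuccEquiv k n (nagataEquiv N (X i))).natDegree = N ^ (i : ℕ) := by
  have h : nagataEquiv (k := k) (n := n) N (X i) = nagataHom N 1 (X i) := rfl
  rw [h]
  cases i using Fin.cases with
  | zero =>
    rw [nagataHom_X_zero, finSuccEquiv_X_zero]
    exact ⟨Polynomial.monic_X, by simp⟩
  | succ i =>
    rw [nagataHom_X_succ, one_smul, map_add, map_pow, finSuccEquiv_X_zero, finSuccEquiv_X_succ,
      add_comm]
    exact ⟨Polynomial.monic_X_pow_add_C _ (pow_pos hN _).ne', Polynomial.natDegree_X_pow_add_C⟩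

/-- The image of a monomial with exponents `v` has the leading coefficient of the monomial and
degree `∑ vᵢ Nⁱ`. -/
lemma finSuccEquiv_nagataEquiv_monomial {N : ℕ} (hN : 0 < N) (v : Fin (n + 1) →₀ ℕ) {a : k}
    (ha : a ≠ 0) :
    (finSuccEquiv k n (nagataEquiv N (monomial v a))).leadingCoeff = C a ∧
      (finSuccEquiv k n (nagataEquiv N (monomial v a))).natDegree =
        ∑ i : Fin (n + 1), v i * N ^ (i : ℕ) := by
  have hm : (∏ i, finSuccEquiv k n (nagataEquiv N (X i)) ^ v i).Monic :=
    Polynomial.monic_prod_of_monic _ _ fun i _ => (finSuccEquiv_nagataEquiv_X hN i).1.pow _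
  have hC : finSuccEquiv k n (nagataEquiv N (C a)) = Polynomial.C (C a) :=
    ((finSuccEquiv k n).commutes a ▸ congrArg (finSuccEquiv k n)
      ((nagataEquiv (k := k) (n := n) N).commutes a) : _)
  rw [monomial_eq, Finsupp.prod_fintype _ _ fun i => pow_zero _]
  simp only [map_mul, map_prod, map_pow, hC]
  refine ⟨by rw [Polynomial.leadingCoeff_mul, Polynomial.leadingCoeff_C, hm.leadingCoeff, mul_one], ?_⟩
  rw [Polynomial.natDegree_C_mul_of_mul_ne_zero (by rw [hm.leadingCoeff, mul_one]; simpa using ha),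
    Polynomial.natDegree_prod_of_monic _ _ fun i _ => (finSuccEquiv_nagataEquiv_X hN i).1.pow _]
  exact Finset.sum_congr rfl fun i _ => by
    rw [(finSuccEquiv_nagataEquiv_X hN i).1.natDegree_pow, (finSuccEquiv_nagataEquiv_X hN i).2]

/-- A nonzero polynomial becomes monic in one of the variables, up to a unit, after an automorphism
of the polynomial ring. -/
lemma exists_algEquiv_isUnit_leadingCoeff {f : MvPolynomial (Fin (n + 1)) k} (hf : f ≠ 0) :
    ∃ e : MvPolynomial (Fin (n + 1)) k ≃ₐ[k] MvPolynomial (Fin (n + 1)) k,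
      IsUnit (finSuccEquiv k n (e f)).leadingCoeff := by
  -- All exponents are digits in base `N`, so that distinct monomials get distinct degrees in `X₀`.
  set N := f.totalDegree + 2 with hN
  let wt : (Fin (n + 1) →₀ ℕ) → ℕ := fun v => ∑ i : Fin (n + 1), v i * N ^ (i : ℕ)
  have hlt : ∀ v ∈ f.support, ∀ i, v i < N := fun v hv i =>
    lt_of_le_of_lt ((monomial_le_degreeOf i hv).trans (degreeOf_le_totalDegree f i)) (by omega)
  have hinj : ∀ v ∈ f.support, ∀ w ∈ f.support, wt v = wt w → v = w := by
    intro v hv w hw h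
    refine Finsupp.ext <| congrFun <| List.ofFn_inj.mp ?_
    have hmem : ∀ v ∈ f.support, ∀ l ∈ List.ofFn v, l < N := fun v hv l hl => by
      obtain ⟨i, rfl⟩ := (List.mem_ofFn' _ _).mp hl
      exact hlt v hv i
    refine Nat.ofDigits_inj_of_len_eq (b := N) (by omega) (by simp) (hmem v hv) (hmem w hw) ?_
    simpa only [Nat.ofDigits_eq_sum_mapIdx, List.mapIdx_eq_ofFn, List.get_ofFn, List.length_ofFn,
      Fin.val_cast, mul_comm, List.sum_ofFn, wt] using! h
  obtain ⟨v, hv, hmax⟩ := Finset.exists_max_image f.support wt (support_nonempty.mpr hf)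
  let g : (Fin (n + 1) →₀ ℕ) → Polynomial (MvPolynomial (Fin n) k) := fun w =>
    finSuccEquiv k n (nagataEquiv N (monomial w (coeff w f)))
  have hg : ∀ w ∈ f.support, (g w).leadingCoeff = C (coeff w f) ∧ (g w).natDegree = wt w :=
    fun w hw => finSuccEquiv_nagataEquiv_monomial (by omega) w (mem_support_iff.mp hw)
  have hg0 : ∀ w ∈ f.support, g w ≠ 0 := fun w hw h => by
    have := (hg w hw).1
    rw [h, Polynomial.leadingCoeff_zero] at this
    exact mem_support_iff.mp hw (by simpa using this.symm)
  refine ⟨nagataEquiv N, ?_⟩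
  have hsum : finSuccEquiv k n (nagataEquiv N f) = g v + ∑ w ∈ f.support.erase v, g w := by
    rw [Finset.add_sum_erase _ _ hv]
    conv_lhs => rw [← f.support_sum_monomial_coeff, map_sum, map_sum]
  rw [hsum, add_comm, Polynomial.leadingCoeff_add_of_degree_lt, (hg v hv).1]
  · exact (mem_support_iff.mp hv).isUnit.map C
  · refine lt_of_le_of_lt (Polynomial.degree_sum_le _ _) ?_
    refine (Finset.sup_lt_iff (Ne.bot_lt fun h => hg0 v hv (Polynomial.degree_eq_bot.mp h))).mpr ?_
    intro w hw
    obtain ⟨hwv, hw⟩ := Finset.mem_erase.mp hw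
    refine Polynomial.degree_lt_degree ?_
    rw [(hg w hw).2, (hg v hv).2]
    exact lt_of_le_of_ne (hmax w hw) fun h => hwv (hinj w hw v hv h)

end Nagata

/-! ### Regular sequences in primes of polynomial rings -/

section Grade

open RingTheory.Sequence

/-- Every prime of a polynomial ring over a field contains a weakly regular sequence of length its
height. -/
theorem exists_isWeaklyRegular_height_eq {k : Type*} [Field k] (n : ℕ) :
    ∀ (P : Ideal (MvPolynomial (Fin n) k)) [P.IsPrime], ∃ xs : List (MvPolynomial (Fin n) k),
      IsWeaklyRegular (MvPolynomial (Fin n) k) xs ∧ (∀ x ∈ xs, x ∈ P) ∧ P.height = xs.length := by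
  induction n with
  | zero =>
    intro P hP
    refine ⟨[], .nil _ _, by simp, ?_⟩
    have h : P = ⊥ := by
      refine (Submodule.eq_bot_iff _).mpr fun f hf => ?_
      by_contra h0
      rw [MvPolynomial.eq_C_of_isEmpty f] at hf h0
      refine hP.ne_top (Ideal.eq_top_of_isUnit_mem _ hf (IsUnit.map _ (Ne.isUnit fun h => h0 ?_)))
      rw [h, map_zero]
    rw [h, Ideal.height_bot]
    rfl
  | succ n ih =>
    intro P hP
    by_cases h : P = ⊥
    · refine ⟨[], .nil _ _, by simp, ?_⟩
      rw [h, Ideal.height_bot]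
      rfl
    obtain ⟨f, hfP, hf⟩ := Submodule.exists_mem_ne_zero_of_ne_bot h
    obtain ⟨e, he⟩ := exists_algEquiv_isUnit_leadingCoeff hf
    let σ : MvPolynomial (Fin (n + 1)) k ≃+* Polynomial (MvPolynomial (Fin n) k) :=
      (e.trans (MvPolynomial.finSuccEquiv k n)).toRingEquiv
    let P' : Ideal (Polynomial (MvPolynomial (Fin n) k)) := P.comap σ.symm
    have hmem : ∀ x, σ x ∈ P' ↔ x ∈ P := fun x => by
      rw [Ideal.mem_comap, RingEquiv.symm_apply_apply]
    have hP' : P'.IsPrime := Ideal.comap_isPrime σ.symm P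
    obtain ⟨F, hF, hFP⟩ : ∃ F, F.Monic ∧ F ∈ P' :=
      ⟨_, Polynomial.monic_of_isUnit_leadingCoeff_inv_smul he,
        Submodule.smul_of_tower_mem _ _ ((hmem f).mpr hfP)⟩
    obtain ⟨xs, hxs, hxP, hlen⟩ := ih (P'.comap Polynomial.C)
    refine ⟨(xs.map Polynomial.C ++ [F]).map σ.symm, ?_, ?_, ?_⟩
    · refine (AddEquiv.isWeaklyRegular_congr (e := σ.symm.toAddEquiv) (List.forall₂_map_right_iff.mpr
        (List.forall₂_same.mpr fun r _ x => ?_))).mp (isWeaklyRegular_append_monic hxs hF)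
      exact map_mul σ.symm r x
    · intro x hx
      obtain ⟨y, hy, rfl⟩ := List.mem_map.mp hx
      change y ∈ P'
      rcases List.mem_append.mp hy with h | h
      · obtain ⟨z, hz, rfl⟩ := List.mem_map.mp h
        exact hxP z hz
      · rwa [List.mem_singleton.mp h]
    · have h1 : P'.height = P.height := RingEquiv.height_comap σ.symm P
      rw [← h1, height_eq_height_comap_add_one P' hF hFP, hlen]
      simp

/-- Every prime of a localization of a polynomial ring over a field contains a weakly regular sequence
of length its height. -/
lemma exists_isWeaklyRegular_of_isLocalization {k : Type*} [Field k] {n : ℕ}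
    (W : Submonoid (MvPolynomial (Fin n) k)) (B : Type*) [CommRing B]
    [Algebra (MvPolynomial (Fin n) k) B] [IsLocalization W B] (P : Ideal B) [P.IsPrime] :
    ∃ xs : List B, IsWeaklyRegular B xs ∧ (∀ x ∈ xs, x ∈ P) ∧ P.height = xs.length := by
  obtain ⟨xs, hxs, hP, hlen⟩ := exists_isWeaklyRegular_height_eq n
    (P.comap (algebraMap (MvPolynomial (Fin n) k) B))
  refine ⟨xs.map (algebraMap _ B), hxs.of_isLocalization B W, fun x hx => ?_, ?_⟩
  · obtain ⟨y, hy, rfl⟩ := List.mem_map.mp hx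
    exact hP y hy
  · rw [List.length_map, ← hlen]
    exact (IsLocalization.height_under W P).symm

end Grade

/-! ### Presentations from canonical modules -/

section Canonical

open RingTheory.Sequence

variable {k U M : Type u} [Field k] [CommRing U] [Algebra k U] [AddCommGroup M] [Module U M]

lemma exists_ringHom_ker_eq {B : Type u} [CommRing B] (I : Ideal B) :
    ∃ (A : Type u) (_ : CommRing A) (π : B →+* A), Function.Surjective π ∧ RingHom.ker π = I :=
  ⟨B ⧸ I, inferInstance, Ideal.Quotient.mk I, Ideal.Quotient.mk_surjective, Ideal.mk_ker⟩

/-- A canonical module of a domain has a presentation: the kernel of the map to a domain is prime, so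
that it contains a weakly regular sequence of length its height. -/
lemma exists_dualizingData [IsDomain U] (h : IsCanonicalModuleOfConnected k U M) :
    ∃ D : DualizingData k U M, Function.Surjective D.ψ := by
  obtain ⟨n, W, φ, c, hφ, hc, ⟨i⟩⟩ := h
  have hprime : (RingHom.ker φ).IsPrime := RingHom.ker_isPrime φ
  obtain ⟨xs, hxs, hP, hlen⟩ := exists_isWeaklyRegular_of_isLocalization W (Localization W)
    (RingHom.ker φ)
  obtain rfl : c = xs.length := by
    rw [hc] at hlen
    exact_mod_cast hlen
  obtain ⟨A, _, π, hπ, hker⟩ := exists_ringHom_ker_eq (Ideal.ofList xs)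
  obtain ⟨μ, hμ⟩ := (exists_represents_iff (M := M) (ψ := φ.toRingHom) hφ hxs hP hπ hker).mpr ⟨i⟩
  exact ⟨{
    n := n
    B := Localization W
    isLocPoly := ⟨W, ⟨AlgEquiv.refl⟩⟩
    A := A
    xs := xs
    isWeaklyRegular := hxs
    π := π
    π_surjective := hπ
    ker_π := hker
    ψ := φ
    ψ_xs := hP
    height_ker := hc
    μ := μ
    represents := hμ }, hφ⟩

end Canonical

/-! ### Localization of canonical modules -/

section Localization

open RingTheory.Sequence

variable {k U M : Type u} [Field k] [CommRing U] [Algebra k U] [AddCommGroup M] [Module U M]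

/-- If a finitely generated ideal kills an element after localization, then it kills a multiple of this
element by an element of the multiplicative set. -/
lemma exists_forall_mul_eq_zero {B A A' : Type*} [CommRing B] [IsNoetherianRing B] [CommRing A]
    [CommRing A'] [Algebra A A'] (V : Submonoid B) (π : B →+* A) [IsLocalization (V.map π) A']
    (I : Ideal B) {a : A} (ha : ∀ b ∈ I, algebraMap A A' (π b * a) = 0) :
    ∃ v ∈ V, ∀ b ∈ I, π b * (π v * a) = 0 := by
  obtain ⟨s, hs⟩ := IsNoetherian.noetherian I
  have hfin : ∀ t : Finset B, (∀ b ∈ t, b ∈ I) → ∃ v ∈ V, ∀ b ∈ t, π b * (π v * a) = 0 := by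
    classical
    intro t
    induction t using Finset.induction_on with
    | empty => exact fun _ => ⟨1, V.one_mem, by simp⟩
    | insert c t _ ih =>
      intro ht
      obtain ⟨v, hv, hvt⟩ := ih fun b hb => ht b (Finset.mem_insert_of_mem hb)
      obtain ⟨⟨w, hw⟩, hwc⟩ := (IsLocalization.map_eq_zero_iff (V.map π) A' _).mp
        (ha c (ht c (Finset.mem_insert_self c t)))
      obtain ⟨w, hw, rfl⟩ := hw
      refine ⟨v * w, V.mul_mem hv hw, fun b hb => ?_⟩
      rw [map_mul]
      rcases Finset.mem_insert.mp hb with rfl | hb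
      · linear_combination π v * hwc
      · linear_combination π w * hvt b hb
  obtain ⟨v, hv, hvs⟩ := hfin s fun b hb => hs ▸ Submodule.subset_span hb
  refine ⟨v, hv, fun b hb => ?_⟩
  rw [← hs] at hb
  induction hb using Submodule.span_induction with
  | mem x hx => exact hvs x hx
  | zero => rw [map_zero, zero_mul]
  | add x y _ _ hx hy => rw [map_add, add_mul, hx, hy, add_zero]
  | smul c x _ hx => rw [smul_eq_mul, map_mul, mul_assoc, hx, mul_zero]

/-- Representability is compatible with localization, if the source is a cyclic module over a Noetherian
ring. -/
lemma Represents.localization {B A B' A' : Type*} {U' M' : Type u} [CommRing B] [IsNoetherianRing B]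
    [CommRing A] [CommRing B'] [CommRing A'] [CommRing U'] [AddCommGroup M'] [Module U' M']
    [Algebra B B'] [Algebra A A'] [Algebra U U'] [Module U M'] [IsScalarTower U U' M']
    {ψ : B →+* U} {π : B →+* A} {μ : M →+ A} (hμ : Represents ψ π μ)
    (hψ : Function.Surjective ψ) (V : Submonoid B) [IsLocalization V B']
    [IsLocalization (V.map π) A'] (f : M →ₗ[U] M') [IsLocalizedModule (V.map ψ) f]
    {ψ' : B' →+* U'} (hψ' : Function.Surjective ψ')
    (hψc : ∀ b, ψ' (algebraMap B B' b) = algebraMap U U' (ψ b))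
    {π' : B' →+* A'} (hπc : ∀ b, π' (algebraMap B B' b) = algebraMap A A' (π b)) :
    ∃ μ' : M' →+ A', Represents ψ' π' μ' := by
  let _ : Module B M := Module.compHom M ψ
  let _ : Module B M' := Module.compHom M' ψ
  let _ : Module B A' := Module.compHom A' ((algebraMap A A').comp π)
  let fB : M →ₗ[B] M' :=
    { toFun := f, map_add' := map_add f, map_smul' := fun b m => f.map_smul (ψ b) m }
  let g : M →ₗ[B] A' :=
    { toFun := fun m => algebraMap A A' (μ m)
      map_add' := fun m n => by rw [map_add, map_add]
      map_smul' := fun b m => by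
        rw [RingHom.id_apply]
        exact (congrArg _ (hμ.map_smul b m)).trans (map_mul _ _ _) }
  have hloc : IsLocalizedModule V fB := by
    refine ⟨fun v => ?_, fun y => ?_, fun {x₁ x₂} h => ?_⟩
    · have h := IsLocalizedModule.map_units f (⟨ψ v, v, v.2, rfl⟩ : V.map ψ)
      rw [Module.End.isUnit_iff] at h ⊢
      exact h
    · obtain ⟨⟨x, ⟨_, v, hv, rfl⟩⟩, hx⟩ := IsLocalizedModule.surj (V.map ψ) f y
      exact ⟨⟨x, v, hv⟩, hx⟩
    · obtain ⟨⟨_, v, hv, rfl⟩, hc⟩ := IsLocalizedModule.exists_of_eq (S := V.map ψ) (f := f) h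
      exact ⟨⟨v, hv⟩, hc⟩
  have hunit : ∀ v ∈ V, IsUnit (algebraMap A A' (π v)) := fun v hv =>
    IsLocalization.map_units A' (⟨π v, v, hv, rfl⟩ : V.map π)
  have hg : ∀ v : V, IsUnit (algebraMap B (Module.End B A') v) := fun v => by
    rw [Module.End.isUnit_iff]
    exact IsUnit.isUnit_iff_mulLeft_bijective.mp (hunit v v.2)
  let L := IsLocalizedModule.lift V fB g hg
  have hL : ∀ m, L (f m) = algebraMap A A' (μ m) := fun m =>
    IsLocalizedModule.lift_apply V fB g hg m
  have hLs : ∀ b m', L (ψ b • m') = algebraMap A A' (π b) * L m' := fun b m' => L.map_smul b m'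
  have hsurj : ∀ m' : M', ∃ v ∈ V, ∃ m, ψ v • m' = f m := fun m' => by
    obtain ⟨⟨x, ⟨_, v, hv, rfl⟩⟩, hx⟩ := IsLocalizedModule.surj (V.map ψ) f m'
    exact ⟨v, hv, x, hx⟩
  have hinj : ∀ v ∈ V, ∀ m' : M', ψ v • m' = 0 → m' = 0 := fun v hv m' h => by
    have h1 := IsLocalizedModule.map_units f (⟨ψ v, v, hv, rfl⟩ : V.map ψ)
    rw [Module.End.isUnit_iff] at h1
    exact h1.1 (h.trans (smul_zero _).symm)
  refine ⟨L.toAddMonoidHom, .of_surjective hψ' (fun b' m' => ?_) ?_ fun a' ha' => ?_⟩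
  · obtain ⟨⟨b, v⟩, hb⟩ := IsLocalization.surj V b'
    refine (hunit v v.2).mul_left_cancel ?_
    change algebraMap A A' (π v) * L _ = algebraMap A A' (π v) * (π' b' * L m')
    rw [← hLs, ← mul_assoc, ← hπc, ← map_mul, mul_comm _ b', hb, hπc, ← hLs]
    congr 1
    rw [← algebraMap_smul U' (ψ v), ← algebraMap_smul U' (ψ b), ← mul_smul, ← hψc, ← hψc, ← hb,
      map_mul, mul_comm]
  · rw [injective_iff_map_eq_zero]
    intro m' hm'
    obtain ⟨v, hv, m, hm⟩ := hsurj m'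
    refine hinj v hv m' ?_
    have h1 : algebraMap A A' (μ m) = 0 := by
      rw [← hL, ← hm, hLs]
      exact (congrArg _ hm').trans (mul_zero _)
    obtain ⟨⟨_, w, hw, rfl⟩, hc⟩ := (IsLocalization.map_eq_zero_iff (V.map π) A' _).mp h1
    have h2 : ψ w • m = 0 := by
      refine hμ.injective hψ ?_
      rw [hμ.map_smul, map_zero]
      exact hc
    refine hinj w hw _ ?_
    rw [hm, ← f.map_smul, h2, map_zero]
  · obtain ⟨⟨a, ⟨_, v, hv, rfl⟩⟩, ha⟩ := IsLocalization.surj (V.map π) a'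
    obtain ⟨w, hw, hwa⟩ := exists_forall_mul_eq_zero (A' := A') V π (RingHom.ker ψ) (a := a)
      fun b hb => by
        rw [map_mul, ← ha, ← mul_assoc, ← hπc, ha' _ (by rw [hψc, RingHom.mem_ker.mp hb, map_zero]),
          zero_mul]
    obtain ⟨m, hm⟩ := hμ.exists_eq hψ (a := π w * a) hwa
    obtain ⟨m', hm'⟩ := ((Module.End.isUnit_iff _).mp
      (IsLocalizedModule.map_units f (⟨ψ (w * v), w * v, V.mul_mem hw hv, rfl⟩ : V.map ψ))).2 (f m)
    have hm'' : ψ (w * v) • m' = f m := hm'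
    refine ⟨m', (hunit _ (V.mul_mem hw hv)).mul_left_cancel ?_⟩
    change algebraMap A A' (π (w * v)) * L m' = _
    rw [← hLs, hm'', hL, hm, map_mul, map_mul, map_mul, ← ha]
    ring

/-- Presentations localize, for given models of the localized rings; `V` is the preimage of `W`. -/
lemma DualizingData.exists_localization_of_isLocalization [IsDomain U] (D : DualizingData k U M)
    (hD : Function.Surjective D.ψ) (W : Submonoid U) (hW : (0 : U) ∉ W) {U' M' : Type u}
    [CommRing U'] [Algebra k U'] [Algebra U U'] [IsScalarTower k U U'] [IsLocalization W U']
    [AddCommGroup M'] [Module U' M'] [Module U M'] [IsScalarTower U U' M'] (f : M →ₗ[U] M')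
    [IsLocalizedModule W f] (V : Submonoid D.B) (hV : V = W.comap (D.ψ : D.B →+* U))
    (B' A' : Type u) [CommRing B'] [Algebra k B'] [Algebra D.B B'] [IsScalarTower k D.B B']
    [IsLocalization V B'] [CommRing A'] [Algebra D.A A'] [IsLocalization (V.map D.π) A'] :
    ∃ D' : DualizingData k U' M', Function.Surjective D'.ψ := by
  set ψ : D.B →+* U := (D.ψ : D.B →+* U) with hψdef
  have hψ : Function.Surjective ψ := hD
  have hVW : V.map ψ = W := hV ▸ Submonoid.map_comap_eq_of_surjective hψ W
  have : IsLocalization (V.map ψ) U' := hVW ▸ ‹IsLocalization W U'›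
  have : IsLocalizedModule (V.map ψ) f := hVW ▸ ‹IsLocalizedModule W f›
  have := D.isLocPoly.isNoetherianRing
  let ψ' : B' →+* U' := IsLocalization.map U' ψ V.le_comap_map
  let π' : B' →+* A' := IsLocalization.map A' D.π V.le_comap_map
  have hψc : ∀ b, ψ' (algebraMap D.B B' b) = algebraMap U U' (ψ b) := fun b =>
    IsLocalization.map_eq V.le_comap_map b
  have hπc : ∀ b, π' (algebraMap D.B B' b) = algebraMap D.A A' (D.π b) := fun b =>
    IsLocalization.map_eq V.le_comap_map b
  have hψ' : Function.Surjective ψ' := IsLocalization.map_surjective_of_surjective V B' U' hψ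
  have hπ' : Function.Surjective π' :=
    IsLocalization.map_surjective_of_surjective V B' A' D.π_surjective
  obtain ⟨μ', hμ'⟩ := D.represents.localization (B' := B') (A' := A') (U' := U') hψ V f hψ' hψc hπc
  let ψa : B' →ₐ[k] U' := { ψ' with
    commutes' := fun r => by
      change ψ' (algebraMap k B' r) = _
      rw [IsScalarTower.algebraMap_apply k D.B B', hψc, IsScalarTower.algebraMap_apply k U U']
      exact congrArg _ (D.ψ.commutes r) }
  refine ⟨{
    n := D.n
    B := B'
    isLocPoly := D.isLocPoly.localization V B'
    A := A'
    xs := D.xs.map (algebraMap D.B B')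
    isWeaklyRegular := D.isWeaklyRegular.of_isLocalization B' V
    π := π'
    π_surjective := hπ'
    ker_π := by
      rw [← Ideal.map_ofList, ← D.ker_π]
      exact IsLocalization.ker_map A' D.π rfl
    ψ := ψa
    ψ_xs := fun x hx => by
      obtain ⟨b, hb, rfl⟩ := List.mem_map.mp hx
      change ψ' _ = 0
      rw [hψc]
      exact (congrArg _ (D.ψ_xs b hb)).trans (map_zero _)
    height_ker := by
      have h1 : RingHom.ker ψa = (RingHom.ker ψ).map (algebraMap D.B B') :=
        IsLocalization.ker_map U' ψ rfl
      have hp : (RingHom.ker ψ).IsPrime := RingHom.ker_isPrime ψ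
      rw [h1, IsLocalization.height_map_of_disjoint V (RingHom.ker ψ), List.length_map]
      · exact D.height_ker
      · refine Set.disjoint_left.mpr fun v hv hv0 => hW ?_
        have : ψ v ∈ W := by rwa [hV] at hv
        rwa [RingHom.mem_ker.mp hv0] at this
    μ := μ'
    represents := hμ' }, hψ'⟩

/-- If `M` has a presentation over `U` that comes from a surjective map, then so has its localization. -/
lemma DualizingData.exists_localization [IsDomain U] (D : DualizingData k U M)
    (hD : Function.Surjective D.ψ) (W : Submonoid U) (hW : (0 : U) ∉ W) {U' M' : Type u}
    [CommRing U'] [Algebra k U'] [Algebra U U'] [IsScalarTower k U U'] [IsLocalization W U']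
    [AddCommGroup M'] [Module U' M'] [Module U M'] [IsScalarTower U U' M'] (f : M →ₗ[U] M')
    [IsLocalizedModule W f] :
    ∃ D' : DualizingData k U' M', Function.Surjective D'.ψ :=
  D.exists_localization_of_isLocalization hD W hW f _ rfl
    (Localization (W.comap (D.ψ : D.B →+* U)))
    (Localization ((W.comap (D.ψ : D.B →+* U)).map D.π))

end Localization

/-! ### Prime avoidance -/

section PrimeAvoidance

variable {R : Type u} [CommRing R]

/-- Prime avoidance: an ideal contained in none of finitely many primes has an element outside of all
of them. -/
lemma exists_mem_forall_notMem_of_not_le {ι : Type*} (T : Finset ι) (f : ι → Ideal R)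
    (hT : ∀ i ∈ T, (f i).IsPrime) (I : Ideal R) (hI : ∀ i ∈ T, ¬ I ≤ f i) :
    ∃ b ∈ I, ∀ i ∈ T, b ∉ f i := by
  classical
  by_contra! h
  rcases T.eq_empty_or_nonempty with rfl | ⟨i0, hi0⟩
  · obtain ⟨i, hi, -⟩ := h 0 I.zero_mem
    exact absurd hi (Finset.notMem_empty i)
  · obtain ⟨i, hi, hle⟩ := (Ideal.subset_union_prime (s := T) (f := f) i0 i0
      (fun i hi _ _ => hT i hi) (I := I)).mp (fun b hb => by
        obtain ⟨i, hi, hb'⟩ := h b hb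
        exact Set.mem_iUnion₂.mpr ⟨i, hi, hb'⟩)
    exact hI i hi hle

/-- An element of finitely many ideals that avoids finitely many primes, none of which contains one of
the ideals. -/
lemma exists_mem_notMem_of_finite {S T : Set (Ideal R)} (hS : S.Finite) (hT : T.Finite)
    (hTp : ∀ P ∈ T, P.IsPrime) (h : ∀ I ∈ S, ∀ P ∈ T, ¬ I ≤ P) :
    ∃ b, (∀ I ∈ S, b ∈ I) ∧ ∀ P ∈ T, b ∉ P := by
  classical
  obtain ⟨b, hb, hb'⟩ := exists_mem_forall_notMem_of_not_le hT.toFinset id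
    (fun i hi => hTp i (by simpa using hi)) (hS.toFinset.inf id) (fun P hP hle => by
      have hP' : P ∈ T := by simpa using hP
      obtain ⟨I, hI, hle⟩ := ((hTp P hP').inf_le').mp hle
      exact h I (by simpa using hI) P hP' hle)
  refine ⟨b, fun I hI => ?_, fun P hP => hb' P (by simpa using hP)⟩
  exact (Finset.inf_le (f := id) (hS.mem_toFinset.mpr hI)) hb

end PrimeAvoidance

/-! ### Clearing denominators -/

section Fractions

variable {R : Type u} [CommRing R]

/-- A relation `y = c m` that holds over the local ring at `p` becomes `s y = a m` over `R`, for some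
`s` outside of `p`. -/
lemma exists_smul_eq_smul_of_map_eq (p : Ideal R) [p.IsPrime] {Q Rp L : Type*} [CommRing Q]
    [CommRing Rp] [CommRing L] [Algebra R Q] [IsFractionRing R Q] [Algebra R Rp]
    [IsLocalization.AtPrime Rp p] [Algebra Rp L] (hinj : Function.Injective (algebraMap Rp L))
    (t : Q →+* L) (ht : ∀ r, t (algebraMap R Q r) = algebraMap Rp L (algebraMap R Rp r))
    {y m : Q} {c : Rp} (h : t y = algebraMap Rp L c * t m) :
    ∃ s ∉ p, ∃ a : R, s • y = a • m := by
  classical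
  obtain ⟨d, hd⟩ := IsLocalization.exist_integer_multiples_of_finset R⁰ ({y, m} : Finset Q)
  obtain ⟨b, hb⟩ := hd y (by simp)
  obtain ⟨b', hb'⟩ := hd m (by simp)
  obtain ⟨a, s, rfl⟩ := IsLocalization.exists_mk'_eq p.primeCompl c
  have h1 : algebraMap R Rp ((s : R) * b) = algebraMap R Rp (a * b') := by
    apply hinj
    rw [map_mul, map_mul, map_mul, map_mul, ← ht b, ← ht b', hb, hb', Algebra.smul_def,
      Algebra.smul_def, map_mul, map_mul, h, ← IsLocalization.mk'_spec' Rp a s, map_mul]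
    ring
  obtain ⟨s', hs'⟩ := (IsLocalization.eq_iff_exists p.primeCompl Rp).mp h1
  refine ⟨s' * s, fun h => (p.primeCompl.mul_mem s'.2 s.2) h, s' * a, ?_⟩
  have hdu : IsUnit (algebraMap R Q d) := IsLocalization.map_units Q d
  apply hdu.mul_left_cancel
  have h2 := congrArg (algebraMap R Q) hs'
  simp only [map_mul, hb, hb', Algebra.smul_def] at h2
  simp only [map_mul, Algebra.smul_def]
  linear_combination h2

end Fractions

/-! ### Normal rings and their total rings of fractions -/

section Normal

variable {R : Type u} [CommRing R]

lemma IsNormalRing.isReduced [IsNormalRing R] : IsReduced R := by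
  refine isReduced_ofLocalizationMaximal R fun p hp => ?_
  have := IsNormalRing.isDomain p
  infer_instance

lemma nonZeroDivisors_le_comap_localization (p : Ideal R) [p.IsPrime]
    [IsDomain (Localization.AtPrime p)] :
    R⁰ ≤ ((Localization.AtPrime p)⁰).comap (algebraMap R (Localization.AtPrime p)) :=
  fun s hs => by
  refine mem_nonZeroDivisors_of_ne_zero fun h0 => ?_
  obtain ⟨t, ht⟩ :=
    (IsLocalization.map_eq_zero_iff p.primeCompl (Localization.AtPrime p) s).mp h0
  have : (t : R) = 0 := (mem_nonZeroDivisors_iff_right.mp hs) _ ht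
  exact t.2 (this ▸ p.zero_mem)

/-- A normal ring is integrally closed in its total ring of fractions. -/
lemma IsNormalRing.mem_range_of_isIntegral [IsNormalRing R] {Q : Type*} [CommRing Q] [Algebra R Q]
    [IsFractionRing R Q] {x : Q} (hx : IsIntegral R x) : ∃ r, algebraMap R Q r = x := by
  by_contra hcon
  -- The ideal of denominators of `x` is not contained in any maximal ideal.
  let I : Ideal R := (1 : Submodule R Q).comap (LinearMap.toSpanSingleton R Q x)
  have hI : I ≠ ⊤ := fun h => hcon <| by
    have : (1 : R) ∈ I := h ▸ Submodule.mem_top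
    simpa [I, Submodule.mem_one] using this
  obtain ⟨m, hm, hIm⟩ := Ideal.exists_le_maximal I hI
  have := IsNormalRing.isDomain m
  have := IsNormalRing.isIntegrallyClosed m
  let A := Localization.AtPrime m
  let t : Q →+* FractionRing A := IsLocalization.map (FractionRing A) (algebraMap R A)
    (nonZeroDivisors_le_comap_localization m)
  have ht : ∀ r, t (algebraMap R Q r) = algebraMap A (FractionRing A) (algebraMap R A r) :=
    fun r => IsLocalization.map_eq _ r
  have hint : IsIntegral A (t x) := by
    obtain ⟨f, hf, hf0⟩ := hx
    refine ⟨f.map (algebraMap R A), hf.map _, ?_⟩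
    rw [Polynomial.eval₂_map]
    have : (algebraMap A (FractionRing A)).comp (algebraMap R A) = t.comp (algebraMap R Q) :=
      RingHom.ext fun r => (ht r).symm
    rw [this, ← Polynomial.hom_eval₂, hf0, map_zero]
  obtain ⟨c, hc⟩ := IsIntegrallyClosed.isIntegral_iff.mp hint
  obtain ⟨s, hs, a, hsa⟩ := exists_smul_eq_smul_of_map_eq m
    (IsFractionRing.injective A (FractionRing A)) t ht (y := x) (m := 1) (c := c)
    (by rw [hc, map_one, mul_one])
  refine hs (hIm ?_)
  change s • x ∈ (1 : Submodule R Q)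
  rw [hsa, Submodule.mem_one]
  exact ⟨a, by rw [Algebra.smul_def, mul_one]⟩

lemma notMem_minimalPrimes_of_mem_nonZeroDivisors {r : R} (hr : r ∈ R⁰) {P : Ideal R}
    (hP : P ∈ minimalPrimes R) : r ∉ P := fun h =>
  Set.disjoint_left.mp (Ideal.disjoint_nonZeroDivisors_of_mem_minimalPrimes hP) h hr

lemma mem_nonZeroDivisors_of_notMem_minimalPrimes [IsReduced R] {r : R}
    (h : ∀ P ∈ minimalPrimes R, r ∉ P) : r ∈ R⁰ := by
  rw [mem_nonZeroDivisors_iff_right]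
  intro x hx
  have : x ∈ sInf (minimalPrimes R) := by
    rw [Ideal.mem_sInf]
    intro P hP
    have := hP.1.1
    exact (this.mem_or_mem (show x * r ∈ P by rw [hx]; exact P.zero_mem)).resolve_right (h P hP)
  rw [minimalPrimes, Ideal.sInf_minimalPrimes] at this
  rw [← Ideal.mem_bot (R := R)]
  exact (nilradical_eq_zero R).le this

variable [IsNoetherianRing R]

/-- In a reduced Noetherian ring, some `b` vanishes on the components on which `a` does not, and on no
others. -/
lemma exists_mul_eq_zero_add_mem_nonZeroDivisors [IsReduced R] (a : R) :
    ∃ b, a * b = 0 ∧ a + b ∈ R⁰ := by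
  have hfin := minimalPrimes.finite_of_isNoetherianRing R
  obtain ⟨b, hb, hb'⟩ := exists_mem_notMem_of_finite (S := {P ∈ minimalPrimes R | a ∉ P})
    (T := {P ∈ minimalPrimes R | a ∈ P}) (hfin.subset fun _ h => h.1) (hfin.subset fun _ h => h.1)
    (fun P hP => hP.1.1.1) (fun I hI P hP hle => hI.2 (by
      have := hI.1.1.1
      have h : P = I := le_antisymm (hP.1.2 ⟨this, bot_le⟩ hle) hle
      exact h ▸ hP.2))
  refine ⟨b, ?_, ?_⟩
  · have : a * b ∈ sInf (minimalPrimes R) := by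
      rw [Ideal.mem_sInf]
      intro P hP
      by_cases ha : a ∈ P
      · exact P.mul_mem_right _ ha
      · exact P.mul_mem_left _ (hb P ⟨hP, ha⟩)
    rw [minimalPrimes, Ideal.sInf_minimalPrimes] at this
    rw [← Ideal.mem_bot (R := R)]
    exact (nilradical_eq_zero R).le this
  · refine mem_nonZeroDivisors_of_notMem_minimalPrimes fun P hP h => ?_
    by_cases ha : a ∈ P
    · exact hb' P ⟨hP, ha⟩ ((P.add_mem_iff_right ha).mp h)
    · exact ha ((P.add_mem_iff_left (hb P ⟨hP, ha⟩)).mp h)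

/-- In a reduced Noetherian ring containing all idempotents of its total ring of fractions, every
element is the product of an idempotent and a nonzerodivisor. -/
lemma exists_isIdempotentElem_mul_eq [IsReduced R] {Q : Type*} [CommRing Q] [Algebra R Q]
    [IsFractionRing R Q] (hQ : ∀ x : Q, IsIntegral R x → ∃ r, algebraMap R Q r = x) (a : R) :
    ∃ e s : R, IsIdempotentElem e ∧ s ∈ R⁰ ∧ s * e = a := by
  obtain ⟨b, hab, hs⟩ := exists_mul_eq_zero_add_mem_nonZeroDivisors a
  have hinj := IsFractionRing.injective R Q
  -- As `a b = 0`, the fraction `x = a / (a + b)` is idempotent.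
  let x : Q := IsLocalization.mk' Q a (⟨a + b, hs⟩ : R⁰)
  have hx : algebraMap R Q (a + b) * x = algebraMap R Q a := IsLocalization.mk'_spec' Q a ⟨_, hs⟩
  have hu : IsUnit (algebraMap R Q (a + b)) := IsLocalization.map_units Q (⟨a + b, hs⟩ : R⁰)
  have hxx : x * x = x := by
    apply hu.mul_left_cancel
    apply hu.mul_left_cancel
    have h0 : algebraMap R Q a * algebraMap R Q b = 0 := by rw [← map_mul, hab, map_zero]
    have : algebraMap R Q (a + b) * (algebraMap R Q (a + b) * (x * x)) =
      (algebraMap R Q (a + b) * x) * (algebraMap R Q (a + b) * x) := by ring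
    rw [this, hx, map_add]
    linear_combination -h0
  have hint : IsIntegral R x := by
    have hm : (Polynomial.X ^ 2 - Polynomial.X : Polynomial R).Monic := by
      nontriviality R
      refine Polynomial.monic_X_pow_sub ?_
      rw [Polynomial.degree_X]
      decide
    exact ⟨_, hm, by simp [pow_two, hxx]⟩
  obtain ⟨e, he⟩ := hQ x hint
  refine ⟨e, a + b, hinj ?_, hs, hinj ?_⟩
  · rw [map_mul, he, hxx]
  · rw [map_mul, he, hx]

lemma IsNormalRing.exists_isIdempotentElem_mul_eq [IsNormalRing R] (a : R) :
    ∃ e s : R, IsIdempotentElem e ∧ s ∈ R⁰ ∧ s * e = a := by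
  have := IsNormalRing.isReduced (R := R)
  exact QuasiGorenstein.exists_isIdempotentElem_mul_eq (Q := FractionRing R)
    (fun _ hx => IsNormalRing.mem_range_of_isIntegral hx) a

end Normal

/-! ### Idempotents and components -/

section Idempotents

variable {R : Type u} [CommRing R]

lemma IsIdempotentElem.eq_zero_or_eq_one_of_connectedSpace [ConnectedSpace (PrimeSpectrum R)]
    {e : R} (he : IsIdempotentElem e) : e = 0 ∨ e = 1 := by
  have hc : IsClopen (PrimeSpectrum.basicOpen e : Set (PrimeSpectrum R)) :=
    PrimeSpectrum.isClopen_iff.mpr ⟨e, he, rfl⟩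
  rcases isClopen_iff.mp hc with h | h
  · left
    refine PrimeSpectrum.basicOpen_injOn_isIdempotentElem he IsIdempotentElem.zero ?_
    rw [PrimeSpectrum.basicOpen_zero]
    exact SetLike.coe_injective h
  · right
    refine PrimeSpectrum.basicOpen_injOn_isIdempotentElem he IsIdempotentElem.one ?_
    rw [PrimeSpectrum.basicOpen_one]
    exact SetLike.coe_injective h

lemma mem_span_idempotent_iff {e : R} (he : IsIdempotentElem e) {x : R} :
    x ∈ Ideal.span {e} ↔ (1 - e) * x = 0 := by
  rw [Ideal.mem_span_singleton']
  constructor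
  · rintro ⟨y, rfl⟩
    linear_combination -y * he.eq
  · intro h
    exact ⟨x, by linear_combination -h⟩

/-- A function that is nonzero on one component becomes a nonzerodivisor when it is replaced by `1` on
the other components. -/
lemma idempotent_mem_nonZeroDivisors {e : R} (he : IsIdempotentElem e)
    [hP : (Ideal.span {e}).IsPrime] {r : R} (hr : r ∉ Ideal.span {e}) : (1 - e) * r + e ∈ R⁰ := by
  rw [mem_nonZeroDivisors_iff_right]
  intro x hx
  have h1 : x * e = 0 := by linear_combination e * hx - x * (1 - r) * he.eq
  have h2 : x * r ∈ Ideal.span {e} := by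
    rw [mem_span_idempotent_iff he]
    linear_combination hx - h1
  have h3 := (hP.mem_or_mem h2).resolve_right hr
  rw [mem_span_idempotent_iff he] at h3
  linear_combination h3 + h1

lemma one_sub_mem_of_notMem {P : Ideal R} [hP : P.IsPrime] {e : R} (he : IsIdempotentElem e)
    (h : e ∉ P) : 1 - e ∈ P :=
  (hP.mem_or_mem (show e * (1 - e) ∈ P by
    rw [show e * (1 - e) = 0 by linear_combination -he.eq]; exact P.zero_mem)).resolve_left h

variable [IsNoetherianRing R] [IsNormalRing R]

/-- A connected component of the spectrum of a normal ring is irreducible and reduced. -/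
lemma IsNormalRing.isPrime_span_idempotent {e : R} (he : IsIdempotentElem e)
    [ConnectedSpace (PrimeSpectrum (R ⧸ Ideal.span {e}))] : (Ideal.span {e}).IsPrime := by
  have hnt : Nontrivial (R ⧸ Ideal.span {e}) := by
    rw [← PrimeSpectrum.nonempty_iff_nontrivial]
    infer_instance
  refine ⟨Ideal.Quotient.nontrivial_iff.mp hnt, fun {a b} hab => ?_⟩
  obtain ⟨e₁, s, he₁, hs, rfl⟩ := IsNormalRing.exists_isIdempotentElem_mul_eq a
  rcases IsIdempotentElem.eq_zero_or_eq_one_of_connectedSpace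
    (he₁.map (Ideal.Quotient.mk (Ideal.span {e}))) with h | h
  · exact Or.inl (Ideal.mul_mem_left _ _ (Ideal.Quotient.eq_zero_iff_mem.mp h))
  · right
    have h1 : e₁ - 1 ∈ Ideal.span {e} := by
      rw [← Ideal.Quotient.eq_zero_iff_mem, map_sub, h, map_one, sub_self]
    rw [mem_span_idempotent_iff he] at hab h1 ⊢
    refine (mem_nonZeroDivisors_iff.mp hs).1 _ ?_
    linear_combination hab - s * b * h1

/-- The minimal primes of a normal Noetherian ring are generated by idempotents: its irreducible
components are disjoint. -/
lemma IsNormalRing.exists_minimalPrime_eq_span {P : Ideal R} (hP : P ∈ minimalPrimes R) :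
    ∃ e, IsIdempotentElem e ∧ P = Ideal.span {e} := by
  have := hP.1.1
  refine (Ideal.isIdempotentElem_iff_of_fg P (IsNoetherian.noetherian P)).mp ?_
  refine le_antisymm Ideal.mul_le_left fun a ha => ?_
  obtain ⟨e, s, he, hs, rfl⟩ := IsNormalRing.exists_isIdempotentElem_mul_eq a
  have hsP := notMem_minimalPrimes_of_mem_nonZeroDivisors hs hP
  have heP := (this.mem_or_mem ha).resolve_left hsP
  have : s * e = s * e * e := by rw [mul_assoc, he.eq]
  rw [this]
  exact Ideal.mul_mem_mul ha heP

end Idempotents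

/-! ### A criterion for normality -/

section Criterion

variable {R : Type u} [CommRing R]

lemma map_idempotent_atPrime (p : Ideal R) [p.IsPrime] {e : R} (he : IsIdempotentElem e) :
    algebraMap R (Localization.AtPrime p) e = 0 ∨ algebraMap R (Localization.AtPrime p) e = 1 := by
  by_cases h : e ∈ p
  · left
    rw [IsLocalization.map_eq_zero_iff p.primeCompl]
    refine ⟨⟨1 - e, fun h' => ?_⟩, ?_⟩
    · exact (inferInstance : p.IsPrime).one_notMem (by simpa using p.add_mem h' h)
    · change (1 - e) * e = 0
      linear_combination -he.eq
  · right
    have hu : IsUnit (algebraMap R (Localization.AtPrime p) e) :=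
      IsLocalization.map_units _ (⟨e, h⟩ : p.primeCompl)
    apply hu.mul_left_cancel
    rw [← map_mul, he.eq, mul_one]

/-- A reduced Noetherian ring which is integrally closed in its total ring of fractions is
normal. -/
lemma isNormalRing_of_forall_isIntegral [IsNoetherianRing R] [IsReduced R] {Q : Type*} [CommRing Q]
    [Algebra R Q] [IsFractionRing R Q]
    (hQ : ∀ x : Q, IsIntegral R x → ∃ r, algebraMap R Q r = x) : IsNormalRing R := by
  have hdom : ∀ (p : Ideal R) [p.IsPrime], IsDomain (Localization.AtPrime p) := by
    intro p _
    have : NoZeroDivisors (Localization.AtPrime p) := by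
      refine ⟨fun {x y} hxy => ?_⟩
      obtain ⟨a, t, rfl⟩ := IsLocalization.exists_mk'_eq p.primeCompl x
      obtain ⟨e, s, he, hs, rfl⟩ := exists_isIdempotentElem_mul_eq hQ a
      rcases map_idempotent_atPrime p he with h | h
      · left
        rw [IsLocalization.mk'_eq_mul_mk'_one, map_mul, h, mul_zero, zero_mul]
      · right
        have hs' := IsLocalization.map_nonZeroDivisors_le p.primeCompl (Localization.AtPrime p)
          (Submonoid.mem_map_of_mem (algebraMap R (Localization.AtPrime p)) hs)
        refine (mem_nonZeroDivisors_iff.mp hs').1 _ ?_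
        have h2 := IsLocalization.mk'_spec' (Localization.AtPrime p) (s * e) t
        rw [map_mul, h, mul_one] at h2
        change algebraMap R (Localization.AtPrime p) s * y = 0
        rw [← h2, mul_assoc, hxy, mul_zero]
    exact NoZeroDivisors.to_isDomain _
  refine ⟨hdom, fun p _ => ?_⟩
  have := hdom p
  let A := Localization.AtPrime p
  refine (isIntegrallyClosed_iff (FractionRing A)).mpr fun {x} hx => ?_
  obtain ⟨t, ht⟩ : ∃ t : Q →+* FractionRing A, ∀ r, t (algebraMap R Q r) =
      algebraMap A (FractionRing A) (algebraMap R A r) :=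
    ⟨IsLocalization.map (FractionRing A) (algebraMap R A)
      (nonZeroDivisors_le_comap_localization p), fun r => IsLocalization.map_eq _ r⟩
  have htu : ∀ r, algebraMap R (FractionRing A) r = t (algebraMap R Q r) := fun r => by
    rw [ht, IsScalarTower.algebraMap_apply R A (FractionRing A)]
  -- Up to a unit of `A`, the denominator of `x` is the image of a nonzerodivisor of `R`.
  obtain ⟨s₂, hs₂, c, hc⟩ : ∃ s₂ ∉ p, ∃ c : Q, s₂ • x = t c := by
    obtain ⟨y, z, hz, rfl⟩ := IsFractionRing.div_surjective (A := A) x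
    obtain ⟨a, s₂, rfl⟩ := IsLocalization.exists_mk'_eq p.primeCompl y
    obtain ⟨b, s₃, rfl⟩ := IsLocalization.exists_mk'_eq p.primeCompl z
    obtain ⟨e, s, he, hs, rfl⟩ := exists_isIdempotentElem_mul_eq hQ b
    have he1 : algebraMap R A e = 1 := by
      refine (map_idempotent_atPrime p he).resolve_left fun h => nonZeroDivisors.ne_zero hz ?_
      rw [IsLocalization.mk'_eq_mul_mk'_one, map_mul]
      change _ * algebraMap R A e * _ = _
      rw [h, mul_zero, zero_mul]
    refine ⟨s₂, s₂.2, IsLocalization.mk' Q (a * s₃) ⟨s, hs⟩, ?_⟩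
    have h1 := congrArg t (IsLocalization.mk'_spec' Q (a * s₃) ⟨s, hs⟩)
    rw [map_mul, ← htu, ← htu] at h1
    have h2 := congrArg (algebraMap A (FractionRing A)) (IsLocalization.mk'_spec' A a s₂)
    have h3 := congrArg (algebraMap A (FractionRing A)) (IsLocalization.mk'_spec' A (s * e) s₃)
    rw [map_mul, ← IsScalarTower.algebraMap_apply R A (FractionRing A),
      ← IsScalarTower.algebraMap_apply R A (FractionRing A)] at h2 h3
    rw [IsScalarTower.algebraMap_apply R A (FractionRing A) (s * e), map_mul, he1, mul_one,
      ← IsScalarTower.algebraMap_apply R A (FractionRing A)] at h3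
    have hz0 : algebraMap A (FractionRing A) (IsLocalization.mk' A (s * e) s₃) ≠ 0 := fun h =>
      nonZeroDivisors.ne_zero hz
        (IsFractionRing.injective A (FractionRing A) (h.trans (map_zero _).symm))
    have hs0 : algebraMap R (FractionRing A) s ≠ 0 := by
      rw [← h3]
      refine mul_ne_zero ?_ hz0
      rw [IsScalarTower.algebraMap_apply R A (FractionRing A)]
      exact fun h => (IsLocalization.map_units A s₃).ne_zero
        (IsFractionRing.injective A (FractionRing A) (h.trans (map_zero _).symm))
    apply mul_left_cancel₀ hs0
    rw [h1, Algebra.smul_def, map_mul, ← h2, mul_div_assoc', mul_div_assoc', div_eq_iff hz0, ← h3]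
    ring
  -- A multiple of `c` by an element outside of `p` is integral over `R`, first only after mapping it to
  -- the field of fractions of `A`.
  obtain ⟨⟨s₁, hs₁⟩, hint⟩ :=
    hx.exists_multiple_integral_of_isLocalization p.primeCompl (R := R) x
  obtain ⟨f, hf, hf0⟩ : IsIntegral R (t (s₁ • c)) := by
    have : t (s₁ • c) = s₂ • s₁ • x := by
      rw [smul_comm, hc, Algebra.smul_def, map_mul, ← htu, Algebra.smul_def]
    rw [this]
    exact hint.smul s₂
  have h0 : t (Polynomial.aeval (s₁ • c) f) = 0 := by
    rw [Polynomial.aeval_def, Polynomial.hom_eval₂, ← hf0]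
    congr 1
    exact RingHom.ext fun r => (htu r).symm
  obtain ⟨s₃, hs₃, a, h3⟩ := exists_smul_eq_smul_of_map_eq p
    (IsFractionRing.injective A (FractionRing A)) t ht (y := Polynomial.aeval (s₁ • c) f) (m := 0)
    (c := 0) (by rw [h0, map_zero, zero_mul])
  rw [smul_zero] at h3
  -- The monic equation holds in `Q` after multiplication by `s₃`; scaling the roots by `s₃` absorbs it.
  obtain ⟨r, hr⟩ := hQ (s₃ • s₁ • c) (by
    refine ⟨f.scaleRoots s₃, (Polynomial.monic_scaleRoots_iff s₃).mpr hf, ?_⟩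
    rw [Algebra.smul_def s₃, Polynomial.scaleRoots_eval₂_mul]
    rw [Polynomial.aeval_def, Algebra.smul_def] at h3
    have hd : f.natDegree ≠ 0 := fun hd => by
      rw [Polynomial.eq_one_of_monic_natDegree_zero hf hd, Polynomial.eval₂_one, mul_one] at h3
      exact hs₃ (by rw [IsFractionRing.injective R Q (h3.trans (map_zero _).symm)]
                    exact p.zero_mem)
    obtain ⟨n, hn⟩ := Nat.exists_eq_succ_of_ne_zero hd
    rw [hn, pow_succ, mul_assoc, h3, mul_zero])
  refine ⟨IsLocalization.mk' A r (⟨s₃ * s₁ * s₂, p.primeCompl.mul_mem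
    (p.primeCompl.mul_mem hs₃ hs₁) hs₂⟩ : p.primeCompl), ?_⟩
  have hne : algebraMap R (FractionRing A) (s₃ * s₁ * s₂) ≠ 0 := by
    rw [IsScalarTower.algebraMap_apply R A (FractionRing A)]
    refine fun h => (IsLocalization.map_units A (⟨s₃ * s₁ * s₂, p.primeCompl.mul_mem
    (p.primeCompl.mul_mem hs₃ hs₁) hs₂⟩ : p.primeCompl)).ne_zero
      (IsFractionRing.injective A (FractionRing A) (h.trans (map_zero _).symm))
  apply mul_left_cancel₀ hne
  have h4 := congrArg (algebraMap A (FractionRing A)) (IsLocalization.mk'_spec' A r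
    (⟨s₃ * s₁ * s₂, p.primeCompl.mul_mem (p.primeCompl.mul_mem hs₃ hs₁) hs₂⟩ : p.primeCompl))
  rw [map_mul, ← ht r, hr] at h4
  rw [IsScalarTower.algebraMap_apply R A (FractionRing A), h4, Algebra.smul_def, Algebra.smul_def,
    map_mul, map_mul, ← hc, ← htu, ← htu, Algebra.smul_def,
    ← IsScalarTower.algebraMap_apply R A (FractionRing A), map_mul, map_mul]
  ring

lemma IsNormalRing.of_ringEquiv [IsNoetherianRing R] [IsNormalRing R] {S : Type u} [CommRing S]
    (e : R ≃+* S) : IsNormalRing S := by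
  have := isNoetherianRing_of_ringEquiv R e
  have := IsNormalRing.isReduced (R := R)
  have : IsReduced S := isReduced_of_injective e.symm e.symm.injective
  refine isNormalRing_of_forall_isIntegral (Q := FractionRing S) fun x hx => ?_
  let φ : FractionRing S ≃+* FractionRing R := IsFractionRing.ringEquivOfRingEquiv e.symm
  have hφ : ∀ y, φ (algebraMap S _ y) = algebraMap R _ (e.symm y) := fun y =>
    IsFractionRing.ringEquivOfRingEquiv_algebraMap e.symm y
  have hint : IsIntegral R (φ x) :=
    hx.map_of_comp_eq (e.symm : S →+* R) (φ : FractionRing S →+* FractionRing R)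
      (RingHom.ext fun y => (hφ y).symm)
  obtain ⟨r, hr⟩ := IsNormalRing.mem_range_of_isIntegral hint
  refine ⟨e r, φ.injective ?_⟩
  rw [hφ, e.symm_apply_apply, hr]

end Criterion

/-! ### Prime ideals of denominators -/

section Hartogs

variable {R : Type u} [CommRing R]

/-- The determinant trick: an element that maps a finitely generated faithful module into itself is
integral. Faithfulness is ensured by the unit `u`. -/
lemma isIntegral_of_mul_mem_of_fg {Q : Type*} [CommRing Q] [Algebra R Q] {N : Submodule R Q}
    (hN : N.FG) {u : Q} (hu : IsUnit u) (huN : u ∈ N) {x : Q} (hx : ∀ n ∈ N, x * n ∈ N) :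
    IsIntegral R x := by
  have : Module.Finite R N := by rwa [Module.Finite.iff_fg]
  let φ : Module.End R N := (LinearMap.mulLeft R x).restrict hx
  have hφ : ∀ (f : Polynomial R) (n : N),
      ((Polynomial.aeval φ f n : N) : Q) = Polynomial.aeval x f * n := by
    intro f
    induction f using Polynomial.induction_on' with
    | add f g hf hg => intro n; simp [hf, hg, add_mul]
    | monomial i a =>
      intro n
      rw [Polynomial.aeval_monomial, Polynomial.aeval_monomial, Module.End.mul_apply]
      induction i generalizing n with
      | zero => simp [Algebra.smul_def]
      | succ i ih =>
        rw [pow_succ φ, Module.End.mul_apply, ih]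
        change _ * (x * (n : Q)) = _
        ring
  obtain ⟨f, hf, hf0⟩ := LinearMap.exists_monic_and_aeval_eq_zero R φ
  refine ⟨f, hf, hu.mul_right_cancel ?_⟩
  have := hφ f ⟨u, huN⟩
  rw [hf0] at this
  rw [zero_mul, ← Polynomial.aeval_def]
  exact this.symm

variable [IsNoetherianRing R]

/-- If an element of a module over a Noetherian ring is not in a submodule, then a multiple of it
is not in the submodule and has prime ideal of denominators. -/
lemma exists_prime_denominators {V : Type*} [AddCommGroup V] [Module R V] (M : Submodule R V)
    {x : V} (hx : x ∉ M) : ∃ (p : Ideal R) (a : R), p.IsPrime ∧ ∀ r : R, r ∈ p ↔ r • a • x ∈ M := by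
  have hne : M.mkQ x ≠ 0 := by simpa using hx
  let z : Submodule.span R {M.mkQ x} := ⟨M.mkQ x, Submodule.mem_span_singleton_self _⟩
  obtain ⟨p, hp, -⟩ := exists_le_isAssociatedPrime_of_isNoetherianRing R z
    (fun h => hne (congrArg Subtype.val h))
  obtain ⟨hp, ⟨y, hy'⟩, hy⟩ := isAssociatedPrime_iff.mp hp
  obtain ⟨a, rfl⟩ := Submodule.mem_span_singleton.mp hy'
  refine ⟨p, a, hp, fun r => ?_⟩
  rw [hy, Submodule.mem_colon_singleton, Submodule.mem_bot, ← Subtype.coe_inj]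
  change r • a • M.mkQ x = 0 ↔ _
  rw [← map_smul, ← map_smul, Submodule.mkQ_apply, Submodule.Quotient.mk_eq_zero]

/-- On a normal Noetherian ring, a prime ideal of denominators has height one. -/
lemma height_eq_one_of_mem_iff [IsNormalRing R] {Q : Type*} [CommRing Q] [Algebra R Q]
    [IsFractionRing R Q] (p : Ideal R) [p.IsPrime] {x : Q}
    (hx : ∀ r : R, r ∈ p ↔ ∃ b, algebraMap R Q b = r • x) : p.height = 1 := by
  have hinj := IsFractionRing.injective R Q
  obtain ⟨s, hsx⟩ : ∃ s : R⁰, ∃ b, algebraMap R Q b = (s : R) • x := by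
    obtain ⟨b, s, rfl⟩ := IsLocalization.exists_mk'_eq R⁰ x
    exact ⟨s, b, by rw [Algebra.smul_def, IsLocalization.mk'_spec']⟩
  have hsp : (s : R) ∈ p := (hx s).mpr hsx
  refine le_antisymm ?_ ?_
  · -- Some element of `p` is sent outside of `p` by `x`, else `x` would be integral.
    obtain ⟨π, hπ, c, hc, hcp⟩ : ∃ π ∈ p, ∃ c, algebraMap R Q c = π • x ∧ c ∉ p := by
      by_contra! hcon
      have hint : IsIntegral R x := by
        refine isIntegral_of_mul_mem_of_fg (N := Submodule.map (Algebra.linearMap R Q) p)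
          ((IsNoetherian.noetherian p).map _) (IsLocalization.map_units Q s)
          ⟨s, hsp, rfl⟩ ?_
        rintro _ ⟨y, hy, rfl⟩
        obtain ⟨c, hc⟩ := (hx y).mp hy
        exact ⟨c, hcon y hy c hc, by
          rw [Algebra.linearMap_apply, hc, Algebra.smul_def, mul_comm, Algebra.linearMap_apply]⟩
      obtain ⟨r, hr⟩ := IsNormalRing.mem_range_of_isIntegral hint
      exact (inferInstance : p.IsPrime).one_notMem ((hx 1).mpr ⟨r, by rw [hr, one_smul]⟩)
    -- By Krull's principal ideal theorem it suffices that `p` is minimal over `π`; in fact `c y = π d` for all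
    -- `y ∈ p`, and `c ∉ p`.
    refine Ideal.height_le_one_of_isPrincipal_of_mem_minimalPrimes (Ideal.span {π}) p ⟨⟨inferInstance,
      (Ideal.span_singleton_le_iff_mem p).mpr hπ⟩, fun q ⟨hq, hπq⟩ hqp y hy => ?_⟩
    obtain ⟨d, hd⟩ := (hx y).mp hy
    have h1 : c * y = π * d := hinj (by
      rw [map_mul, map_mul, hc, hd, Algebra.smul_def, Algebra.smul_def]; ring)
    refine (hq.mem_or_mem (show c * y ∈ q from ?_)).resolve_left fun h => hcp (hqp h)
    rw [h1]
    exact q.mul_mem_right _ (hπq (Ideal.mem_span_singleton_self π))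
  · rw [Order.one_le_iff_ne_zero, Ne, Ideal.height_eq_zero_iff]
    exact fun h => notMem_minimalPrimes_of_mem_nonZeroDivisors s.2 h hsp

end Hartogs

/-! ### Valuations at prime divisors -/

section Valuation

variable {R : Type u} [CommRing R]

lemma exists_algebraMap_eq_smul (x : FractionRing R) : ∃ s ∈ R⁰, ∃ a : R,
    algebraMap R (FractionRing R) a = s • x := by
  obtain ⟨a, s, rfl⟩ := IsLocalization.exists_mk'_eq R⁰ x
  exact ⟨s, s.2, a, by rw [Algebra.smul_def, IsLocalization.mk'_spec']⟩

lemma mem_nonZeroDivisors_of_isUnit_algebraMap {Q : Type*} [CommRing Q] [Algebra R Q]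
    [IsFractionRing R Q] {a : R} (h : IsUnit (algebraMap R Q a)) : a ∈ R⁰ := by
  rw [mem_nonZeroDivisors_iff_right]
  intro b hb
  have h1 := congrArg (algebraMap R Q) hb
  rw [map_mul, map_zero, h.mul_left_eq_zero] at h1
  exact IsFractionRing.injective R Q (h1.trans (map_zero _).symm)

/-- A nonzerodivisor vanishes along finitely many prime divisors only, as these are minimal over it. -/
lemma finite_setOf_mem_primeDivisor [IsNoetherianRing R] {r : R} (hr : r ∈ R⁰) :
    {p : PrimeDivisor R | r ∈ p.asIdeal}.Finite := by
  have hinj : Function.Injective (PrimeDivisor.asIdeal (R := R)) := by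
    rintro ⟨p, _, _⟩ ⟨q, _, _⟩ rfl
    rfl
  refine Set.Finite.of_finite_image (f := PrimeDivisor.asIdeal)
    (((Ideal.span {r}).finite_minimalPrimes_of_isNoetherianRing R).subset ?_) hinj.injOn
  rintro _ ⟨p, hp, rfl⟩
  refine ⟨⟨p.isPrime, (Ideal.span_singleton_le_iff_mem _).mpr hp⟩, fun q ⟨hq, hrq⟩ hqp => ?_⟩
  by_contra hlt
  have h1 := Ideal.height_add_one_le_of_lt_of_isPrime (lt_of_le_not_ge hqp hlt)
  rw [p.height_eq_one] at h1
  have h2 : q.height = 0 := by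
    by_contra h
    have h3 : (2 : ℕ∞) ≤ 1 := (by
      calc (2 : ℕ∞) = 1 + 1 := by norm_num
        _ ≤ _ := by gcongr; exact Order.one_le_iff_ne_zero.mpr h
        _ ≤ 1 := h1)
    exact absurd h3 (by decide)
  rw [Ideal.height_eq_zero_iff] at h2
  exact notMem_minimalPrimes_of_mem_nonZeroDivisors hr h2
    (hrq (Ideal.mem_span_singleton_self r))

lemma PrimeDivisor.eq_of_le {p q : PrimeDivisor R} (h : p.asIdeal ≤ q.asIdeal) : p = q := by
  have : p.asIdeal = q.asIdeal := by
    by_contra hne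
    have h1 := Ideal.height_add_one_le_of_lt_of_isPrime (lt_of_le_of_ne h hne)
    rw [p.height_eq_one, q.height_eq_one] at h1
    exact absurd h1 (by decide)
  cases p; cases q; cases this; rfl

lemma PrimeDivisor.not_le_of_mem_minimalPrimes (p : PrimeDivisor R) {P : Ideal R} (hP : P ∈ minimalPrimes R) :
    ¬ p.asIdeal ≤ P := fun h => by
  have h1 := Ideal.height_mono h
  have := hP.1.1
  rw [p.height_eq_one, Ideal.height_eq_zero_iff.mpr hP] at h1
  exact absurd h1 (by decide)

variable [IsNormalRing R] (p : PrimeDivisor R)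

lemma toLocalFractions_algebraMap (r : R) :
    p.toLocalFractions (algebraMap R (FractionRing R) r) =
      algebraMap p.localRing (FractionRing p.localRing) (algebraMap R p.localRing r) :=
  IsLocalization.map_eq p.nonZeroDivisors_le r

variable [IsNoetherianRing R]

lemma valuation_algebraMap (r : R) :
    p.valuation (algebraMap R (FractionRing R) r) =
      (IsDiscreteValuationRing.maximalIdeal p.localRing).valuation (FractionRing p.localRing)
        (algebraMap p.localRing _ (algebraMap R p.localRing r)) := by
  rw [PrimeDivisor.valuation, Valuation.comap_apply, toLocalFractions_algebraMap]

lemma valuation_algebraMap_lt_one_iff {r : R} :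
    p.valuation (algebraMap R (FractionRing R) r) < 1 ↔ r ∈ p.asIdeal := by
  rw [valuation_algebraMap, IsDedekindDomain.HeightOneSpectrum.valuation_lt_one_iff_mem]
  exact IsLocalization.AtPrime.to_map_mem_maximal_iff p.localRing p.asIdeal r

lemma valuation_algebraMap_eq_one {r : R} (h : r ∉ p.asIdeal) :
    p.valuation (algebraMap R (FractionRing R) r) = 1 :=
  le_antisymm (p.valuation_algebraMap_le_one r)
    (not_lt.mp (mt (valuation_algebraMap_lt_one_iff p).mp h))

/-- If `y` has no larger pole than `m` along `p`, then `y` is a multiple of `m` with a denominator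
outside of `p`. -/
lemma exists_smul_eq_smul_of_valuation_le {y m : FractionRing R}
    (h : p.valuation y ≤ p.valuation m) : ∃ s ∉ p.asIdeal, ∃ a : R, s • y = a • m := by
  have hinj := IsFractionRing.injective p.localRing (FractionRing p.localRing)
  obtain ⟨c, hc⟩ : ∃ c : p.localRing,
      p.toLocalFractions y = algebraMap p.localRing _ c * p.toLocalFractions m := by
    simp only [PrimeDivisor.valuation, Valuation.comap_apply] at h
    by_cases hm : p.toLocalFractions m = 0
    · rw [hm, map_zero, le_zero_iff, map_eq_zero] at h
      exact ⟨0, by rw [h, hm, mul_zero]⟩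
    rcases ValuationRing.isInteger_or_isInteger p.localRing
      (p.toLocalFractions y / p.toLocalFractions m) with ⟨c, hc⟩ | ⟨c, hc⟩
    · exact ⟨c, by rw [hc, div_mul_cancel₀ _ hm]⟩
    · have hy0 : p.toLocalFractions y ≠ 0 ∨ p.toLocalFractions y = 0 := (ne_or_eq _ _)
      rcases hy0 with hy | hy
      · rw [inv_div] at hc
        have hcu : IsUnit c := by
          by_contra hcu
          have h1 : (IsDiscreteValuationRing.maximalIdeal p.localRing).valuation
              (FractionRing p.localRing) (algebraMap p.localRing _ c) < 1 :=
            (IsDedekindDomain.HeightOneSpectrum.valuation_lt_one_iff_mem _ c).mpr hcu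
          rw [hc, map_div₀, div_lt_one₀ (zero_lt_iff.mpr ((map_ne_zero _).mpr hy))] at h1
          exact absurd h (not_le.mpr h1)
        obtain ⟨d, hd⟩ := hcu.exists_right_inv
        have hd' := congrArg (algebraMap p.localRing (FractionRing p.localRing)) hd
        rw [map_mul, hc, map_one] at hd'
        refine ⟨d, ?_⟩
        field_simp at hd'
        rw [mul_comm, ← hd']
      · exact ⟨0, by rw [hy, map_zero, zero_mul]⟩
  exact exists_smul_eq_smul_of_map_eq p.asIdeal hinj p.toLocalFractions
    (toLocalFractions_algebraMap p) hc

lemma valuation_unit_ne_zero (u : (FractionRing R)ˣ) : p.valuation (u : FractionRing R) ≠ 0 := by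
  intro h
  have := congrArg p.valuation u.mul_inv
  rw [map_mul, h, zero_mul, map_one] at this
  exact zero_ne_one this

lemma exists_valuation_eq_exp_neg_one :
    ∃ π : R, p.valuation (algebraMap R (FractionRing R) π) = WithZero.exp (-1 : ℤ) := by
  obtain ⟨ϖ, hϖ⟩ := (IsDiscreteValuationRing.maximalIdeal
    p.localRing).valuation_exists_uniformizer' (FractionRing p.localRing)
  obtain ⟨a, s, rfl⟩ := IsLocalization.exists_mk'_eq p.asIdeal.primeCompl ϖ
  refine ⟨a, ?_⟩
  have := congrArg (fun z => (IsDiscreteValuationRing.maximalIdeal p.localRing).valuation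
    (FractionRing p.localRing) (algebraMap p.localRing _ z))
    (IsLocalization.mk'_spec' p.localRing a s)
  simp only [map_mul] at this
  rw [valuation_algebraMap, ← this, ← valuation_algebraMap, valuation_algebraMap_eq_one p s.2,
    one_mul, hϖ]

lemma finite_setOf_valuation_unit_ne_one (u : (FractionRing R)ˣ) :
    {p : PrimeDivisor R | p.valuation (u : FractionRing R) ≠ 1}.Finite := by
  obtain ⟨s, hs, a, ha⟩ := exists_algebraMap_eq_smul (u : FractionRing R)
  have hsu := IsLocalization.map_units (FractionRing R) (⟨s, hs⟩ : R⁰)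
  have ha' : a ∈ R⁰ := by
    refine mem_nonZeroDivisors_of_isUnit_algebraMap (Q := FractionRing R) ?_
    rw [ha, Algebra.smul_def]
    exact hsu.mul u.isUnit
  refine ((finite_setOf_mem_primeDivisor hs).union (finite_setOf_mem_primeDivisor ha')).subset
    fun p hp => ?_
  by_contra hcon
  simp only [Set.mem_union, Set.mem_ofPred_eq, not_or] at hcon
  refine hp ?_
  have := congrArg p.valuation ha
  rwa [Algebra.smul_def, map_mul, valuation_algebraMap_eq_one p hcon.1,
    valuation_algebraMap_eq_one p hcon.2, one_mul, eq_comm] at this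

/-- A nonzerodivisor which is a uniformizer at one prime divisor, and a unit at finitely many given
others. -/
lemma exists_uniformizer (F : Set (PrimeDivisor R)) (hF : F.Finite) :
    ∃ π ∈ R⁰, p.valuation (algebraMap R (FractionRing R) π) = WithZero.exp (-1 : ℤ) ∧
      ∀ q ∈ F, q ≠ p → π ∉ q.asIdeal := by
  classical
  have := IsNormalRing.isReduced (R := R)
  -- Prime avoidance allows one ideal that is not prime: here the ideal `J` of all functions that vanish
  -- to second order along `p`. The minimal primes are avoided in order to get a nonzerodivisor.
  let J : Ideal R :=
    { carrier := {r | p.valuation (algebraMap R (FractionRing R) r) < WithZero.exp (-1 : ℤ)}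
      zero_mem' := by simp
      add_mem' := fun {a b} ha hb => by
        change p.valuation _ < _
        rw [map_add]
        exact (Valuation.map_add _ _ _).trans_lt (max_lt ha hb)
      smul_mem' := fun r a ha => by
        change p.valuation _ < _
        rw [smul_eq_mul, map_mul, map_mul]
        exact ((mul_le_mul_left (p.valuation_algebraMap_le_one r) _).trans (one_mul _).le).trans_lt
          ha }
  have hfin := (hF.image PrimeDivisor.asIdeal).union (minimalPrimes.finite_of_isNoetherianRing R)
  let T : Finset (Option (Ideal R)) := insert none
    ((hfin.toFinset.erase p.asIdeal).image some)
  let f : Option (Ideal R) → Ideal R := fun i => i.elim J id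
  have hnot : ¬ ((p.asIdeal : Set R) ⊆ ⋃ i ∈ (T : Set (Option (Ideal R))), f i) := by
    intro h
    obtain ⟨i, hi, hle⟩ := (Ideal.subset_union_prime (s := T) (f := f) none none (by
      rintro (_ | P) hi h1 _
      · exact absurd rfl h1
      · simp only [T, Finset.mem_insert, Finset.mem_image, Finset.mem_erase, Set.Finite.mem_toFinset,
          reduceCtorEq, false_or, Option.some.injEq, exists_eq_right] at hi
        rcases hi.2 with ⟨q, -, rfl⟩ | hP
        · exact q.isPrime
        · exact hP.1.1) (I := p.asIdeal)).mp h
    rcases i with _ | P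
    · obtain ⟨π, hπ⟩ := exists_valuation_eq_exp_neg_one p
      have h1 : π ∈ p.asIdeal := by
        rw [← valuation_algebraMap_lt_one_iff, hπ, ← WithZero.exp_zero, WithZero.exp_lt_exp]
        decide
      have h2 : p.valuation (algebraMap R (FractionRing R) π) < WithZero.exp (-1 : ℤ) := hle h1
      exact absurd hπ h2.ne
    · simp only [T, Finset.mem_insert, Finset.mem_image, Finset.mem_erase, Set.Finite.mem_toFinset,
          reduceCtorEq, false_or, Option.some.injEq, exists_eq_right] at hi
      rcases hi.2 with ⟨q, -, rfl⟩ | hP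
      · exact hi.1 (by rw [PrimeDivisor.eq_of_le hle])
      · exact PrimeDivisor.not_le_of_mem_minimalPrimes p hP hle
  obtain ⟨π, hπp, hπ⟩ := Set.not_subset.mp hnot
  simp only [Set.mem_iUnion, not_exists] at hπ
  refine ⟨π, mem_nonZeroDivisors_of_notMem_minimalPrimes fun P hP h => ?_, ?_, fun q hq hne h => ?_⟩
  · refine hπ (some P) ?_ h
    simp only [T, Finset.coe_insert, Set.mem_insert_iff, reduceCtorEq, false_or, Finset.mem_coe,
      Finset.mem_image, Finset.mem_erase, Set.Finite.mem_toFinset, Option.some.injEq,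
      exists_eq_right]
    exact ⟨fun h => PrimeDivisor.not_le_of_mem_minimalPrimes p hP h.ge, Or.inr hP⟩
  · refine le_antisymm ?_ (not_lt.mp (fun h => hπ none (by simp [T]) h))
    rw [← WithZero.lt_mul_exp_iff_le WithZero.exp_ne_zero, ← WithZero.exp_add]
    simpa using (valuation_algebraMap_lt_one_iff p).mpr hπp
  · refine hπ (some q.asIdeal) ?_ h
    simp only [T, Finset.coe_insert, Set.mem_insert_iff, reduceCtorEq, false_or, Finset.mem_coe,
      Finset.mem_image, Finset.mem_erase, Set.Finite.mem_toFinset, Option.some.injEq,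
      exists_eq_right]
    exact ⟨fun h => hne (PrimeDivisor.eq_of_le h.le), Or.inl ⟨q, hq, rfl⟩⟩

/-- Approximation: there is an invertible section of `𝒪(E)` that generates it at finitely many
given prime divisors. -/
lemma exists_unit_valuation (E : WeilDivisor R) (B : Set (PrimeDivisor R)) (hB : B.Finite) :
    ∃ u : (FractionRing R)ˣ, (∀ p : PrimeDivisor R, p.valuation (u : FractionRing R) ≤
      WithZero.exp (E p)) ∧
      ∀ p ∈ B, p.valuation (u : FractionRing R) = WithZero.exp (E p) := by
  classical
  have := IsNormalRing.isReduced (R := R)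
  let F : Finset (PrimeDivisor R) := hB.toFinset ∪ E.support
  choose π hπ hπv hπF using fun p : PrimeDivisor R => exists_uniformizer p (F : Set _) F.finite_toSet
  let v : PrimeDivisor R → (FractionRing R)ˣ := fun p =>
    (IsLocalization.map_units (FractionRing R) (⟨π p, hπ p⟩ : R⁰)).unit
  have hv : ∀ p, (v p : FractionRing R) = algebraMap R _ (π p) := fun p => rfl
  -- A product of uniformizers generates `𝒪(E)` at the primes in `F`.
  let g : (FractionRing R)ˣ := ∏ q ∈ F, v q ^ (-E q)
  have hg : ∀ p ∈ F, p.valuation (g : FractionRing R) = WithZero.exp (E p) := by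
    intro p hp
    have h1 : p.valuation (g : FractionRing R) =
        ∏ q ∈ F, p.valuation ((v q ^ (-E q) : (FractionRing R)ˣ) : FractionRing R) := by
      simp only [g, Units.coe_prod, map_prod]
    have h2 : ∀ q, p.valuation ((v q ^ (-E q) : (FractionRing R)ˣ) : FractionRing R) =
        (p.valuation (v q : FractionRing R)) ^ (-E q) := by
      intro q
      have := map_zpow (Units.map (p.valuation : FractionRing R →* WithZero (Multiplicative ℤ)))
        (v q) (-E q)
      refine (congrArg Units.val this).trans ?_
      rw [Units.val_zpow_eq_zpow_val]
      rfl
    rw [h1, Finset.prod_eq_single p]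
    · rw [h2, hv, hπv, ← WithZero.exp_zsmul]
      simp
    · intro q _ hne
      rw [h2, hv, valuation_algebraMap_eq_one p (hπF q p hp hne.symm), one_zpow]
    · exact fun h => absurd hp h
  -- The possible poles of `g` outside of `F` are removed by a power of a function `t` that vanishes along
  -- them and is a unit along the primes in `F`.
  let C : Set (PrimeDivisor R) := {p | p ∉ F ∧ p.valuation (g : FractionRing R) ≠ 1}
  have hC : C.Finite := (finite_setOf_valuation_unit_ne_one g).subset fun _ h => h.2
  obtain ⟨t, htC, htF⟩ := exists_mem_notMem_of_finite (hC.image PrimeDivisor.asIdeal)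
    ((F.finite_toSet.image PrimeDivisor.asIdeal).union (minimalPrimes.finite_of_isNoetherianRing R))
    (by
      rintro _ (⟨q, -, rfl⟩ | hP)
      · exact q.isPrime
      · exact hP.1.1)
    (by
      rintro _ ⟨p, hp, rfl⟩ _ (⟨q, hq, rfl⟩ | hP) hle
      · exact hp.1 (PrimeDivisor.eq_of_le hle ▸ hq)
      · exact PrimeDivisor.not_le_of_mem_minimalPrimes p hP hle)
  have ht : t ∈ R⁰ := mem_nonZeroDivisors_of_notMem_minimalPrimes fun P hP => htF P (Or.inr hP)
  have hN : ∀ p ∈ C, ∃ n : ℕ, ∀ m ≥ n,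
      p.valuation (algebraMap R (FractionRing R) t) ^ m * p.valuation (g : FractionRing R) ≤ 1 := by
    intro p hp
    have h1 : p.valuation (algebraMap R (FractionRing R) t) ≤ WithZero.exp (-1 : ℤ) := by
      rw [← WithZero.lt_mul_exp_iff_le WithZero.exp_ne_zero, ← WithZero.exp_add]
      simpa using (valuation_algebraMap_lt_one_iff p).mpr (htC _ ⟨p, hp, rfl⟩)
    refine ⟨(WithZero.log (p.valuation (g : FractionRing R))).toNat, fun m hm => ?_⟩
    rw [← WithZero.exp_log (valuation_unit_ne_zero p g)]
    refine (mul_le_mul_left (pow_le_pow_left₀ zero_le h1 m) _).trans ?_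
    rw [← WithZero.exp_nsmul, ← WithZero.exp_add, ← WithZero.exp_zero, WithZero.exp_le_exp]
    simp only [nsmul_eq_mul]
    omega
  choose! n hn using hN
  obtain ⟨N, hN⟩ := (hC.image n).bddAbove
  let w : (FractionRing R)ˣ := (IsLocalization.map_units (FractionRing R) (⟨t, ht⟩ : R⁰)).unit
  have hw : ∀ p : PrimeDivisor R, p.valuation ((w ^ N * g : (FractionRing R)ˣ) : FractionRing R) =
      p.valuation (algebraMap R (FractionRing R) t) ^ N * p.valuation (g : FractionRing R) := by
    intro p
    rw [Units.val_mul, Units.val_pow_eq_pow_val, map_mul, map_pow]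
    rfl
  have hF : ∀ p ∈ F, p.valuation ((w ^ N * g : (FractionRing R)ˣ) : FractionRing R) =
      WithZero.exp (E p) := fun p hp => by
    rw [hw, valuation_algebraMap_eq_one p (htF _ (Or.inl ⟨p, hp, rfl⟩)), one_pow, one_mul, hg p hp]
  refine ⟨w ^ N * g, fun p => ?_, fun p hp => hF p (by simp [F, hp])⟩
  by_cases hp : p ∈ F
  · exact (hF p hp).le
  · have hE : E p = 0 := by
      by_contra h
      exact hp (by simp [F, h])
    rw [hw, hE, WithZero.exp_zero]
    by_cases h1 : p.valuation (g : FractionRing R) = 1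
    · rw [h1, mul_one]
      exact pow_le_one₀ zero_le (p.valuation_algebraMap_le_one t)
    · exact hn p ⟨hp, h1⟩ N (hN ⟨p, ⟨hp, h1⟩, rfl⟩)

end Valuation

/-! ### Divisorial modules -/

section Sections

variable {R : Type u} [CommRing R] [IsNoetherianRing R] [IsNormalRing R]

/-- A rational function without poles along prime divisors on a normal Noetherian scheme is
regular. -/
lemma exists_algebraMap_eq_of_valuation_le_one {x : FractionRing R}
    (hx : ∀ p : PrimeDivisor R, p.valuation x ≤ 1) : ∃ r, algebraMap R (FractionRing R) r = x := by
  by_contra hcon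
  obtain ⟨p, a, hp, hpa⟩ := exists_prime_denominators (1 : Submodule R (FractionRing R)) (x := x)
    (by simpa [Submodule.mem_one] using hcon)
  have hheight : p.height = 1 := height_eq_one_of_mem_iff p (x := a • x) (fun r => by
    rw [hpa, Submodule.mem_one])
  let P : PrimeDivisor R := ⟨p, hp, hheight⟩
  obtain ⟨s, hs, b, hb⟩ := exists_smul_eq_smul_of_valuation_le P (y := a • x) (m := 1) (by
    rw [Algebra.smul_def, map_mul, map_one]
    exact mul_le_one' (P.valuation_algebraMap_le_one a) (hx P))
  refine hs ((hpa s).mpr ?_)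
  rw [hb, Submodule.mem_one]
  exact ⟨b, by rw [Algebra.smul_def, mul_one]⟩

lemma exists_unit_mem_sections (K : WeilDivisor R) :
    ∃ u : (FractionRing R)ˣ, (u : FractionRing R) ∈ K.sections := by
  obtain ⟨u, hu, -⟩ := exists_unit_valuation K ∅ Set.finite_empty
  exact ⟨u, hu⟩

/-- `𝒪(K)` is finitely generated: multiplication by an invertible section of `𝒪(-K)` embeds it into `R`. -/
instance finite_sections (K : WeilDivisor R) : Module.Finite R K.sections := by
  obtain ⟨u, hu, -⟩ := exists_unit_valuation (-K) ∅ Set.finite_empty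
  have h : ∀ x ∈ K.sections, (LinearMap.mulLeft R (u : FractionRing R)) x ∈
      (1 : Submodule R (FractionRing R)) := by
    intro x hx
    rw [Submodule.mem_one]
    refine exists_algebraMap_eq_of_valuation_le_one fun p => ?_
    rw [LinearMap.mulLeft_apply, map_mul]
    refine (mul_le_mul' (hu p) (hx p)).trans ?_
    rw [← WithZero.exp_add]
    simp
  have : Module.Finite R (1 : Submodule R (FractionRing R)) := by
    rw [Module.Finite.iff_fg, Submodule.one_eq_span]
    exact Submodule.fg_span_singleton _
  refine Module.Finite.of_injective ((LinearMap.mulLeft R (u : FractionRing R)).restrict h) ?_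
  intro x y hxy
  have h1 : (u : FractionRing R) * x = u * y := congrArg Subtype.val hxy
  exact Subtype.ext (u.isUnit.mul_left_cancel h1)

/-- The endomorphism ring of the divisorial module `𝒪(K)` is `R`. -/
lemma exists_eq_smul_of_end_sections {K : WeilDivisor R} (φ : K.sections →ₗ[R] K.sections) :
    ∃ r : R, ∀ x, φ x = r • x := by
  obtain ⟨u, hu⟩ := exists_unit_mem_sections K
  let q : FractionRing R := (φ ⟨u, hu⟩ : FractionRing R) * ↑u⁻¹
  have hq : ∀ x : K.sections, (φ x : FractionRing R) = q * x := by
    intro x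
    obtain ⟨s, hs, a, ha⟩ := exists_algebraMap_eq_smul ((x : FractionRing R) * ((u⁻¹ : (FractionRing R)ˣ) : FractionRing R))
    have h1 : s • x = a • (⟨u, hu⟩ : K.sections) := Subtype.ext (by
      change s • (x : FractionRing R) = a • (u : FractionRing R)
      rw [Algebra.smul_def a, ha, smul_mul_assoc, mul_assoc, u.inv_mul, mul_one])
    have h2 := congrArg (fun z => (φ z : FractionRing R)) h1
    simp only [map_smul, Submodule.coe_smul, Algebra.smul_def] at h2
    have h3 : algebraMap R (FractionRing R) s * x = algebraMap R _ a * u := by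
      simpa [Algebra.smul_def] using congrArg Subtype.val h1
    apply (IsLocalization.map_units (FractionRing R) (⟨s, hs⟩ : R⁰)).mul_left_cancel
    change algebraMap R (FractionRing R) s * _ = algebraMap R (FractionRing R) s * _
    rw [h2, mul_left_comm, h3]
    simp only [q]
    rw [mul_assoc, mul_left_comm (↑u⁻¹ : FractionRing R), u.inv_mul, mul_one, mul_comm]
  obtain ⟨r, hr⟩ : ∃ r, algebraMap R (FractionRing R) r = q := by
    refine exists_algebraMap_eq_of_valuation_le_one fun p => ?_
    obtain ⟨w, hw, hwp⟩ := exists_unit_valuation K {p} (Set.finite_singleton p)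
    have h1 := (φ ⟨w, hw⟩).2 p
    rw [hq, map_mul, hwp p rfl] at h1
    exact (mul_le_iff_le_one_left (zero_lt_iff.mpr WithZero.exp_ne_zero)).mp h1
  refine ⟨r, fun x => Subtype.ext ?_⟩
  rw [hq, ← hr, ← Algebra.smul_def]
  rfl

/-- A prime of height at least two contains a strictly smaller prime that is not minimal. -/
lemma exists_lt_prime_mem_nonZeroDivisors {p : Ideal R} [p.IsPrime] {s : R} (hs : s ∈ R⁰)
    (hsp : s ∈ p) (hp : p.height ≠ 1) : ∃ q < p, q.IsPrime ∧ ∃ t ∈ q, t ∈ R⁰ := by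
  have := IsNormalRing.isReduced (R := R)
  have h1 : ¬ p.height ≤ 1 := fun h => hp (le_antisymm h (by
    rw [Order.one_le_iff_ne_zero, Ne, Ideal.height_eq_zero_iff]
    exact fun h => notMem_minimalPrimes_of_mem_nonZeroDivisors hs h hsp))
  have h2 := Ideal.height_le_iff (p := p) (n := 1)
  rw [Nat.cast_one] at h2
  rw [h2] at h1
  push Not at h1
  obtain ⟨q, hq, hqp, hq1⟩ := h1
  refine ⟨q, hqp, hq, ?_⟩
  obtain ⟨t, htq, ht⟩ := exists_mem_forall_notMem_of_not_le
    (minimalPrimes.finite_of_isNoetherianRing R).toFinset id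
    (fun P hP => ((Set.Finite.mem_toFinset _).mp hP).1.1) q (fun P hP hle => by
      have hP := (Set.Finite.mem_toFinset _).mp hP
      have : q ∈ minimalPrimes R := (le_antisymm hle (hP.2 ⟨hq, bot_le⟩ hle)) ▸ hP
      rw [← Ideal.height_eq_zero_iff] at this
      rw [this] at hq1
      exact absurd hq1 (by decide))
  exact ⟨t, htq, mem_nonZeroDivisors_of_notMem_minimalPrimes fun P hP =>
    ht P ((Set.Finite.mem_toFinset _).mpr hP)⟩

/-- A finitely generated submodule of the total ring of fractions, of full rank, is divisorial if
its quotients have no associated primes of height at least two. -/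
lemma exists_sections_eq {M : Submodule R (FractionRing R)} (hM : M.FG) {u : (FractionRing R)ˣ}
    (hu : (u : FractionRing R) ∈ M)
    (hS2 : ∀ p q : Ideal R, p.IsPrime → q.IsPrime → q < p → (∃ t ∈ q, t ∈ R⁰) →
      ∀ y, (∀ r ∈ p, r • y ∈ M) → y ∈ M) :
    ∃ K : WeilDivisor R, K.sections = M := by
  classical
  obtain ⟨G, rfl⟩ := hM
  -- The multiplicity of `K` at `p` is the largest pole order of a generator of `M`.
  have hmax : ∀ p : PrimeDivisor R, ∃ m ∈ insert (u : FractionRing R) G,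
      ∀ x ∈ Submodule.span R (G : Set (FractionRing R)), p.valuation x ≤ p.valuation m := by
    intro p
    obtain ⟨m, hm, hmax⟩ := Finset.exists_max_image (insert (u : FractionRing R) G) p.valuation
      ⟨_, Finset.mem_insert_self _ _⟩
    refine ⟨m, hm, fun x hx => ?_⟩
    induction hx using Submodule.span_induction with
    | mem x hx => exact hmax x (Finset.mem_insert_of_mem hx)
    | zero => rw [map_zero]; exact zero_le
    | add x y _ _ hx hy => exact (Valuation.map_add _ _ _).trans (max_le hx hy)
    | smul a x _ hx =>
      rw [Algebra.smul_def, map_mul]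
      exact (mul_le_mul' (p.valuation_algebraMap_le_one a) hx).trans (one_mul _).le
  choose m hm hmv using hmax
  have hmM : ∀ p, m p ∈ Submodule.span R (G : Set (FractionRing R)) := fun p => by
    rcases Finset.mem_insert.mp (hm p) with h | h
    · rw [h]; exact hu
    · exact Submodule.subset_span h
  have hm0 : ∀ p : PrimeDivisor R, p.valuation (m p) ≠ 0 := fun p h => by
    have := hmv p _ hu
    rw [h, le_zero_iff] at this
    exact valuation_unit_ne_zero p u this
  obtain ⟨s, hs⟩ := IsLocalization.exist_integer_multiples_of_finset R⁰
    (insert (u : FractionRing R) G)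
  have hfin : {p : PrimeDivisor R | WithZero.log (p.valuation (m p)) ≠ 0}.Finite := by
    refine ((finite_setOf_valuation_unit_ne_one u).union
      (finite_setOf_mem_primeDivisor s.2)).subset fun p hp => ?_
    by_contra hcon
    simp only [Set.mem_union, Set.mem_ofPred_eq, not_or, not_not] at hcon
    have h1 : (1 : WithZero (Multiplicative ℤ)) ≤ p.valuation (m p) := hcon.1 ▸ hmv p _ hu
    obtain ⟨b, hb⟩ := hs (m p) (hm p)
    have h2 : p.valuation (m p) ≤ 1 := by
      have h3 := congrArg p.valuation hb
      rw [Algebra.smul_def, map_mul, valuation_algebraMap_eq_one p hcon.2, one_mul] at h3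
      rw [← h3]
      exact p.valuation_algebraMap_le_one b
    exact hp (by rw [le_antisymm h2 h1]; rfl)
  refine ⟨Finsupp.ofSupportFinite (fun p => WithZero.log (p.valuation (m p))) hfin, ?_⟩
  have hK : ∀ p : PrimeDivisor R, WithZero.exp (Finsupp.ofSupportFinite
      (fun p : PrimeDivisor R => WithZero.log (p.valuation (m p))) hfin p) = p.valuation (m p) :=
    fun p => WithZero.exp_log (hm0 p)
  refine le_antisymm (fun x hx => ?_) fun x hx p => ?_
  -- A section of `𝒪(K)` outside of `M` would have a prime ideal `p` of denominators modulo `M`: height one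
  -- is excluded by the choice of `K`, larger height by the hypothesis on `M`.
  · by_contra hxM
    obtain ⟨p, a, hp, hpa⟩ := exists_prime_denominators _ hxM
    have hax := Submodule.smul_mem _ a hx
    obtain ⟨t, ht, b, hb⟩ := exists_algebraMap_eq_smul (R := R)
      ((a • x) * ((u⁻¹ : (FractionRing R)ˣ) : FractionRing R))
    have htp : t ∈ p := by
      rw [hpa]
      have : t • a • x = b • (u : FractionRing R) := by
        rw [Algebra.smul_def b, hb, smul_mul_assoc, mul_assoc, u.inv_mul, mul_one]
      rw [this]
      exact Submodule.smul_mem _ _ hu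
    have hnot : a • x ∉ Submodule.span R (G : Set (FractionRing R)) := fun h =>
      hp.one_notMem ((hpa 1).mpr (by rwa [one_smul]))
    by_cases hheight : p.height = 1
    · let P : PrimeDivisor R := ⟨p, hp, hheight⟩
      obtain ⟨s, hs, c, hc⟩ := exists_smul_eq_smul_of_valuation_le P (y := a • x) (m := m P) (by
        rw [← hK]
        exact hax P)
      refine hs ((hpa s).mpr ?_)
      rw [hc]
      exact Submodule.smul_mem _ _ (hmM P)
    · obtain ⟨q, hqp, hq, hqt⟩ := exists_lt_prime_mem_nonZeroDivisors ht htp hheight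
      exact hnot (hS2 p q hp hq hqp hqt _ fun r hr => (hpa r).mp hr)
  · rw [hK]
    exact hmv p x hx

end Sections

/-! ### Derivations of domains -/

section Derivation

/-- A domain essentially of finite type over a field `k`, and not itself a field, has a nonzero
`k`-derivation: otherwise its field of fractions would be finite separable over `k`. -/
lemma exists_derivation_ne_zero (k T : Type u) [Field k] [CommRing T] [IsDomain T] [Algebra k T]
    [Algebra.EssFiniteType k T] (hT : ¬ IsField T) : ∃ D : Derivation k T T, D ≠ 0 := by
  classical
  let κ := FractionRing T
  have hinj := IsFractionRing.injective T κ
  have : Algebra.EssFiniteType T κ := Algebra.EssFiniteType.of_isLocalization κ T⁰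
  have : Algebra.EssFiniteType k κ := Algebra.EssFiniteType.comp k T κ
  obtain ⟨D₀, hD₀⟩ : ∃ D₀ : Derivation k κ κ, D₀ ≠ 0 := by
    by_contra! hcon
    refine hT ?_
    have hΩ : Subsingleton (Ω[κ⁄k]) := by
      refine subsingleton_of_forall_eq 0 fun ω => ?_
      rw [← Module.forall_dual_apply_eq_zero_iff κ]
      intro φ
      have h1 : ∀ x, φ (KaehlerDifferential.D k κ x) = 0 := fun x =>
        DFunLike.congr_fun (hcon (φ.compDer (KaehlerDifferential.D k κ))) x
      have h2 : ω ∈ Submodule.span κ (Set.range (KaehlerDifferential.D k κ)) := by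
        rw [KaehlerDifferential.span_range_derivation]
        exact Submodule.mem_top
      have h3 : Submodule.span κ (Set.range (KaehlerDifferential.D k κ)) ≤ LinearMap.ker φ := by
        rw [Submodule.span_le]
        rintro _ ⟨x, rfl⟩
        exact h1 x
      exact h3 h2
    have h1 : Algebra.FormallyUnramified k κ :=
      Algebra.formallyUnramified_iff _ _ |>.mpr hΩ
    have h2 := (Algebra.FormallyUnramified.iff_isSeparable k κ).mp h1
    have h3 : Algebra.IsIntegral k κ := inferInstance
    have h4 : Algebra.IsIntegral k T := ⟨fun x => by
      rw [← isIntegral_algHom_iff (IsScalarTower.toAlgHom k T κ) hinj]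
      exact h3.isIntegral _⟩
    exact isField_of_isIntegral_of_isField' (Field.toIsField k)
  let D₁ : Derivation k T κ := D₀.compAlgebraMap T
  obtain ⟨r, hr⟩ : ∃ r, D₁ r ≠ 0 := by
    by_contra! hcon
    refine hD₀ (Derivation.ext fun x => ?_)
    obtain ⟨a, b, hb, rfl⟩ := IsFractionRing.div_surjective (A := T) x
    have hb0 : algebraMap T κ b ≠ 0 := fun h => nonZeroDivisors.ne_zero hb
      (hinj (h.trans (map_zero _).symm))
    have h1 := congrArg D₀ (mul_div_cancel₀ (algebraMap T κ a) hb0)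
    have ha : D₀ (algebraMap T κ a) = 0 := hcon a
    have hb : D₀ (algebraMap T κ b) = 0 := hcon b
    rw [Derivation.leibniz, ha, hb, smul_zero, add_zero, smul_eq_mul] at h1
    exact (mul_eq_zero.mp h1).resolve_left hb0
  let ψ : Ω[T⁄k] →ₗ[T] κ := D₁.liftKaehlerDifferential
  obtain ⟨G, hG⟩ := (Module.Finite.fg_top (R := T) (M := Ω[T⁄k])).map ψ
  obtain ⟨d, hd⟩ := IsLocalization.exist_integer_multiples_of_finset T⁰ G
  have hψ : ∀ ω, ((d : T) • ψ) ω ∈ LinearMap.range (Algebra.linearMap T κ) := by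
    intro ω
    have h1 : ψ ω ∈ Submodule.span T (G : Set κ) := by
      rw [hG]
      exact ⟨ω, Submodule.mem_top, rfl⟩
    have h2 : Submodule.span T (G : Set κ) ≤
        (LinearMap.range (Algebra.linearMap T κ)).comap ((d : T) • LinearMap.id) := by
      rw [Submodule.span_le]
      intro x hx
      exact hd x hx
    exact h2 h1
  let ι := LinearEquiv.ofInjective (Algebra.linearMap T κ) hinj
  let ψ' : Ω[T⁄k] →ₗ[T] T := ι.symm.toLinearMap ∘ₗ ((d : T) • ψ).codRestrict _ hψ
  refine ⟨ψ'.compDer (KaehlerDifferential.D k T), fun h => hr ?_⟩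
  have h1 : ψ' (KaehlerDifferential.D k T r) = 0 := DFunLike.congr_fun h r
  have h2 : ((d : T) • ψ).codRestrict _ hψ (KaehlerDifferential.D k T r) = 0 := by
    simpa [ψ'] using h1
  have h3 : (d : T) • ψ (KaehlerDifferential.D k T r) = 0 := congrArg Subtype.val h2
  rw [Derivation.liftKaehlerDifferential_comp_D, Algebra.smul_def] at h3
  exact (mul_eq_zero.mp h3).resolve_left fun h => nonZeroDivisors.coe_ne_zero d
    (hinj (h.trans (map_zero _).symm))

end Derivation

/-! ### Pencils of functions and derivations -/

section Bertini

variable {k R : Type u} [Field k] [CommRing R] [Algebra k R]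

/-- If `G₁ + c G₂` vanishes to second order along a prime, relative to `G₂`, where `c` is killed by
the derivation `D`, then the numerator of `D (G₁ / G₂)` vanishes along this prime. -/
lemma wronskian_mem {P p : Ideal R} (hPp : P ≤ p) [p.IsPrime] (D : Derivation k R (R ⧸ P))
    {G₁ G₂ c : R} (hc : D c = 0) (hF : G₁ + c * G₂ ∈ p)
    (hDF : Ideal.Quotient.factor hPp (D (G₁ + c * G₂)) = 0) :
    Ideal.Quotient.factor hPp (G₂ • D G₁ - G₁ • D G₂) = 0 := by
  set χ := Ideal.Quotient.factor hPp
  have hs : ∀ (a : R) (x : R ⧸ P), χ (a • x) = Ideal.Quotient.mk p a * χ x := fun a x => by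
    rw [Algebra.smul_def, map_mul]; rfl
  have h1 : Ideal.Quotient.mk p G₁ + Ideal.Quotient.mk p c * Ideal.Quotient.mk p G₂ = 0 := by
    rw [← map_mul, ← map_add]; exact Ideal.Quotient.eq_zero_iff_mem.mpr hF
  rw [map_add, Derivation.leibniz, hc, smul_zero, add_zero, map_add, hs] at hDF
  rw [map_sub, hs, hs]
  linear_combination Ideal.Quotient.mk p G₂ * hDF - χ (D G₂) * h1

/-- If `F` vanishes to second order along `p`, then `D F` vanishes along `p`. Second order vanishing is
expressed by `t F = a π² g`, where `t` is a unit at `p` and `π` vanishes there. -/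
lemma factor_derivation_eq_zero {P p : Ideal R} (hPp : P ≤ p) [p.IsPrime]
    (D : Derivation k R (R ⧸ P)) {F a π g t : R} (ht : t ∉ p) (hπ : π ∈ p)
    (h : t * F = a * (π * π * g)) :
    F ∈ p ∧ Ideal.Quotient.factor hPp (D F) = 0 := by
  set χ := Ideal.Quotient.factor hPp
  have hs : ∀ (a : R) (x : R ⧸ P), χ (a • x) = Ideal.Quotient.mk p a * χ x := fun a x => by
    rw [Algebra.smul_def, map_mul]; rfl
  have hπ0 : Ideal.Quotient.mk p π = 0 := Ideal.Quotient.eq_zero_iff_mem.mpr hπ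
  have ht0 : Ideal.Quotient.mk p t ≠ 0 := fun h => ht (Ideal.Quotient.eq_zero_iff_mem.mp h)
  have h1 := congrArg (Ideal.Quotient.mk p) h
  rw [map_mul, map_mul, map_mul, map_mul, hπ0, zero_mul, zero_mul, mul_zero] at h1
  have hF := (mul_eq_zero.mp h1).resolve_left ht0
  refine ⟨Ideal.Quotient.eq_zero_iff_mem.mp hF, ?_⟩
  have h2 := congrArg (fun x => χ (D x)) h
  simp only [Derivation.leibniz, map_add, hs, map_mul, hF, hπ0, smul_add] at h2
  simp only [zero_mul, mul_zero, add_zero] at h2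
  exact (mul_eq_zero.mp h2).resolve_left ht0

variable [IsNoetherianRing R] [IsNormalRing R]

/-- The multiplicative valuation of a regular function at a prime divisor. -/
noncomputable abbrev ringValuation (p : PrimeDivisor R) (r : R) : WithZero (Multiplicative ℤ) :=
  p.valuation (algebraMap R (FractionRing R) r)

lemma ringValuation_add_eq_left {p : PrimeDivisor R} {a b : R}
    (h : ringValuation p b < ringValuation p a) :
    ringValuation p (a + b) = ringValuation p a := by
  rw [ringValuation, map_add]
  exact Valuation.map_add_eq_of_lt_left _ h

lemma ringValuation_add_eq_right {p : PrimeDivisor R} {a b : R}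
    (h : ringValuation p a < ringValuation p b) :
    ringValuation p (a + b) = ringValuation p b := by
  rw [ringValuation, map_add]
  exact Valuation.map_add_eq_of_lt_right _ h

lemma ringValuation_mul (p : PrimeDivisor R) (a b : R) :
    ringValuation p (a * b) = ringValuation p a * ringValuation p b := by
  rw [ringValuation, map_mul, map_mul]

lemma ringValuation_mul_le (p : PrimeDivisor R) (a b : R) :
    ringValuation p (a * b) ≤ ringValuation p b := by
  rw [ringValuation_mul]
  exact (mul_le_mul_left (p.valuation_algebraMap_le_one a) _).trans (one_mul _).le

lemma ringValuation_pos (p : PrimeDivisor R) {r : R} (hr : r ∈ R⁰) : 0 < ringValuation p r :=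
  zero_lt_iff.mpr
    (valuation_unit_ne_zero p (IsLocalization.map_units (FractionRing R) (⟨r, hr⟩ : R⁰)).unit)

/-- Some `c` killed by the derivation `D` makes the valuation of `G₁ + c G₂` at finitely many primes
as large as the one of `G₂`. In characteristic `ℓ` the element `c` can be taken to be an `ℓ`-th power,
in characteristic zero an integer. -/
lemma exists_constant_ringValuation_eq {N : Type*} [AddCommGroup N] [Module R N] [Module k N]
    (D : Derivation k R N) {B : Set (PrimeDivisor R)} (hB : B.Finite) {G₁ G₂ : R} (hG₂ : G₂ ∈ R⁰)
    (h : ∀ p ∈ B, ringValuation p G₁ ≤ ringValuation p G₂) :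
    ∃ c, D c = 0 ∧ ∀ p ∈ B, ringValuation p (G₁ + c * G₂) = ringValuation p G₂ := by
  obtain ⟨ℓ, hℓ⟩ := CharP.exists k
  rcases CharP.char_is_prime_or_zero k ℓ with hp | rfl
  -- The function `b` vanishes exactly along those primes at which `G₁` already has the valuation of `G₂`.
  · obtain ⟨b, hbS, hbT⟩ := exists_mem_notMem_of_finite
      (S := PrimeDivisor.asIdeal '' {p ∈ B | ringValuation p G₁ = ringValuation p G₂})
      (T := PrimeDivisor.asIdeal '' {p ∈ B | ringValuation p G₁ < ringValuation p G₂})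
      ((hB.subset fun _ h => h.1).image _) ((hB.subset fun _ h => h.1).image _)
      (by rintro _ ⟨p, -, rfl⟩; exact p.isPrime)
      (by
        rintro _ ⟨p, hp, rfl⟩ _ ⟨q, hq, rfl⟩ hle
        rw [PrimeDivisor.eq_of_le hle] at hp
        exact hq.2.ne hp.2)
    refine ⟨b ^ ℓ, ?_, fun p hpB => ?_⟩
    · have h0 : (ℓ : R) = 0 := by
        rw [← map_natCast (algebraMap k R), CharP.cast_eq_zero, map_zero]
      rw [Derivation.leibniz_pow, ← Nat.cast_smul_eq_nsmul R, h0, zero_smul]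
    · rcases (h p hpB).eq_or_lt with h1 | h1
      · rw [← h1]
        refine ringValuation_add_eq_left ?_
        rw [h1, ringValuation_mul]
        refine mul_lt_of_lt_one_left (ringValuation_pos p hG₂) ?_
        rw [valuation_algebraMap_lt_one_iff]
        exact p.asIdeal.pow_mem_of_mem (hbS _ ⟨p, ⟨hpB, h1⟩, rfl⟩) ℓ hp.pos
      · have h2 : ringValuation p (b ^ ℓ * G₂) = ringValuation p G₂ := by
          rw [ringValuation_mul, ringValuation, valuation_algebraMap_eq_one p, one_mul]
          exact fun h => hbT _ ⟨p, ⟨hpB, h1⟩, rfl⟩ (p.isPrime.mem_of_pow_mem _ h)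
        rw [ringValuation_add_eq_right (by rw [h2]; exact h1), h2]
  · have hc0 : CharZero k := CharP.charP_to_charZero k
    -- For each prime at most one integer is bad, as differences of distinct integers are units.
    have hfin : (⋃ p ∈ B, {n : ℕ | ringValuation p (G₁ + n * G₂) < ringValuation p G₂}).Finite := by
      refine hB.biUnion fun p _ => Set.Subsingleton.finite fun n hn m hm => ?_
      by_contra hne
      have hu : IsUnit ((n : R) - m) := by
        have : (n : R) - m = algebraMap k R (n - m) := by simp
        rw [this]
        exact (IsUnit.mk0 _ (sub_ne_zero.mpr (Nat.cast_injective.ne hne))).map _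
      have h1 : ringValuation p (((n : R) - m) * G₂) = ringValuation p G₂ := by
        rw [ringValuation_mul, ringValuation, valuation_algebraMap_eq_one p, one_mul]
        exact fun h => p.isPrime.ne_top (Ideal.eq_top_of_isUnit_mem _ h hu)
      have h2 : ((n : R) - m) * G₂ = (G₁ + n * G₂) - (G₁ + m * G₂) := by ring
      have h3 := Valuation.map_sub p.valuation (algebraMap R _ (G₁ + n * G₂))
        (algebraMap R _ (G₁ + m * G₂))
      rw [← map_sub, ← h2] at h3
      exact absurd h1 (h3.trans_lt (max_lt hn hm)).ne
    obtain ⟨n, hn⟩ := hfin.exists_notMem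
    refine ⟨n, Derivation.map_natCast D n, fun p hp => ?_⟩
    simp only [Set.mem_iUnion, Set.mem_ofPred_eq, not_exists, not_lt] at hn
    refine le_antisymm ?_ (hn p hp)
    rw [ringValuation, map_add]
    exact (Valuation.map_add _ _ _).trans (max_le (h p hp) (ringValuation_mul_le p n G₂))

end Bertini

/-! ### Sections with reduced divisor on one component -/

section Bertini

variable {k R : Type u} [Field k] [CommRing R] [Algebra k R] [IsNoetherianRing R] [IsNormalRing R]

/-- Replacing a function by `1` on the other components does not change its valuations on the component
cut out by `e`. -/
lemma algebraMap_idempotent_mul_add {e : R} (he : IsIdempotentElem e) (p : PrimeDivisor R)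
    (hep : e ∈ p.asIdeal) (r : R) :
    ringValuation p ((1 - e) * r + e) = ringValuation p r := by
  have h0 : ringValuation p e = 0 := by
    have h1 : p.valuation (algebraMap R (FractionRing R) (1 - e)) = 1 :=
      valuation_algebraMap_eq_one p fun h =>
        p.isPrime.one_notMem (by simpa using p.asIdeal.add_mem h hep)
    have h2 : ringValuation p ((1 - e) * e) = 0 := by
      rw [show (1 - e) * e = 0 by linear_combination -he.eq, ringValuation, map_zero, map_zero]
    rw [ringValuation_mul, ringValuation, h1, one_mul] at h2
    exact h2
  have h1 : p.valuation (algebraMap R (FractionRing R) (1 - e)) = 1 :=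
    valuation_algebraMap_eq_one p fun h =>
      p.isPrime.one_notMem (by simpa using p.asIdeal.add_mem h hep)
  have h2 : ringValuation p ((1 - e) * r) = ringValuation p r := by
    rw [ringValuation_mul, ringValuation, h1, one_mul]
  by_cases hr : ringValuation p r = 0
  · rw [hr]
    rw [hr] at h2
    refine le_antisymm ?_ zero_le
    rw [ringValuation, map_add]
    exact (Valuation.map_add _ _ _).trans (max_le h2.le h0.le)
  · rw [ringValuation_add_eq_left, h2]
    rw [h0, h2]
    exact zero_lt_iff.mpr hr

/-- A suitable member of a pencil of sections of `𝒪(E)` has reduced divisor of zeros on a given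
component. -/
lemma exists_reduced_residual_of_component [Algebra.EssFiniteType k R] (E : WeilDivisor R) {e : R}
    (he : IsIdempotentElem e) (hP : Ideal.span {e} ∈ minimalPrimes R) :
    ∃ f : (FractionRing R)ˣ, ∀ p : PrimeDivisor R, e ∈ p.asIdeal →
      p.valuation (f : FractionRing R) = WithZero.exp (E p) ∨
      p.valuation (f : FractionRing R) = WithZero.exp (E p - 1) := by
  by_cases hne : ∃ p : PrimeDivisor R, e ∈ p.asIdeal
  swap
  · exact ⟨1, fun p hp => absurd ⟨p, hp⟩ hne⟩
  obtain ⟨p₀, hp₀⟩ := hne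
  have hPp := hP.1.1
  set P := Ideal.span {e}
  have hle : ∀ {p : PrimeDivisor R}, e ∈ p.asIdeal → P ≤ p.asIdeal := fun h =>
    (Ideal.span_singleton_le_iff_mem _).mpr h
  -- The component is not a point, hence has a nonzero derivation.
  have hnf : ¬ IsField (R ⧸ P) := fun h => by
    have hmax := Ideal.Quotient.maximal_of_isField P h
    have h1 := hmax.eq_of_le p₀.isPrime.ne_top (hle hp₀)
    exact PrimeDivisor.not_le_of_mem_minimalPrimes p₀ hP h1.ge
  obtain ⟨D, r₀, hr₀⟩ : ∃ (D : Derivation k R (R ⧸ P)) (r₀ : R), D r₀ ≠ 0 := by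
    have : Algebra.EssFiniteType k (R ⧸ P) := Algebra.EssFiniteType.comp k R (R ⧸ P)
    obtain ⟨D, hD⟩ := exists_derivation_ne_zero k (R ⧸ P) hnf
    by_contra! hcon
    refine hD (Derivation.ext fun x => ?_)
    obtain ⟨r, rfl⟩ := Ideal.Quotient.mk_surjective x
    exact hcon (D.compAlgebraMap R) r
  -- Two sections `g₁`, `g₂` without common zeros, after multiplication by a denominator `s`.
  obtain ⟨g₂, hg₂, -⟩ := exists_unit_valuation E ∅ Set.finite_empty
  have hB₀ : {p : PrimeDivisor R | p.valuation (g₂ : FractionRing R) ≠ WithZero.exp (E p)}.Finite := by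
    refine ((finite_setOf_valuation_unit_ne_one g₂).union E.hasFiniteSupport).subset fun p hp => ?_
    by_contra hcon
    simp only [Set.mem_union, Set.mem_ofPred_eq, not_or, not_not, Function.mem_support] at hcon
    exact hp (by rw [hcon.1, hcon.2, WithZero.exp_zero])
  set B₀ := {p : PrimeDivisor R | p.valuation (g₂ : FractionRing R) ≠ WithZero.exp (E p)}
  obtain ⟨g₁, hg₁, hg₁B⟩ := exists_unit_valuation E B₀ hB₀
  obtain ⟨s, hs⟩ := IsLocalization.exist_integer_multiples_of_finset R⁰
    (({(g₁ : FractionRing R), (g₂ : FractionRing R)} : Set _).toFinite.toFinset)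
  obtain ⟨G₀, hG₀⟩ := hs g₁ (by simp)
  obtain ⟨G₂, hG₂⟩ := hs g₂ (by simp)
  have hv : ∀ {p : PrimeDivisor R} {G : R} {g : FractionRing R},
      algebraMap R (FractionRing R) G = (s : R) • g →
      ringValuation p G = ringValuation p s * p.valuation g := fun h => by
    rw [ringValuation, h, Algebra.smul_def, map_mul]
  have hspos : ∀ p, 0 < ringValuation p (s : R) := fun p => ringValuation_pos p s.2
  have hG₂n : G₂ ∈ R⁰ := mem_nonZeroDivisors_of_isUnit_algebraMap (Q := FractionRing R) (by
    rw [hG₂, Algebra.smul_def]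
    exact (IsLocalization.map_units (FractionRing R) s).mul g₂.isUnit)
  have hG₂P : Ideal.Quotient.mk P G₂ ≠ 0 := fun h =>
    notMem_minimalPrimes_of_mem_nonZeroDivisors hG₂n hP (Ideal.Quotient.eq_zero_iff_mem.mp h)
  have hv₂ : ∀ p ∉ B₀, ringValuation p G₂ = ringValuation p s * WithZero.exp (E p) := by
    intro p hp
    rw [hv hG₂, not_not.mp hp]
  have hv₀ : ∀ p, ringValuation p G₀ ≤ ringValuation p s * WithZero.exp (E p) := fun p => by
    rw [hv hG₀]
    exact mul_le_mul_right (hg₁ p) _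
  have hv₀B : ∀ p ∈ B₀, ringValuation p G₀ = ringValuation p s * WithZero.exp (E p) := fun p hp => by
    rw [hv hG₀, hg₁B p hp]
  have hv₂B : ∀ p ∈ B₀, ringValuation p G₂ < ringValuation p s * WithZero.exp (E p) := fun p hp => by
    rw [hv hG₂]
    exact (mul_lt_mul_iff_right₀ (hspos p)).mpr (lt_of_le_of_ne (hg₂ p) hp)
  -- The pencil is not constant for `D`.
  obtain ⟨G₁, hv₁, hv₁B, hw⟩ : ∃ G₁ : R,
      (∀ p ∉ B₀, ringValuation p G₁ ≤ ringValuation p G₂) ∧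
      (∀ p ∈ B₀, ringValuation p G₁ = ringValuation p s * WithZero.exp (E p)) ∧
      G₂ • D G₁ - G₁ • D G₂ ≠ 0 := by
    by_cases hw : G₂ • D G₀ - G₀ • D G₂ = 0
    · refine ⟨G₀ + r₀ * G₂, fun p hp => ?_, fun p hp => ?_, fun h => ?_⟩
      · rw [ringValuation, map_add]
        exact (Valuation.map_add _ _ _).trans
          (max_le ((hv₀ p).trans (hv₂ p hp).ge) (ringValuation_mul_le p r₀ G₂))
      · rw [ringValuation_add_eq_left, hv₀B p hp]
        rw [hv₀B p hp]
        exact (ringValuation_mul_le p r₀ G₂).trans_lt (hv₂B p hp)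
      · have h1 : Ideal.Quotient.mk P G₂ * (Ideal.Quotient.mk P G₂ * D r₀) = 0 := by
          rw [map_add, Derivation.leibniz] at h
          simp only [Algebra.smul_def, Ideal.Quotient.algebraMap_eq, map_add, map_mul] at h hw
          linear_combination h - hw
        exact hr₀ ((mul_eq_zero.mp ((mul_eq_zero.mp h1).resolve_left hG₂P)).resolve_left hG₂P)
    · exact ⟨G₀, fun p hp => (hv₀ p).trans (hv₂ p hp).ge, hv₀B, hw⟩
  obtain ⟨W, hW⟩ := Ideal.Quotient.mk_surjective (G₂ • D G₁ - G₁ • D G₂)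
  have hWP : W ∉ P := fun h => hw (by rw [← hW]; exact Ideal.Quotient.eq_zero_iff_mem.mpr h)
  have hWp : ∀ {p : Ideal R} (h : P ≤ p),
      Ideal.Quotient.factor h (G₂ • D G₁ - G₁ • D G₂) = 0 → W ∈ p := fun {p} h h0 => by
    rw [← hW, Ideal.Quotient.factor_mk] at h0
    exact Ideal.Quotient.eq_zero_iff_mem.mp h0
  have hB₁ : {p : PrimeDivisor R | e ∈ p.asIdeal ∧ W ∈ p.asIdeal ∧ p ∉ B₀}.Finite := by
    refine (finite_setOf_mem_primeDivisor (idempotent_mem_nonZeroDivisors he hWP)).subset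
      fun p hp => ?_
    exact p.asIdeal.add_mem (Ideal.mul_mem_left _ _ hp.2.1) hp.1
  obtain ⟨c, hc, hcB⟩ := exists_constant_ringValuation_eq D hB₁ hG₂n fun p hp => hv₁ p hp.2.2
  have hFP : G₁ + c * G₂ ∉ P := fun h => by
    refine hWP (hWp le_rfl (wronskian_mem le_rfl D hc h ?_))
    rw [mem_span_idempotent_iff he] at h
    have h1 : (1 - e) * (G₁ + c * G₂) = e * (0 * 0 * 0) := by rw [h]; ring
    exact (factor_derivation_eq_zero le_rfl D (fun h => hPp.one_notMem
      (by simpa using P.add_mem h (Ideal.mem_span_singleton_self e))) P.zero_mem h1).2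
  -- The section is replaced by `1` on the other components, to make it invertible.
  let F := (1 - e) * (G₁ + c * G₂) + e
  let uF := (IsLocalization.map_units (FractionRing R)
    (⟨F, idempotent_mem_nonZeroDivisors he hFP⟩ : R⁰)).unit
  let us := (IsLocalization.map_units (FractionRing R) s).unit
  refine ⟨uF * us⁻¹, fun p hep => ?_⟩
  have hf : ∀ n : ℤ, ringValuation p (G₁ + c * G₂) = ringValuation p s * WithZero.exp n →
      p.valuation ((uF * us⁻¹ : (FractionRing R)ˣ) : FractionRing R) = WithZero.exp n := by
    intro n h
    have h1 : ((uF * us⁻¹ : (FractionRing R)ˣ) : FractionRing R) * algebraMap R _ s =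
        algebraMap R _ F := by
      have := us.inv_mul
      rw [Units.val_mul, mul_assoc, show algebraMap R (FractionRing R) s = us from rfl, this,
        mul_one]
      rfl
    have h2 := congrArg p.valuation h1
    rw [map_mul] at h2
    have h3 : ringValuation p F = ringValuation p (G₁ + c * G₂) :=
      algebraMap_idempotent_mul_add he p hep _
    rw [show p.valuation (algebraMap R (FractionRing R) F) = _ from h3, h, mul_comm] at h2
    exact mul_left_cancel₀ (hspos p).ne' h2
  -- At the zeros of `g₂` the section has no zero, because `g₁` has none; at the other zeros of the Wronskian
  -- it has none by the choice of `c`.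
  by_cases hpB : p ∈ B₀
  · left
    refine hf _ ?_
    rw [ringValuation_add_eq_left, hv₁B p hpB]
    rw [hv₁B p hpB]
    exact (ringValuation_mul_le p c G₂).trans_lt (hv₂B p hpB)
  by_cases hWmem : W ∈ p.asIdeal
  · left
    refine hf _ ?_
    rw [hcB p ⟨hep, hWmem, hpB⟩, hv₂ p hpB]
  -- Elsewhere the section vanishes at most to first order.
  have hup : ringValuation p (G₁ + c * G₂) ≤ ringValuation p G₂ := by
    rw [ringValuation, map_add]
    exact (Valuation.map_add _ _ _).trans (max_le (hv₁ p hpB) (ringValuation_mul_le p c G₂))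
  have hlow : ringValuation p G₂ * WithZero.exp (-1 : ℤ) ≤ ringValuation p (G₁ + c * G₂) := by
    by_contra hlt
    rw [not_le] at hlt
    obtain ⟨π, hπ⟩ := exists_valuation_eq_exp_neg_one p
    have hπp : π ∈ p.asIdeal := by
      rw [← valuation_algebraMap_lt_one_iff, hπ, ← WithZero.exp_zero, WithZero.exp_lt_exp]
      decide
    have h1 : ringValuation p (G₁ + c * G₂) ≤ ringValuation p (π * π * G₂) := by
      rw [ringValuation_mul, ringValuation_mul, show ringValuation p π = _ from hπ]
      rw [← WithZero.lt_mul_exp_iff_le]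
      · refine hlt.trans_eq ?_
        rw [mul_comm, mul_right_comm, ← WithZero.exp_add, ← WithZero.exp_add]
        rfl
      · exact mul_ne_zero (mul_ne_zero WithZero.exp_ne_zero WithZero.exp_ne_zero)
          (ringValuation_pos p hG₂n).ne'
    obtain ⟨t, ht, a, hta⟩ := exists_smul_eq_smul_of_valuation_le p h1
    have h2 : t * (G₁ + c * G₂) = a * (π * π * G₂) := by
      apply IsFractionRing.injective R (FractionRing R)
      rw [map_mul, map_mul _ a, ← Algebra.smul_def, ← Algebra.smul_def, hta]
    obtain ⟨h3, h4⟩ := factor_derivation_eq_zero (hle hep) D ht hπp h2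
    exact hWmem (hWp (hle hep) (wronskian_mem (hle hep) D hc h3 h4))
  rcases hup.eq_or_lt with h | h
  · left
    exact hf _ (by rw [h, hv₂ p hpB])
  · right
    refine hf _ ?_
    rw [WithZero.exp_sub, ← mul_div_assoc, ← hv₂ p hpB, div_eq_mul_inv, ← WithZero.exp_neg]
    refine le_antisymm ?_ hlow
    rw [← WithZero.lt_mul_exp_iff_le]
    · rw [mul_assoc, ← WithZero.exp_add]
      simpa using h
    · exact mul_ne_zero (ringValuation_pos p hG₂n).ne' WithZero.exp_ne_zero

end Bertini

/-! ### Sections with reduced divisor -/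

section Components

variable {R : Type u} [CommRing R] [IsNoetherianRing R] [IsNormalRing R]

variable (R) in
/-- The complementary idempotents of the irreducible components of the spectrum of a normal
Noetherian ring are orthogonal and sum to one. -/
lemma exists_component_idempotents : ∃ (T : Finset (Ideal R)) (e : Ideal R → R),
    (∀ P, P ∈ T ↔ P ∈ minimalPrimes R) ∧
    (∀ P ∈ T, IsIdempotentElem (e P) ∧ P = Ideal.span {e P}) ∧
    (∀ P ∈ T, ∀ P' ∈ T, P ≠ P' → (1 - e P) * (1 - e P') = 0) ∧ ∑ P ∈ T, (1 - e P) = 1 := by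
  classical
  have hred := IsNormalRing.isReduced (R := R)
  have hfin := minimalPrimes.finite_of_isNoetherianRing R
  have h0 : ∀ x : R, (∀ P ∈ minimalPrimes R, x ∈ P) → x = 0 := by
    intro x hx
    have : x ∈ sInf (minimalPrimes R) := by
      rw [Ideal.mem_sInf]
      exact fun {P} hP => hx P hP
    rw [minimalPrimes, Ideal.sInf_minimalPrimes] at this
    rw [← Ideal.mem_bot (R := R)]
    exact (nilradical_eq_zero R).le this
  have hex : ∀ P : Ideal R, ∃ e, P ∈ minimalPrimes R → IsIdempotentElem e ∧ P = Ideal.span {e} := by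
    intro P
    by_cases hP : P ∈ minimalPrimes R
    · obtain ⟨e, he⟩ := IsNormalRing.exists_minimalPrime_eq_span hP
      exact ⟨e, fun _ => he⟩
    · exact ⟨0, fun h => absurd h hP⟩
  choose e he using hex
  have hmem : ∀ P ∈ minimalPrimes R, ∀ P' ∈ minimalPrimes R, P ≠ P' → 1 - e P ∈ P' := by
    intro P hP P' hP' hne
    have := hP'.1.1
    refine one_sub_mem_of_notMem (he P hP).1 fun h => hne ?_
    have hle : P ≤ P' := by
      rw [(he P hP).2]
      exact (Ideal.span_singleton_le_iff_mem _).mpr h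
    exact le_antisymm hle (hP'.2 hP.1 hle)
  have hself : ∀ P ∈ minimalPrimes R, e P ∈ P := fun P hP =>
    (he P hP).2.ge (Ideal.mem_span_singleton_self _)
  refine ⟨hfin.toFinset, e, fun P => hfin.mem_toFinset, fun P hP => he P (hfin.mem_toFinset.mp hP),
    fun P hP P' hP' hne => h0 _ fun P'' hP'' => ?_, ?_⟩
  · rw [hfin.mem_toFinset] at hP hP'
    by_cases h : P = P''
    · exact Ideal.mul_mem_left _ _ (hmem P' hP' P'' hP'' fun h' => hne (h.trans h'.symm))
    · exact Ideal.mul_mem_right _ _ (hmem P hP P'' hP'' h)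
  · rw [← sub_eq_zero]
    refine h0 _ fun P hP => ?_
    rw [← Finset.add_sum_erase _ _ (hfin.mem_toFinset.mpr hP), add_sub_right_comm, sub_sub_cancel_left]
    refine P.add_mem (P.neg_mem (hself P hP)) (P.sum_mem fun P' hP' => ?_)
    rw [Finset.mem_erase, hfin.mem_toFinset] at hP'
    exact hmem P' hP'.2 P hP hP'.1

/-- Invertible rational functions on the components glue. -/
lemma exists_unit_valuation_eq (F : Ideal R → (FractionRing R)ˣ) :
    ∃ f : (FractionRing R)ˣ, ∀ p : PrimeDivisor R, ∃ e, IsIdempotentElem e ∧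
      Ideal.span {e} ∈ minimalPrimes R ∧ e ∈ p.asIdeal ∧
      p.valuation (f : FractionRing R) = p.valuation (F (Ideal.span {e}) : FractionRing R) := by
  classical
  obtain ⟨T, e, hT, he, horth, hsum⟩ := exists_component_idempotents R
  let a := algebraMap R (FractionRing R)
  have hidem : ∀ P ∈ T, a (1 - e P) * a (1 - e P) = a (1 - e P) := fun P hP => by
    rw [← map_mul, (he P hP).1.one_sub.eq]
  have horth' : ∀ P ∈ T, ∀ P' ∈ T, P ≠ P' → a (1 - e P) * a (1 - e P') = 0 :=
    fun P hP P' hP' h => by rw [← map_mul, horth P hP P' hP' h, map_zero]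
  have hglue : ∀ (G : Ideal R → FractionRing R), ∀ P ∈ T,
      a (1 - e P) * (∑ P' ∈ T, a (1 - e P') * G P') = a (1 - e P) * G P := by
    intro G P hP
    rw [Finset.mul_sum, Finset.sum_eq_single P]
    · rw [← mul_assoc, hidem P hP]
    · intro P' hP' hne
      rw [← mul_assoc, horth' P hP P' hP' hne.symm, zero_mul]
    · exact fun h => absurd hP h
  let f := ∑ P ∈ T, a (1 - e P) * (F P : FractionRing R)
  let g := ∑ P ∈ T, a (1 - e P) * (((F P)⁻¹ : (FractionRing R)ˣ) : FractionRing R)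
  have hfg : f * g = 1 := by
    have h1 : ∀ P ∈ T, a (1 - e P) * (f * g) = a (1 - e P) := by
      intro P hP
      have h2 := hglue (fun P => (F P : FractionRing R)) P hP
      have h3 := hglue (fun P => (((F P)⁻¹ : (FractionRing R)ˣ) : FractionRing R)) P hP
      calc a (1 - e P) * (f * g) = (a (1 - e P) * f) * (a (1 - e P) * g) := by
            rw [mul_mul_mul_comm, hidem P hP]
        _ = _ := by
            change _ = _ at h2 h3
            rw [h2, h3, mul_mul_mul_comm, hidem P hP, Units.mul_inv, mul_one]
    calc f * g = a (∑ P ∈ T, (1 - e P)) * (f * g) := by rw [hsum, map_one, one_mul]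
      _ = ∑ P ∈ T, a (1 - e P) := by rw [map_sum, Finset.sum_mul, Finset.sum_congr rfl h1]
      _ = 1 := by rw [← map_sum, hsum, map_one]
  refine ⟨⟨f, g, hfg, by rw [mul_comm, hfg]⟩, fun p => ?_⟩
  obtain ⟨P, hPm, hPp⟩ := Ideal.exists_minimalPrimes_le (bot_le : (⊥ : Ideal R) ≤ p.asIdeal)
  have hP : P ∈ T := (hT P).mpr hPm
  have hPe := (he P hP).2
  have hep : e P ∈ p.asIdeal := hPp (hPe.ge (Ideal.mem_span_singleton_self _))
  refine ⟨e P, (he P hP).1, hPe ▸ hPm, hep, ?_⟩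
  rw [← hPe]
  have h1 := congrArg p.valuation (hglue (fun P => (F P : FractionRing R)) P hP)
  rw [map_mul, map_mul, valuation_algebraMap_eq_one p, one_mul, one_mul] at h1
  · exact h1
  · exact fun h => p.isPrime.one_notMem (by simpa using p.asIdeal.add_mem h hep)

/-- For every divisor `K` there is a reduced effective divisor linearly equivalent to `-2K`. -/
lemma exists_isReduced_isDivOf {k : Type u} [Field k] [Algebra k R] [Algebra.EssFiniteType k R]
    (K : WeilDivisor R) : ∃ (H : WeilDivisor R) (f : (FractionRing R)ˣ),
      H.IsReduced ∧ (H + 2 • K).IsDivOf f := by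
  have hex : ∀ P : Ideal R, ∃ f : (FractionRing R)ˣ, ∀ e, IsIdempotentElem e →
      Ideal.span {e} ∈ minimalPrimes R → P = Ideal.span {e} → ∀ p : PrimeDivisor R, e ∈ p.asIdeal →
      p.valuation (f : FractionRing R) = WithZero.exp ((-(2 • K)) p) ∨
      p.valuation (f : FractionRing R) = WithZero.exp ((-(2 • K)) p - 1) := by
    intro P
    by_cases hP : ∃ e, IsIdempotentElem e ∧ Ideal.span {e} ∈ minimalPrimes R ∧ P = Ideal.span {e}
    · obtain ⟨e, he, hem, rfl⟩ := hP
      obtain ⟨f, hf⟩ := exists_reduced_residual_of_component (k := k) (-(2 • K)) he hem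
      refine ⟨f, fun e' _ _ h p hep => hf p ?_⟩
      have h1 : e ∈ Ideal.span {e'} := h ▸ Ideal.mem_span_singleton_self e
      exact (Ideal.span_singleton_le_iff_mem _).mpr hep h1
    · exact ⟨1, fun e he hem h => absurd ⟨e, he, hem, h⟩ hP⟩
  choose F hF using hex
  obtain ⟨f, hf⟩ := exists_unit_valuation_eq F
  have hval : ∀ p : PrimeDivisor R,
      p.valuation (f : FractionRing R) = WithZero.exp ((-(2 • K)) p) ∨
      p.valuation (f : FractionRing R) = WithZero.exp ((-(2 • K)) p - 1) := by
    intro p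
    obtain ⟨e, he, hem, hep, hv⟩ := hf p
    rw [hv]
    exact hF _ e he hem rfl p hep
  have hfin : {p : PrimeDivisor R |
      -WithZero.log (p.valuation (f : FractionRing R)) - 2 * K p ≠ 0}.Finite := by
    refine ((finite_setOf_valuation_unit_ne_one f).union K.hasFiniteSupport).subset fun p hp => ?_
    by_contra hcon
    simp only [Set.mem_union, Set.mem_ofPred_eq, not_or, not_not, Function.mem_support] at hcon
    exact hp (by rw [hcon.1, hcon.2]; simp)
  refine ⟨Finsupp.ofSupportFinite _ hfin, f, fun p => ?_, fun p => ?_⟩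
  · change -WithZero.log (p.valuation (f : FractionRing R)) - 2 * K p = 0 ∨
      -WithZero.log (p.valuation (f : FractionRing R)) - 2 * K p = 1
    rcases hval p with h | h <;> rw [h, WithZero.log_exp] <;>
      simp only [Finsupp.neg_apply, Finsupp.smul_apply, nsmul_eq_mul, Nat.cast_ofNat]
    · left; ring
    · right; ring
  · rw [Finsupp.add_apply]
    change _ = WithZero.exp (-((-WithZero.log (p.valuation (f : FractionRing R)) - 2 * K p) + _))
    rw [← WithZero.exp_log (valuation_unit_ne_zero p f), WithZero.log_exp]
    congr 1
    simp only [Finsupp.smul_apply, nsmul_eq_mul, Nat.cast_ofNat]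
    ring

end Components

/-! ### The twisted double -/

section TwistedDouble

open scoped QuadraticAlgebra

variable {R : Type u} [CommRing R] [IsNoetherianRing R] [IsNormalRing R]

/-- The product `b y f` is regular for sections `b`, `y` of `𝒪(K)`, because `H` is effective. -/
lemma exists_algebraMap_eq_mul_mul {H K : WeilDivisor R} {f : (FractionRing R)ˣ}
    (hH : H.IsReduced) (hf : (H + 2 • K).IsDivOf f) {b y : FractionRing R} (hb : b ∈ K.sections)
    (hy : y ∈ K.sections) : ∃ c : R, algebraMap R (FractionRing R) c = b * y * f := by
  refine exists_algebraMap_eq_of_valuation_le_one fun p => ?_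
  rw [map_mul, map_mul, hf p]
  refine (mul_le_mul_left (mul_le_mul' (hb p) (hy p)) _).trans ?_
  rw [← WithZero.exp_add, ← WithZero.exp_add, ← WithZero.exp_zero, WithZero.exp_le_exp]
  simp only [Finsupp.add_apply, Finsupp.smul_apply, nsmul_eq_mul, Nat.cast_ofNat]
  rcases hH p with h | h <;> rw [h] <;> linarith

/-- As all multiplicities of `H` are at most one, `𝒪(K)` contains every `b` such that `b² f` is
regular. -/
lemma mem_sections_of_sq {H K : WeilDivisor R} {f : (FractionRing R)ˣ}
    (hH : H.IsReduced) (hf : (H + 2 • K).IsDivOf f) {b : FractionRing R} {c : R}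
    (hb : algebraMap R (FractionRing R) c = b * b * f) : b ∈ K.sections := by
  intro p
  have h1 := p.valuation_algebraMap_le_one c
  rw [hb, map_mul, map_mul, hf p] at h1
  by_cases h0 : p.valuation b = 0
  · rw [h0]; exact zero_le
  rw [← WithZero.exp_log h0, WithZero.exp_le_exp]
  rw [← WithZero.exp_log h0, ← WithZero.exp_add, ← WithZero.exp_add, ← WithZero.exp_zero,
    WithZero.exp_le_exp] at h1
  simp only [Finsupp.add_apply, Finsupp.smul_apply, nsmul_eq_mul, Nat.cast_ofNat] at h1
  rcases hH p with h | h <;> rw [h] at h1 <;> omega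

/-- The algebra `R ⊕ 𝒪(K) ω`, inside the algebra obtained from the total ring of fractions of `R`
by adjoining a formal square root `ω` of `f`. -/
def twistedDouble (K : WeilDivisor R) (f : FractionRing R)
    (hf : ∀ b ∈ K.sections, ∀ y ∈ K.sections, ∃ c : R, algebraMap R (FractionRing R) c = b * y * f) :
    Subalgebra R (QuadraticAlgebra (FractionRing R) f 0) where
  carrier := {z | (∃ r : R, algebraMap R (FractionRing R) r = z.re) ∧ z.im ∈ K.sections}
  mul_mem' := by
    rintro z w ⟨⟨r, hr⟩, hz⟩ ⟨⟨s, hs⟩, hw⟩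
    obtain ⟨c, hc⟩ := hf _ hz _ hw
    refine ⟨⟨r * s + c, ?_⟩, ?_⟩
    · rw [map_add, map_mul, hr, hs, hc, QuadraticAlgebra.re_mul]
      ring
    · rw [QuadraticAlgebra.im_mul, zero_mul, zero_mul, add_zero, ← hr, ← hs, ← Algebra.smul_def,
        mul_comm, ← Algebra.smul_def]
      exact add_mem (K.sections.smul_mem _ hw) (K.sections.smul_mem _ hz)
  add_mem' := by
    rintro z w ⟨⟨r, hr⟩, hz⟩ ⟨⟨s, hs⟩, hw⟩
    exact ⟨⟨r + s, by rw [map_add, hr, hs, QuadraticAlgebra.re_add]⟩, add_mem hz hw⟩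
  algebraMap_mem' := fun r => ⟨⟨r, rfl⟩, K.sections.zero_mem⟩

variable {K : WeilDivisor R} {f : FractionRing R}
  {hf : ∀ b ∈ K.sections, ∀ y ∈ K.sections, ∃ c : R, algebraMap R (FractionRing R) c = b * y * f}

/-- The splitting `S = R ⊕ 𝒪(K)`. -/
noncomputable def twistedDoubleEquiv : (R × K.sections) ≃ₗ[R] twistedDouble K f hf :=
  LinearEquiv.ofBijective
    { toFun := fun x : R × K.sections => (⟨⟨algebraMap R (FractionRing R) x.1, x.2⟩, ⟨x.1, rfl⟩,
        x.2.2⟩ : twistedDouble K f hf)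
      map_add' := fun x y => Subtype.ext (QuadraticAlgebra.ext (map_add _ _ _) rfl)
      map_smul' := by
        intro r x
        refine Subtype.ext (QuadraticAlgebra.ext ?_ rfl)
        change algebraMap R (FractionRing R) (r * x.1) = r • algebraMap R (FractionRing R) x.1
        rw [map_mul, Algebra.smul_def] }
    ⟨fun x y h => by
        have h1 := congrArg (fun z : twistedDouble K f hf => (z : QuadraticAlgebra _ f 0).re) h
        have h2 := congrArg (fun z : twistedDouble K f hf => (z : QuadraticAlgebra _ f 0).im) h
        exact Prod.ext (IsFractionRing.injective R (FractionRing R) h1) (Subtype.ext h2),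
      fun ⟨z, ⟨r, hr⟩, hz⟩ => ⟨(r, ⟨z.im, hz⟩), Subtype.ext (QuadraticAlgebra.ext hr rfl)⟩⟩

lemma twistedDoubleEquiv_re (x : R × K.sections) :
    (twistedDoubleEquiv (hf := hf) x : QuadraticAlgebra (FractionRing R) f 0).re =
      algebraMap R _ x.1 := rfl

lemma twistedDoubleEquiv_im (x : R × K.sections) :
    (twistedDoubleEquiv (hf := hf) x : QuadraticAlgebra (FractionRing R) f 0).im = x.2 := rfl

lemma isTwistedDouble {f : (FractionRing R)ˣ}
    {hf : ∀ b ∈ K.sections, ∀ y ∈ K.sections, ∃ c : R,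
      algebraMap R (FractionRing R) c = b * y * f} :
    IsTwistedDouble K f (twistedDouble K f hf) := by
  refine ⟨twistedDoubleEquiv, fun a x b y => ?_⟩
  obtain ⟨c, hc⟩ := hf b b.2 y y.2
  refine ⟨a * x + c, by rw [map_add, hc], Subtype.ext (QuadraticAlgebra.ext ?_ ?_)⟩
  · rw [MulMemClass.coe_mul, QuadraticAlgebra.re_mul]
    simp only [twistedDoubleEquiv_re, twistedDoubleEquiv_im, map_add, map_mul, hc]
    ring
  · rw [MulMemClass.coe_mul, QuadraticAlgebra.im_mul]
    simp only [twistedDoubleEquiv_re, twistedDoubleEquiv_im, zero_mul, add_zero,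
      Submodule.coe_add, Submodule.coe_smul, Algebra.smul_def]
    ring

instance finite_twistedDouble : Module.Finite R (twistedDouble K f hf) :=
  Module.Finite.equiv twistedDoubleEquiv

instance isNoetherianRing_twistedDouble : IsNoetherianRing (twistedDouble K f hf) :=
  IsNoetherianRing.of_finite R _

lemma algebraMap_twistedDouble_injective :
    Function.Injective (algebraMap R (twistedDouble K f hf)) := fun _ _ h =>
  IsFractionRing.injective R (FractionRing R)
    (congrArg (fun z : twistedDouble K f hf => (z : QuadraticAlgebra _ f 0).re) h)

/-- Projection to the second summand. -/
noncomputable def twistedDoubleSnd : twistedDouble K f hf →ₗ[R] K.sections :=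
  LinearMap.snd R R K.sections ∘ₗ twistedDoubleEquiv.symm.toLinearMap

lemma twistedDoubleSnd_apply (x : R × K.sections) :
    twistedDoubleSnd (twistedDoubleEquiv (hf := hf) x) = x.2 := by
  simp [twistedDoubleSnd]

/-- `Hom_R(S, 𝒪(K))` is free over `S` on the second projection, because `End_R(𝒪(K)) = R`. -/
lemma existsUnique_twistedDoubleSnd_mul (h : twistedDouble K f hf →ₗ[R] K.sections) :
    ∃! s, ∀ u, h u = twistedDoubleSnd (s * u) := by
  have key : ∀ (x : R) (y : K.sections) (a : R) (b : K.sections),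
      twistedDoubleSnd (twistedDoubleEquiv (hf := hf) (x, y) * twistedDoubleEquiv (a, b)) =
        x • b + a • y := by
    intro x y a b
    obtain ⟨c, hc⟩ := hf y y.2 b b.2
    have h1 : twistedDoubleEquiv (hf := hf) (x, y) * twistedDoubleEquiv (a, b) =
        twistedDoubleEquiv (x * a + c, x • b + a • y) := by
      refine Subtype.ext (QuadraticAlgebra.ext ?_ ?_)
      · rw [MulMemClass.coe_mul, QuadraticAlgebra.re_mul]
        simp only [twistedDoubleEquiv_re, twistedDoubleEquiv_im, map_add, map_mul, hc]
        ring
      · rw [MulMemClass.coe_mul, QuadraticAlgebra.im_mul]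
        simp only [twistedDoubleEquiv_re, twistedDoubleEquiv_im, zero_mul, add_zero,
          Submodule.coe_add, Submodule.coe_smul, Algebra.smul_def]
        ring
    rw [h1, twistedDoubleSnd_apply]
  obtain ⟨x, hx⟩ := exists_eq_smul_of_end_sections
    (h ∘ₗ twistedDoubleEquiv.toLinearMap ∘ₗ LinearMap.inr R R K.sections)
  have hx' : ∀ b, h (twistedDoubleEquiv (0, b)) = x • b := hx
  refine ⟨twistedDoubleEquiv (x, h (twistedDoubleEquiv (1, 0))), fun u => ?_, fun s hs => ?_⟩
  · obtain ⟨⟨a, b⟩, rfl⟩ := twistedDoubleEquiv.surjective u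
    have h1 : ((a, b) : R × K.sections) = a • (1, 0) + (0, b) := by simp
    rw [key, h1, map_add, map_smul, map_add, map_smul, hx', add_comm]
  · obtain ⟨⟨x', y'⟩, rfl⟩ := twistedDoubleEquiv.surjective s
    have h1 := hs (twistedDoubleEquiv (1, 0))
    rw [key, smul_zero, zero_add, one_smul] at h1
    obtain ⟨u, hu⟩ := exists_unit_mem_sections K
    have h2 := hs (twistedDoubleEquiv (0, ⟨u, hu⟩))
    rw [key, zero_smul, add_zero, hx'] at h2
    have h3 := congrArg (Subtype.val : K.sections → _) h2
    simp only [Submodule.coe_smul, Algebra.smul_def] at h3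
    rw [h1, IsFractionRing.injective R (FractionRing R) (u.isUnit.mul_right_cancel h3)]

/-- Every element of the quadratic algebra has a denominator in `R`. -/
lemma exists_smul_mem_twistedDouble (z : QuadraticAlgebra (FractionRing R) f 0) :
    ∃ d ∈ R⁰, d • z ∈ twistedDouble K f hf := by
  obtain ⟨u, hu⟩ := exists_unit_mem_sections K
  obtain ⟨s, hs, a, ha⟩ := exists_algebraMap_eq_smul (R := R) z.re
  obtain ⟨t, ht, b, hb⟩ := exists_algebraMap_eq_smul (R := R)
    (z.im * ((u⁻¹ : (FractionRing R)ˣ) : FractionRing R))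
  refine ⟨s * t, mul_mem hs ht, ⟨t * a, ?_⟩, ?_⟩
  · rw [map_mul, ha, QuadraticAlgebra.re_smul, mul_comm s, mul_smul, Algebra.smul_def t]
  · have h1 : t • z.im = b • (u : FractionRing R) := by
      rw [Algebra.smul_def b, hb, smul_mul_assoc, mul_assoc, u.inv_mul, mul_one]
    rw [QuadraticAlgebra.im_smul, mul_smul, h1]
    exact K.sections.smul_mem _ (K.sections.smul_mem _ hu)

/-- The total ring of fractions of the twisted double is the whole quadratic algebra: an element is
invertible there if its norm is. -/
lemma isFractionRing_twistedDouble :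
    IsFractionRing (twistedDouble K f hf) (QuadraticAlgebra (FractionRing R) f 0) := by
  let L := QuadraticAlgebra (FractionRing R) f 0
  have hunit : ∀ d ∈ R⁰, IsUnit (algebraMap R L d) := fun d hd => by
    rw [IsScalarTower.algebraMap_apply R (FractionRing R) L]
    exact (IsLocalization.map_units (FractionRing R) (⟨d, hd⟩ : R⁰)).map _
  have hnz : ∀ s ∈ (twistedDouble K f hf)⁰, (s : L) ∈ L⁰ := by
    intro s hs
    rw [mem_nonZeroDivisors_iff_right]
    intro z hz
    obtain ⟨d, hd, hdz⟩ := exists_smul_mem_twistedDouble (hf := hf) z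
    have h1 : (⟨d • z, hdz⟩ : twistedDouble K f hf) * s = 0 := Subtype.ext (by
      change d • z * (s : L) = 0
      rw [smul_mul_assoc, hz, smul_zero])
    have h2 : d • z = 0 := congrArg Subtype.val ((mem_nonZeroDivisors_iff_right.mp hs) _ h1)
    rw [Algebra.smul_def] at h2
    exact (hunit d hd).mul_right_eq_zero.mp h2
  have hQ : ∀ q ∈ (FractionRing R)⁰, IsUnit q := by
    intro q hq
    obtain ⟨s, hs, a, ha⟩ := exists_algebraMap_eq_smul (R := R) q
    have hsu := IsLocalization.map_units (FractionRing R) (⟨s, hs⟩ : R⁰)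
    have ha' : a ∈ R⁰ := by
      rw [mem_nonZeroDivisors_iff_right]
      intro b hb
      have h1 := congrArg (algebraMap R (FractionRing R)) hb
      rw [map_mul, ha, map_zero, Algebra.smul_def, ← mul_assoc] at h1
      have h2 := (mem_nonZeroDivisors_iff_right.mp hq) _ h1
      exact IsFractionRing.injective R (FractionRing R)
        ((hsu.mul_left_eq_zero.mp h2).trans (map_zero _).symm)
    have h3 := IsLocalization.map_units (FractionRing R) (⟨a, ha'⟩ : R⁰)
    change IsUnit (algebraMap R (FractionRing R) a) at h3
    rw [ha, Algebra.smul_def] at h3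
    exact isUnit_of_mul_isUnit_right h3
  refine ⟨⟨fun s => ?_, fun z => ?_, fun {x y} h => ⟨1, by rw [Subtype.ext h]⟩⟩⟩
  · exact QuadraticAlgebra.isUnit_iff_norm_isUnit.mpr (hQ _
      (QuadraticAlgebra.norm_mem_nonZeroDivisors_iff.mpr (hnz s s.2)))
  · obtain ⟨d, hd, hdz⟩ := exists_smul_mem_twistedDouble (hf := hf) z
    refine ⟨(⟨d • z, hdz⟩, ⟨algebraMap R _ d, ?_⟩), ?_⟩
    · rw [mem_nonZeroDivisors_iff_right]
      intro x hx
      have h1 : (x : L) * algebraMap R L d = 0 := congrArg Subtype.val hx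
      exact Subtype.ext ((hunit d hd).mul_left_eq_zero.mp h1)
    · change z * algebraMap R L d = d • z
      rw [Algebra.smul_def, mul_comm]

omit [IsNoetherianRing R] in
lemma isReduced_of_isUnit_two (h2 : IsUnit (2 : R)) (f : (FractionRing R)ˣ) :
    IsReduced (QuadraticAlgebra (FractionRing R) (f : FractionRing R) 0) := by
  have hR := IsNormalRing.isReduced (R := R)
  have hQ : IsReduced (FractionRing R) := inferInstanceAs (IsReduced (Localization R⁰))
  have h2' : IsUnit (2 : FractionRing R) := by
    have := h2.map (algebraMap R (FractionRing R))
    rwa [map_ofNat] at this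
  rw [isReduced_iff_pow_one_lt 2 one_lt_two]
  intro z hz
  rw [pow_two] at hz
  have h3 := congrArg QuadraticAlgebra.re hz
  have h4 := congrArg QuadraticAlgebra.im hz
  rw [QuadraticAlgebra.re_mul, QuadraticAlgebra.re_zero] at h3
  rw [QuadraticAlgebra.im_mul, QuadraticAlgebra.im_zero] at h4
  have h5 : z.re * z.im = 0 := by
    apply h2'.mul_left_cancel
    linear_combination h4
  have h6 : z.re = 0 := by
    refine hQ.eq_zero _ ⟨3, ?_⟩
    linear_combination z.re * h3 - f * z.im * h5
  have h7 : z.im = 0 := by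
    refine hQ.eq_zero _ ⟨2, f.isUnit.mul_left_cancel ?_⟩
    rw [h6] at h3
    linear_combination h3
  exact QuadraticAlgebra.ext h6 h7

/-- The twisted double is normal: an integral element has integral trace and norm, and `H` is
reduced. -/
lemma isNormalRing_twistedDouble (h2 : IsUnit (2 : R)) {H : WeilDivisor R} {f : (FractionRing R)ˣ}
    (hH : H.IsReduced) (hfH : (H + 2 • K).IsDivOf f)
    {hf : ∀ b ∈ K.sections, ∀ y ∈ K.sections, ∃ c : R,
      algebraMap R (FractionRing R) c = b * y * f} :
    IsNormalRing (twistedDouble K f hf) := by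
  have := isReduced_of_isUnit_two h2 f
  have : IsReduced (twistedDouble K f hf) :=
    isReduced_of_injective (twistedDouble K f hf).val Subtype.val_injective
  have := isFractionRing_twistedDouble (hf := hf)
  refine isNormalRing_of_forall_isIntegral
    (Q := QuadraticAlgebra (FractionRing R) (f : FractionRing R) 0) fun z hz => ?_
  have hz : IsIntegral R z := isIntegral_trans (R := R) (A := twistedDouble K f hf) z hz
  let σ : QuadraticAlgebra (FractionRing R) (f : FractionRing R) 0 →ₐ[R]
      QuadraticAlgebra (FractionRing R) (f : FractionRing R) 0 :=
    { toFun := star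
      map_one' := star_one _
      map_mul' := fun x y => by rw [star_mul, mul_comm]
      map_zero' := star_zero _
      map_add' := star_add
      commutes' := fun r => by
        refine QuadraticAlgebra.ext ?_ ?_ <;> simp [IsScalarTower.algebraMap_apply R (FractionRing R)
          (QuadraticAlgebra (FractionRing R) (f : FractionRing R) 0)] }
  have hσ : IsIntegral R (star z) := hz.map σ
  have hdesc : ∀ q : FractionRing R, IsIntegral R
      (algebraMap (FractionRing R) (QuadraticAlgebra (FractionRing R) (f : FractionRing R) 0) q) →
      ∃ r, algebraMap R (FractionRing R) r = q := fun q hq =>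
    IsNormalRing.mem_range_of_isIntegral ((isIntegral_algHom_iff (IsScalarTower.toAlgHom R
      (FractionRing R) (QuadraticAlgebra (FractionRing R) (f : FractionRing R) 0))
      QuadraticAlgebra.algebraMap_injective).mp hq)
  obtain ⟨t, ht⟩ := hdesc (2 * z.re) (by
    have : algebraMap (FractionRing R) (QuadraticAlgebra (FractionRing R) (f : FractionRing R) 0)
        (2 * z.re) = z + star z := by
      rw [← QuadraticAlgebra.algebraMap_trace_eq_add_star, QuadraticAlgebra.trace_def]
      simp
    rw [this]
    exact hz.add hσ)
  obtain ⟨n, hn⟩ := hdesc (QuadraticAlgebra.norm z) (by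
    rw [QuadraticAlgebra.algebraMap_norm_eq_mul_star]
    exact hz.mul hσ)
  obtain ⟨i, hi⟩ := h2.exists_left_inv
  have hre : algebraMap R (FractionRing R) (i * t) = z.re := by
    have h1 := congrArg (algebraMap R (FractionRing R)) hi
    rw [map_mul, map_one, map_ofNat] at h1
    rw [map_mul, ht]
    linear_combination z.re * h1
  have him : z.im ∈ K.sections := by
    refine mem_sections_of_sq hH hfH (c := (i * t) * (i * t) - n) ?_
    rw [map_sub, map_mul _ (i * t), hre, hn, QuadraticAlgebra.norm_def]
    ring
  exact ⟨⟨z, ⟨_, hre⟩, him⟩, rfl⟩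

end TwistedDouble

/-! ### Frobenius forms and representability -/

section Frobenius

/-- If the `T`-module `N` represents `Hom_B(T, A)`, and the `T`-algebra `U` is `Hom_T(U, N)`, then
`U` represents `Hom_B(U, A)`. -/
lemma Represents.of_frobenius {B A T U N M : Type*} [CommRing B] [CommRing A] [CommRing T]
    [CommRing U] [AddCommGroup N] [Module T N] [AddCommGroup M] [Module U M] {ψ : B →+* T}
    {π : B →+* A} {μ : N →+ A} (hμ : Represents ψ π μ) (ι : T →+* U)
    (Λ : U →+ N) (hΛ : ∀ t u, Λ (ι t * u) = t • Λ u)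
    (hΛu : ∀ g : U →+ N, (∀ t u, g (ι t * u) = t • g u) → ∃! u₀, ∀ u, g u = Λ (u₀ * u))
    (ε : M ≃ₗ[U] U) :
    Represents (ι.comp ψ) π ((μ.comp Λ).comp (ε : M →+ U)) := by
  refine ⟨fun b m => ?_, fun h hh => ?_⟩
  · change μ (Λ (ε (ι (ψ b) • m))) = _
    rw [_root_.map_smul, smul_eq_mul, hΛ, hμ.map_smul]
    rfl
  · have hex : ∀ u, ∃! n : N, ∀ t, h (ι t * u) = μ (t • n) := fun u =>
      hμ.existsUnique (h.comp ((AddMonoidHom.mulRight u).comp (ι : T →+ U))) fun b t => by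
        change h (ι (ψ b * t) * u) = π b * h (ι t * u)
        rw [map_mul ι, mul_assoc]
        exact hh b _
    choose g hg hguniq using hex
    have hgadd : ∀ u v, g (u + v) = g u + g v := fun u v => by
      symm
      refine hguniq (u + v) _ fun t => ?_
      rw [mul_add, map_add, hg, hg, smul_add, map_add]
    have hgsmul : ∀ t u, g (ι t * u) = t • g u := fun t u => by
      symm
      refine hguniq _ _ fun t' => ?_
      rw [← mul_assoc, ← map_mul, hg, mul_smul]
    obtain ⟨u₀, hu₀, huniq⟩ := hΛu (AddMonoidHom.mk' g hgadd) hgsmul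
    have hu₀ : ∀ u, g u = Λ (u₀ * u) := hu₀
    refine ⟨ε.symm u₀, fun u => ?_, fun m hm => ?_⟩
    · change h u = μ (Λ (ε (u • ε.symm u₀)))
      rw [_root_.map_smul, LinearEquiv.apply_symm_apply, smul_eq_mul, mul_comm u, ← hu₀]
      simpa using hg u 1
    · rw [LinearEquiv.eq_symm_apply]
      refine huniq _ fun u => ?_
      change g u = _
      symm
      refine hguniq u _ fun t => ?_
      rw [hm]
      change μ (Λ (ε ((ι t * u) • m))) = _
      rw [_root_.map_smul, smul_eq_mul, ← hΛ]
      congr 2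
      ring

/-- A Frobenius form `S → K` over `R` induces one on components of `S` over components of `R`. -/
lemma exists_frobenius_of_idempotent {R S K T U N : Type*} [CommRing R] [CommRing S] [Algebra R S]
    [AddCommGroup K] [Module R K] [CommRing T] [CommRing U] [AddCommGroup N] [Module T N]
    (lam : S →ₗ[R] K) (hlam : ∀ h : S →ₗ[R] K, ∃! s, ∀ u, h u = lam (s * u)) {e : R} {e' : S}
    (he' : IsIdempotentElem e')
    (r : R →+* T) (hr : Function.Surjective r) (q : S →+* U) (hq : Function.Surjective q)
    (hqker : ∀ s, q s = 0 ↔ (1 - e') * s = 0) (ρ : K →+ N) (hρ : Function.Surjective ρ)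
    (hρker : ∀ x, ρ x = 0 ↔ (1 - e) • x = 0) (hρr : ∀ a x, ρ (a • x) = r a • ρ x)
    (ι : T →+* U) (hι : ∀ a, ι (r a) = q (algebraMap R S a)) (hre : r e = 0) :
    ∃ Λ : U →+ N, (∀ t u, Λ (ι t * u) = t • Λ u) ∧
      ∀ g : U →+ N, (∀ t u, g (ι t * u) = t • g u) → ∃! u₀, ∀ u, g u = Λ (u₀ * u) := by
  have hqe' : q e' = 0 := (hqker e').mpr (by linear_combination -he'.eq)
  have hq1 : ∀ s, q ((1 - e') * s) = q s := fun s => by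
    rw [map_mul, map_sub, map_one, hqe', sub_zero, one_mul]
  have hρ1 : ∀ x, ρ ((1 - e) • x) = ρ x := fun x => by
    rw [hρr, map_sub, map_one, hre, sub_zero, one_smul]
  -- `Λ` and the section `σ` of `ρ` are well defined because of the idempotents.
  obtain ⟨Λ, hΛ⟩ : ∃ Λ : U →+ N, ∀ s, Λ (q s) = ρ (lam ((1 - e') * s)) := by
    have hwd : ∀ s s', q s = q s' → (1 - e') * s = (1 - e') * s' := fun s s' h => by
      rw [← sub_eq_zero, ← mul_sub, ← hqker, map_sub, h, sub_self]
    have hs := Function.surjInv_eq hq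
    refine ⟨AddMonoidHom.mk' (fun u => ρ (lam ((1 - e') * Function.surjInv hq u))) fun u v => ?_,
      fun s => ?_⟩
    · rw [← map_add, ← map_add, ← mul_add]
      congr 2
      exact hwd _ _ (by rw [map_add, hs, hs, hs])
    · change ρ (lam ((1 - e') * _)) = _
      congr 2
      exact hwd _ _ (hs _)
  obtain ⟨σ, hσ⟩ : ∃ σ : N →+ K, ∀ x, σ (ρ x) = (1 - e) • x := by
    have hwd : ∀ s s', ρ s = ρ s' → (1 - e) • s = (1 - e) • s' := fun s s' h => by
      rw [← sub_eq_zero, ← smul_sub, ← hρker, map_sub, h, sub_self]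
    have hs := Function.surjInv_eq hρ
    refine ⟨AddMonoidHom.mk' (fun u => (1 - e) • Function.surjInv hρ u) fun u v => ?_,
      fun s => hwd _ _ (hs _)⟩
    rw [← smul_add]
    exact hwd _ _ (by rw [map_add, hs, hs, hs])
  have hρσ : ∀ n, ρ (σ n) = n := fun n => by
    obtain ⟨x, rfl⟩ := hρ n
    rw [hσ, hρ1]
  have hσr : ∀ a n, σ (r a • n) = a • σ n := fun a n => by
    obtain ⟨x, rfl⟩ := hρ n
    rw [← hρr, hσ, hσ, smul_comm]
  refine ⟨Λ, fun t u => ?_, fun g hg => ?_⟩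
  · obtain ⟨a, rfl⟩ := hr t
    obtain ⟨s, rfl⟩ := hq u
    rw [hι, ← map_mul, hΛ, hΛ, ← hρr, ← map_smul, Algebra.smul_def]
    congr 2
    ring
  · let h : S →ₗ[R] K :=
      { toFun := fun s => σ (g (q s))
        map_add' := fun x y => by rw [map_add, map_add, map_add]
        map_smul' := fun a s => by
          rw [Algebra.smul_def, map_mul, ← hι, hg, hσr]
          rfl }
    obtain ⟨s₀, hs₀, -⟩ := hlam h
    have hs₀ : ∀ s, σ (g (q s)) = lam (s₀ * s) := hs₀
    refine ⟨q s₀, fun u => ?_, fun v hv => ?_⟩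
    · obtain ⟨s, rfl⟩ := hq u
      rw [← map_mul, hΛ, mul_left_comm, ← hs₀, hq1, hρσ]
    · obtain ⟨s₁, rfl⟩ := hq v
      rw [← sub_eq_zero, ← map_sub, hqker]
      set z := (1 - e') * (s₁ - s₀)
      -- `λ` vanishes on the ideal generated by `(1 - e) z`.
      have hz : ∀ s, lam ((algebraMap R S (1 - e) * z) * s) = 0 := by
        intro s
        have h1 := hv (q s)
        rw [← map_mul, hΛ] at h1
        have h2 : ρ (lam (z * s)) = 0 := by
          have h3 : z * s = (1 - e') * (s₁ * s) - s₀ * ((1 - e') * s) := by simp only [z]; ring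
          rw [h3, map_sub, map_sub, ← h1, ← hs₀, hq1, hρσ, sub_self]
        rw [hρker] at h2
        rw [mul_assoc, ← Algebra.smul_def, map_smul, h2]
      obtain ⟨w, -, hw⟩ := hlam 0
      have h4 : algebraMap R S (1 - e) * z = 0 := by
        exact (hw _ fun u => (hz u).symm).trans
          (hw 0 fun u => by rw [zero_mul, map_zero]; rfl).symm
      have h5 : (1 - e') * algebraMap R S e = 0 := by
        rw [← hqker, ← hι, hre, map_zero]
      have h6 : z = (1 - e') * z := by
        simp only [z]; linear_combination -(s₁ - s₀) * he'.eq
      rw [map_sub, map_one] at h4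
      linear_combination h4 + algebraMap R S e * h6 + z * h5

end Frobenius

/-! ### Duality for finite extensions -/

section CanonicalModule

variable {k R S : Type u} [Field k] [CommRing R] [Algebra k R] [CommRing S] [Algebra k S]
  [Algebra R S] [IsScalarTower k R S] [IsNoetherianRing R] [IsNormalRing R]

lemma mem_span_singleton_smul_top_iff {R M : Type*} [CommRing R] [AddCommGroup M] [Module R M]
    {e : R} (he : IsIdempotentElem e) {x : M} :
    x ∈ (Ideal.span {e} • ⊤ : Submodule R M) ↔ (1 - e) • x = 0 := by
  rw [Submodule.ideal_span_singleton_smul, Submodule.mem_smul_pointwise_iff_exists]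
  constructor
  · rintro ⟨y, -, rfl⟩
    rw [smul_smul, show (1 - e) * e = 0 by linear_combination -he.eq, zero_smul]
  · intro h
    exact ⟨x, Submodule.mem_top, by rwa [sub_smul, one_smul, sub_eq_zero, eq_comm] at h⟩

/-- A prime of a normal Noetherian ring that consists of zerodivisors is minimal. -/
lemma mem_minimalPrimes_of_forall_notMem {P : Ideal R} [hP : P.IsPrime]
    (h : ∀ r ∈ P, r ∉ R⁰) : P ∈ minimalPrimes R := by
  have := IsNormalRing.isReduced (R := R)
  by_contra hcon
  obtain ⟨t, htP, ht⟩ := exists_mem_forall_notMem_of_not_le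
    (minimalPrimes.finite_of_isNoetherianRing R).toFinset id
    (fun P hP => ((Set.Finite.mem_toFinset _).mp hP).1.1) P (fun Q hQ hle => by
      have hQ := (Set.Finite.mem_toFinset _).mp hQ
      exact hcon ((le_antisymm hle (hQ.2 ⟨hP, bot_le⟩ hle)) ▸ hQ))
  exact h t htP (mem_nonZeroDivisors_of_notMem_minimalPrimes fun Q hQ =>
    ht Q ((Set.Finite.mem_toFinset _).mpr hQ))

/-- A finite normal extension `S` of `R` with `S = Hom_R(S, ω_R)` is quasi-Gorenstein. -/
lemma isQuasiGorenstein_of_frobenius [Module.Finite R S] [IsNoetherianRing S] [IsNormalRing S]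
    (hRS : ∀ r ∈ R⁰, algebraMap R S r ∈ S⁰) {K : Type u} [AddCommGroup K] [Module R K]
    (hK : IsCanonicalModule k R K) (lam : S →ₗ[R] K)
    (hlam : ∀ h : S →ₗ[R] K, ∃! s, ∀ u, h u = lam (s * u)) : IsQuasiGorenstein k S := by
  intro e' he' hconn
  have hprime := IsNormalRing.isPrime_span_idempotent he'
  set I := Ideal.span {e'}
  obtain ⟨e, he, hPe⟩ := IsNormalRing.exists_minimalPrime_eq_span (P := I.comap (algebraMap R S))
    (mem_minimalPrimes_of_forall_notMem fun r hr hr0 => by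
      have h1 : (1 - e') * algebraMap R S r = 0 := (mem_span_idempotent_iff he').mp hr
      have h2 := (mem_nonZeroDivisors_iff_right.mp (hRS r hr0)) _ h1
      exact hprime.ne_top ((Ideal.eq_top_iff_one _).mpr
        (by rw [sub_eq_zero.mp h2]; exact Ideal.mem_span_singleton_self e')))
  have hJprime : (Ideal.span {e}).IsPrime := hPe ▸ Ideal.comap_isPrime _ _
  set J := Ideal.span {e}
  let ι : R ⧸ J →ₐ[k] S ⧸ I := Ideal.quotientMapₐ I (IsScalarTower.toAlgHom k R S) hPe.ge
  have hι : Function.Injective ι := Ideal.quotientMap_injective' (H := hPe.ge) hPe.le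
  obtain ⟨D, hD⟩ := exists_dualizingData (hK e he inferInstance)
  have hρker : ∀ x : K, (Submodule.mkQ (J • ⊤ : Submodule R K)) x = 0 ↔ (1 - e) • x = 0 := by
    intro x
    rw [Submodule.mkQ_apply, Submodule.Quotient.mk_eq_zero, mem_span_singleton_smul_top_iff he]
  obtain ⟨Λ, hΛ, hΛu⟩ := exists_frobenius_of_idempotent lam hlam he' (Ideal.Quotient.mk J)
    Ideal.Quotient.mk_surjective (Ideal.Quotient.mk I) Ideal.Quotient.mk_surjective
    (fun s => by rw [Ideal.Quotient.eq_zero_iff_mem, mem_span_idempotent_iff he'])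
    ((Submodule.mkQ (J • ⊤ : Submodule R K)).toAddMonoidHom)
    (Submodule.mkQ_surjective _) hρker (fun a x => rfl) (ι : R ⧸ J →+* S ⧸ I) (fun a => rfl)
    (Ideal.Quotient.eq_zero_iff_mem.mpr (Ideal.mem_span_singleton_self e))
  have hIS : (I • ⊤ : Submodule S S) = I := by simp
  let ε₀ : (S ⧸ (I • ⊤ : Submodule S S)) ≃ₗ[S] S ⧸ I := Submodule.quotEquivOfEq _ _ hIS
  let ε : (S ⧸ (I • ⊤ : Submodule S S)) ≃ₗ[S ⧸ I] S ⧸ I :=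
    { ε₀ with
      map_smul' := fun a x => by
        obtain ⟨a, rfl⟩ := Ideal.Quotient.mk_surjective a
        exact ε₀.map_smul a x }
  have hrep := D.represents.of_frobenius (ι : R ⧸ J →+* S ⧸ I) Λ hΛ hΛu ε
  let D' : DualizingData k (S ⧸ I) (S ⧸ (I • ⊤ : Submodule S S)) :=
    { n := D.n
      B := D.B
      isLocPoly := D.isLocPoly
      A := D.A
      xs := D.xs
      isWeaklyRegular := D.isWeaklyRegular
      π := D.π
      π_surjective := D.π_surjective
      ker_π := D.ker_π
      ψ := ι.comp D.ψ
      ψ_xs := fun x hx => by rw [AlgHom.comp_apply, D.ψ_xs x hx, map_zero]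
      height_ker := by
        rw [← D.height_ker]
        congr 1
        ext x
        rw [RingHom.mem_ker, RingHom.mem_ker, AlgHom.comp_apply]
        exact map_eq_zero_iff _ hι
      μ := _
      represents := hrep }
  have hfin : D'.ψ.toRingHom.Finite := by
    have h1 : (ι : R ⧸ J →+* S ⧸ I).Finite := by
      have h2 : ((Ideal.Quotient.mk I).comp (algebraMap R S)).Finite :=
        (RingHom.Finite.of_surjective _ Ideal.Quotient.mk_surjective).comp
          (RingHom.finite_algebraMap.mpr inferInstance)
      exact RingHom.Finite.of_comp_finite (f := Ideal.Quotient.mk J) h2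
    exact h1.comp (RingHom.Finite.of_surjective (D.ψ : D.B →+* R ⧸ J) hD)
  obtain ⟨D'', hD''⟩ := D'.exists_surjective hfin
  exact D''.isCanonicalModuleOfConnected hD''

end CanonicalModule

/-! ### The codifferent -/

section Codifferent

/-- The codifferent of `T` over `N` with respect to a linear form `ξ` on the field of fractions of
`T`: all `m` with `ξ (T m) ⊆ N`. For `ξ ≠ 0` it is a copy of `Hom_N(T, N)`. -/
def codifferent (N T : Type*) {L κ : Type*} [CommRing N] [Field L] [Algebra N L]
    [CommRing T] [Field κ] [Algebra T κ] [Algebra L κ] (ξ : κ →ₗ[L] L) : Submodule T κ where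
  carrier := {m | ∀ t : T, ξ (t • m) ∈ (algebraMap N L).range}
  zero_mem' := fun t => by simp
  add_mem' := fun ha hb t => by
    rw [smul_add, map_add]
    exact add_mem (ha t) (hb t)
  smul_mem' := fun r m hm t => by
    rw [smul_smul]
    exact hm _

/-- The codifferent satisfies Serre's condition `S₂` over `N`, in the following form: the
denominators of an element outside of the codifferent cannot include both a prime element `a` and an
element `b` that `a` does not divide. -/
lemma mem_codifferent_of_prime {N L T κ : Type*} [CommRing N] [Field L] [Algebra N L]
    [IsFractionRing N L] [CommRing T] [Algebra N T] [Field κ] [Algebra T κ] [Algebra N κ]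
    [IsScalarTower N T κ] [Algebra L κ] [IsScalarTower N L κ] {ξ : κ →ₗ[L] L} {a b : N} (ha : Prime a) (hab : ¬ a ∣ b) {z : κ}
    (haz : algebraMap N T a • z ∈ codifferent N T ξ)
    (hbz : algebraMap N T b • z ∈ codifferent N T ξ) : z ∈ codifferent N T ξ := by
  intro t
  have hsmul : ∀ c : N, ξ (t • algebraMap N T c • z) = algebraMap N L c * ξ (t • z) := fun c => by
    rw [smul_comm, algebraMap_smul, ← algebraMap_smul L c, map_smul, smul_eq_mul]
  obtain ⟨x, hx⟩ := haz t
  obtain ⟨y, hy⟩ := hbz t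
  rw [hsmul] at hx hy
  have hxy : b * x = a * y := IsFractionRing.injective N L (by
    rw [map_mul, map_mul, hx, hy]; ring)
  obtain ⟨c, rfl⟩ := (ha.dvd_or_dvd (Dvd.intro _ hxy.symm)).resolve_left hab
  refine ⟨c, mul_left_cancel₀ ((map_ne_zero_iff _ (IsFractionRing.injective N L)).mpr ha.ne_zero) ?_⟩
  rw [← hx, map_mul]

/-- For a domain `T` finite over `N`, denominators in `N` suffice for the field of fractions of `T`. -/
lemma isLocalization_algebraMapSubmonoid_of_finite (N : Type*) {T κ : Type*} [CommRing N]
    [IsDomain N] [CommRing T] [IsDomain T] [Algebra N T] [FaithfulSMul N T] [Module.Finite N T]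
    [Field κ] [Algebra T κ] [IsFractionRing T κ] :
    IsLocalization (Algebra.algebraMapSubmonoid T N⁰) κ := by
  have hinj : Function.Injective (algebraMap T κ) := IsFractionRing.injective T κ
  refine ⟨?_, fun z => ?_, fun h => ⟨1, by rw [hinj h]⟩⟩
  · rintro ⟨_, n, hn, rfl⟩
    refine IsUnit.mk0 _ ((map_ne_zero_iff _ hinj).mpr ?_)
    exact (map_ne_zero_iff _ (FaithfulSMul.algebraMap_injective N T)).mpr
      (nonZeroDivisors.ne_zero hn)
  · obtain ⟨⟨a, s⟩, h⟩ := IsLocalization.surj T⁰ z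
    obtain ⟨c, d, hd, h'⟩ := Algebra.IsAlgebraic.exists_smul_eq_mul N (1 : T)
      (nonZeroDivisors.ne_zero s.2)
    refine ⟨⟨a * c, algebraMap N T d,
      Algebra.mem_algebraMapSubmonoid_of_mem ⟨d, mem_nonZeroDivisors_of_ne_zero hd⟩⟩, ?_⟩
    change z * algebraMap T κ (algebraMap N T d) = algebraMap T κ (a * c)
    rw [Algebra.smul_def, mul_one] at h'
    rw [h', map_mul, map_mul, ← h, mul_assoc]

variable {N L T κ : Type*} [CommRing N] [IsDomain N] [Field L] [Algebra N L] [IsFractionRing N L]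
  [CommRing T] [IsDomain T] [Algebra N T] [FaithfulSMul N T] [Module.Finite N T]
  [Field κ] [Algebra T κ] [IsFractionRing T κ]
  [Algebra N κ] [IsScalarTower N T κ] [Algebra L κ] [IsScalarTower N L κ]

/-- The codifferent represents the functional `Hom_N(T, N)`: over the field of fractions `L` of `N`,
every linear form on the finite field extension `κ` is a multiple of `ξ`. -/
lemma exists_represents_codifferent {ξ : κ →ₗ[L] L} (hξ : ξ ≠ 0) :
    ∃ μ : codifferent N T ξ →+ N, (∀ m, algebraMap N L (μ m) = ξ m) ∧
      Represents (algebraMap N T) (RingHom.id N) μ := by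
  have hinj := IsFractionRing.injective N L
  have h : ∀ m : codifferent N T ξ, ∃ n : N, algebraMap N L n = ξ m := fun m => by
    obtain ⟨n, hn⟩ := m.2 1
    exact ⟨n, by rw [hn, one_smul]⟩
  choose μ hμ using h
  have hsmul : ∀ (b : N) (x : κ), ξ (algebraMap N T b • x) = algebraMap N L b * ξ x := fun b x => by
    rw [algebraMap_smul, ← algebraMap_smul L b x, map_smul, smul_eq_mul]
  refine ⟨{ toFun := μ
            map_zero' := hinj (by rw [hμ]; simp)
            map_add' := fun a b => hinj (by rw [hμ, map_add, hμ, hμ]; simp) }, hμ, ?_, ?_⟩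
  · intro b m
    refine hinj ?_
    rw [RingHom.id_apply, map_mul]
    change algebraMap N L (μ _) = _ * algebraMap N L (μ _)
    rw [hμ, hμ, Submodule.coe_smul, hsmul]
  · intro h hh
    have hloc := isLocalization_algebraMapSubmonoid_of_finite N (T := T) (κ := κ)
    have hfin : Module.Finite L κ := Module.Finite.of_isLocalization N T N⁰
    let h₁ : T →ₗ[N] L :=
      { toFun := fun t => algebraMap N L (h t)
        map_add' := fun a b => by rw [map_add, map_add]
        map_smul' := fun b t => by
          rw [Algebra.smul_def, hh, RingHom.id_apply, map_mul, Algebra.smul_def] }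
    let ι : T →ₗ[N] κ := (IsScalarTower.toAlgHom N T κ).toLinearMap
    have hu : ∀ x : N⁰, IsUnit (algebraMap N (Module.End N L) x) :=
      IsLocalizedModule.map_units (S := N⁰) (Algebra.linearMap N L)
    let h₂ : κ →ₗ[L] L :=
      (IsLocalizedModule.lift N⁰ ι h₁ hu).extendScalarsOfIsLocalization N⁰ L
    have h₂t : ∀ t : T, h₂ (algebraMap T κ t) = algebraMap N L (h t) := fun t =>
      IsLocalizedModule.lift_apply N⁰ ι h₁ hu t
    -- The map `m ↦ ξ (· m)` is injective, hence bijective, as both sides have the same dimension over `L`.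
    let Φ : κ →ₗ[L] Module.Dual L κ :=
      { toFun := fun m => ξ ∘ₗ LinearMap.mulRight L m
        map_add' := fun a b => by ext x; simp [mul_add]
        map_smul' := fun c a => by ext x; simp }
    have hΦinj : Function.Injective Φ := by
      refine (injective_iff_map_eq_zero Φ).mpr fun m hm => ?_
      by_contra hm0
      refine hξ (LinearMap.ext fun x => ?_)
      have := LinearMap.congr_fun hm (x * m⁻¹)
      change ξ (x * m⁻¹ * m) = 0 at this
      rwa [inv_mul_cancel_right₀ hm0] at this
    obtain ⟨m, hm⟩ := (LinearMap.injective_iff_surjective_of_finrank_eq_finrank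
      (Subspace.dual_finrank_eq (K := L) (V := κ)).symm).mp hΦinj h₂
    have hmt : ∀ t : T, ξ (t • m) = algebraMap N L (h t) := fun t => by
      rw [← h₂t, ← hm, Algebra.smul_def]
      rfl
    refine ⟨⟨m, fun t => ⟨h t, (hmt t).symm⟩⟩, fun t => hinj ?_, ?_⟩
    · exact (hmt t).symm.trans (hμ (t • ⟨m, fun t => ⟨h t, (hmt t).symm⟩⟩)).symm
    · rintro ⟨m', hm'⟩ h'
      refine Subtype.ext (hΦinj ?_)
      refine LinearMap.ext fun x => ?_
      change ξ (x * m') = ξ (x * m)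
      obtain ⟨⟨t, ⟨_, n, hn, rfl⟩⟩, hx⟩ :=
        IsLocalization.surj (Algebra.algebraMapSubmonoid T N⁰) x
      have key : ∀ z : κ, algebraMap N L n * ξ (x * z) = ξ (t • z) := fun z => by
        rw [← hsmul, Algebra.smul_def, Algebra.smul_def, ← mul_assoc, mul_comm _ x]
        congr 2
      have hn0 : algebraMap N L n ≠ 0 :=
        (map_ne_zero_iff _ hinj).mpr (nonZeroDivisors.ne_zero hn)
      refine mul_left_cancel₀ hn0 ?_
      rw [key, key, hmt, h' t]
      exact (hμ (t • ⟨m', hm'⟩)).symm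

/-- The codifferent embeds into a finite free module over the Noetherian ring `N`, by the values on
generators of `T`. -/
lemma codifferent_fg [IsNoetherianRing N] {ξ : κ →ₗ[L] L} (hξ : ξ ≠ 0) :
    (codifferent N T ξ).FG := by
  obtain ⟨μ, -, hμ⟩ := exists_represents_codifferent (N := N) (T := T) hξ
  obtain ⟨r, s, hs⟩ := Module.Finite.exists_fin (R := N) (M := T)
  have hNsmul : ∀ (b : N) (m : codifferent N T ξ), μ (b • m) = b * μ m := fun b m => by
    rw [← algebraMap_smul T b m]
    exact hμ.map_smul b m
  let F : codifferent N T ξ →ₗ[N] Fin r → N :=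
    { toFun := fun m i => μ (s i • m)
      map_add' := fun a b => by ext i; simp
      map_smul' := fun c a => by
        ext i
        rw [smul_comm, hNsmul]
        rfl }
  have hF : Function.Injective F := by
    refine (injective_iff_map_eq_zero F).mpr fun m hm => ?_
    have h0 : ∀ t : T, μ (t • m) = 0 := fun t => by
      have ht : t ∈ Submodule.span N (Set.range s) := hs ▸ Submodule.mem_top
      induction ht using Submodule.span_induction with
      | mem x hx =>
        obtain ⟨i, rfl⟩ := hx
        exact congr_fun hm i
      | zero => rw [zero_smul, map_zero]
      | add x y _ _ hx hy => rw [add_smul, map_add, hx, hy, add_zero]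
      | smul b x _ hx => rw [smul_assoc, hNsmul, hx, mul_zero]
    obtain ⟨_, -, huniq⟩ := hμ.existsUnique 0 fun b u => by simp
    exact (huniq m fun u => (h0 u).symm).trans (huniq 0 fun u => by simp).symm
  have hN : IsNoetherian N (codifferent N T ξ) := isNoetherian_of_injective F hF
  have hfin : Module.Finite T (codifferent N T ξ) :=
    Module.Finite.of_restrictScalars_finite N T _
  exact Module.Finite.iff_fg.mp hfin

omit [IsDomain T] in
/-- A common denominator of the values of `ξ` on generators of `T` lies in the codifferent. -/
lemma exists_ne_zero_mem_codifferent (ξ : κ →ₗ[L] L) : ∃ m ∈ codifferent N T ξ, m ≠ 0 := by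
  obtain ⟨s, hs⟩ := Module.Finite.fg_top (R := N) (M := T)
  classical
  obtain ⟨d, hd⟩ := IsLocalization.exist_integer_multiples_of_finset N⁰
    (s.image fun t => ξ (algebraMap T κ t))
  refine ⟨algebraMap N κ d, fun t => ?_, ?_⟩
  · have ht : t ∈ Submodule.span N (s : Set T) := hs ▸ Submodule.mem_top
    have h1 : ξ (t • algebraMap N κ d) = (d : N) • ξ (algebraMap T κ t) := by
      rw [Algebra.smul_def, mul_comm, ← Algebra.smul_def, ← algebraMap_smul L (d : N), map_smul,
        algebraMap_smul]
    rw [h1]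
    clear h1
    induction ht using Submodule.span_induction with
    | mem x hx => exact hd _ (Finset.mem_image_of_mem _ hx)
    | zero => simp
    | add x y _ _ hx hy =>
      rw [map_add, map_add, smul_add]
      exact add_mem hx hy
    | smul b x _ hx =>
      have h2 : ξ (algebraMap T κ (b • x)) = b • ξ (algebraMap T κ x) := by
        rw [Algebra.smul_def b x, map_mul, ← IsScalarTower.algebraMap_apply, ← Algebra.smul_def,
          ← algebraMap_smul L b, map_smul, algebraMap_smul]
      rw [h2, smul_comm, Algebra.smul_def]
      exact mul_mem ⟨b, rfl⟩ hx
  · rw [IsScalarTower.algebraMap_apply N T κ]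
    exact (map_ne_zero_iff _ (IsFractionRing.injective T κ)).mpr
      ((map_ne_zero_iff _ (FaithfulSMul.algebraMap_injective N T)).mpr
        (nonZeroDivisors.ne_zero d.2))

end Codifferent

/-! ### Canonical fractional ideals of domains -/

section CanonicalFractional

/-- By Noether normalization, a domain `T` of finite type is finite over a polynomial ring `N`, and the
codifferent is presented as `Hom_N(T, N)`, with the empty regular sequence. The polynomial ring is
factorial, so a nonzero prime of `T` contains a prime element of `N`; this gives condition `S₂`. -/
lemma exists_dualizingData_of_finiteType (k T κ : Type u) [Field k] [CommRing T] [IsDomain T]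
    [Algebra k T] [Algebra.FiniteType k T] [Field κ] [Algebra T κ] [IsFractionRing T κ] :
    ∃ M : Submodule T κ, M.FG ∧ (∃ u ∈ M, u ≠ 0) ∧
      (∀ p q : Ideal T, p.IsPrime → q.IsPrime → q ≠ ⊥ → q < p →
        ∀ y : κ, (∀ r ∈ p, r • y ∈ M) → y ∈ M) ∧
      ∃ D : DualizingData k T M, Function.Surjective D.ψ := by
  obtain ⟨n, g, hg, hfin⟩ := exists_finite_inj_algHom_of_fg k T
  let N := MvPolynomial (Fin n) k
  let _ : Algebra N T := g.toRingHom.toAlgebra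
  have : Module.Finite N T := hfin
  have : FaithfulSMul N T := (faithfulSMul_iff_algebraMap_injective N T).mpr hg
  let _ : Algebra N κ := ((algebraMap T κ).comp (algebraMap N T)).toAlgebra
  have : IsScalarTower N T κ := IsScalarTower.of_algebraMap_eq fun _ => rfl
  have : FaithfulSMul N κ := (faithfulSMul_iff_algebraMap_injective N κ).mpr
    ((IsFractionRing.injective T κ).comp hg)
  let L := FractionRing N
  let _ : Algebra L κ := FractionRing.liftAlgebra N κ
  have : IsScalarTower N L κ := FractionRing.isScalarTower_liftAlgebra N κ
  obtain ⟨ξ, hξ⟩ : ∃ ξ : Module.Dual L κ, ξ ≠ 0 := by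
    by_contra! h
    exact one_ne_zero ((Module.forall_dual_apply_eq_zero_iff L (1 : κ)).mp fun φ => by
      rw [h φ, LinearMap.zero_apply])
  obtain ⟨μ, -, hμ⟩ := exists_represents_codifferent (N := N) (T := T) hξ
  let D : DualizingData k T (codifferent N T ξ) :=
    { n := n
      B := N
      isLocPoly := isLocPoly_mvPolynomial n
      A := N
      xs := []
      isWeaklyRegular := .nil _ _
      π := RingHom.id N
      π_surjective := Function.surjective_id
      ker_π := by
        rw [Ideal.ofList_nil]
        exact (RingHom.injective_iff_ker_eq_bot _).mp Function.injective_id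
      ψ := g
      ψ_xs := by simp
      height_ker := by
        rw [(RingHom.injective_iff_ker_eq_bot g).mp hg, Ideal.height_bot]
        rfl
      μ := μ
      represents := hμ }
  refine ⟨codifferent N T ξ, codifferent_fg hξ, exists_ne_zero_mem_codifferent ξ, ?_,
    D.exists_surjective hfin⟩
  intro p q hp hq hq0 hqp y hy
  -- A prime element of `N` in `q`, and an element of `p` that it does not divide.
  obtain ⟨a, haq, ha⟩ := (Ideal.comap_isPrime (algebraMap N T) q).exists_mem_prime_of_ne_bot
    fun h => hq0 (Ideal.eq_bot_of_comap_eq_bot h)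
  obtain ⟨x, hxp, hxq⟩ := SetLike.exists_of_lt hqp
  obtain ⟨b, hbp, hbq⟩ := SetLike.exists_of_lt
    (Ideal.comap_lt_comap_of_integral_mem_sdiff hqp.le (R := N) ⟨hxp, hxq⟩
      (Algebra.IsIntegral.isIntegral x))
  refine mem_codifferent_of_prime ha (fun h => hbq (Ideal.mem_of_dvd _ h haq))
    (hy _ (hqp.le haq)) (hy _ hbp)

/-- A domain that is essentially of finite type over `k` has a canonical module that is a fractional
ideal and satisfies Serre's condition `S₂`. -/
theorem exists_isCanonicalModuleOfConnected_submodule (k T κ : Type u) [Field k] [CommRing T]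
    [IsDomain T] [Algebra k T] [Algebra.EssFiniteType k T] [Field κ] [Algebra T κ]
    [IsFractionRing T κ] :
    ∃ M : Submodule T κ, M.FG ∧ (∃ u ∈ M, u ≠ 0) ∧
      (∀ p q : Ideal T, p.IsPrime → q.IsPrime → q ≠ ⊥ → q < p →
        ∀ y : κ, (∀ r ∈ p, r • y ∈ M) → y ∈ M) ∧
      IsCanonicalModuleOfConnected k T M := by
  let T₀ := Algebra.EssFiniteType.subalgebra k T
  let W := Algebra.EssFiniteType.submonoid k T
  have hW : IsLocalization W T := inferInstance
  have hW0 : (0 : T₀) ∉ W := fun h => by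
    have : IsUnit (algebraMap T₀ T 0) := h
    rw [map_zero] at this
    exact not_isUnit_zero this
  have : IsFractionRing T₀ κ := by
    have h1 := IsLocalization.localization_localization_isLocalization_of_has_all_units W T⁰ κ
      fun x hx => hx.mem_nonZeroDivisors
    have h2 : (T⁰).comap (algebraMap T₀ T) = T₀⁰ := by
      ext x
      rw [Submonoid.mem_comap, mem_nonZeroDivisors_iff_ne_zero, mem_nonZeroDivisors_iff_ne_zero,
        Ne, map_eq_zero_iff _ Subtype.val_injective]
    rwa [h2] at h1
  have hNoeth : IsNoetherianRing T₀ := Algebra.FiniteType.isNoetherianRing k T₀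
  obtain ⟨M, ⟨s, hs⟩, ⟨u, hu, hu0⟩, hS2, D, hD⟩ := exists_dualizingData_of_finiteType k T₀ κ
  have hloc : IsLocalizedModule W (LinearMap.id : κ →ₗ[T₀] κ) := isLocalizedModule_id W κ T
  let M' : Submodule T κ := M.localized' T W (LinearMap.id : κ →ₗ[T₀] κ)
  have hmem : ∀ y, y ∈ M' ↔ ∃ w ∈ W, w • y ∈ M := fun y => by
    rw [Submodule.mem_localized']
    constructor
    · rintro ⟨m, hm, w, rfl⟩
      exact ⟨w, w.2, by
        rw [← Submonoid.smul_def, IsLocalizedModule.mk'_cancel']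
        exact hm⟩
    · rintro ⟨w, hw, hy⟩
      exact ⟨_, hy, ⟨w, hw⟩, by
        rw [IsLocalizedModule.mk'_eq_iff]
        rfl⟩
  refine ⟨M', ?_, ⟨u, (hmem u).mpr ⟨1, W.one_mem, by rwa [one_smul]⟩, hu0⟩, ?_, ?_⟩
  · refine ⟨s, ?_⟩
    have h := Submodule.localized'_span T W (LinearMap.id : κ →ₗ[T₀] κ) (s : Set κ)
    rw [hs, LinearMap.id_coe, Set.image_id] at h
    exact h.symm
  · intro p q hp hq hq0 hqp y hy
    obtain ⟨t, ht⟩ := hNoeth.noetherian (p.comap (algebraMap T₀ T))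
    have h1 : ∀ r : T₀, ∃ w ∈ W, r ∈ p.comap (algebraMap T₀ T) → w • r • y ∈ M := fun r => by
      by_cases hr : r ∈ p.comap (algebraMap T₀ T)
      · obtain ⟨w, hw, h⟩ := (hmem _).mp (hy _ hr)
        exact ⟨w, hw, fun _ => by rwa [algebraMap_smul] at h⟩
      · exact ⟨1, W.one_mem, fun h => absurd h hr⟩
    choose w hw hwM using h1
    have hmap : ∀ J : Ideal T, (J.comap (algebraMap T₀ T)).map (algebraMap T₀ T) = J := fun J =>
      IsLocalization.map_under W T J
    classical
    refine (hmem y).mpr ⟨∏ r ∈ t, w r, prod_mem fun r _ => hw r, ?_⟩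
    refine hS2 (p.comap (algebraMap T₀ T)) (q.comap (algebraMap T₀ T)) (Ideal.comap_isPrime _ p)
      (Ideal.comap_isPrime _ q) ?_ ?_ _ fun r hr => ?_
    · intro h
      refine hq0 ?_
      rw [← hmap q, h, Ideal.map_bot]
    · refine lt_of_le_of_ne (Ideal.comap_mono (f := algebraMap T₀ T) hqp.le) fun h => hqp.ne ?_
      rw [← hmap q, ← hmap p, h]
    · rw [← ht] at hr
      induction hr using Submodule.span_induction with
      | mem r hr =>
        rw [smul_comm, ← Finset.prod_erase_mul _ _ hr, mul_smul]
        exact M.smul_mem _ (hwM r (ht ▸ Submodule.subset_span hr))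
      | zero => rw [zero_smul]; exact M.zero_mem
      | add a b _ _ ha hb => rw [add_smul]; exact M.add_mem ha hb
      | smul c a _ ha => rw [smul_assoc]; exact M.smul_mem _ ha
  · obtain ⟨D', hD'⟩ := D.exists_localization hD W hW0 (U' := T)
      (M.toLocalized' T W (LinearMap.id : κ →ₗ[T₀] κ))
    exact D'.isCanonicalModuleOfConnected hD'

end CanonicalFractional

/-! ### Existence of canonical divisors -/

section Glue

lemma IsCanonicalModuleOfConnected.congr {k T M M' : Type u} [Field k] [CommRing T] [Algebra k T]
    [AddCommGroup M] [Module T M] [AddCommGroup M'] [Module T M']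
    (h : IsCanonicalModuleOfConnected k T M) (e : M' ≃ₗ[T] M) :
    IsCanonicalModuleOfConnected k T M' := by
  obtain ⟨n, W, φ, c, hφ, hc, ⟨i⟩⟩ := h
  exact ⟨n, W, φ, c, hφ, hc, ⟨(ModuleCat.restrictScalars.{u} φ.toRingHom).mapIso e.toModuleIso ≪≫ i⟩⟩

/-- The first isomorphism theorem for a surjection `N → M` with kernel `I N`, where `M` is a module over
`R ⧸ I`. -/
lemma nonempty_linearEquiv_quotient {R N M : Type*} [CommRing R] [AddCommGroup N] [Module R N]
    {I : Ideal R} [AddCommGroup M] [Module (R ⧸ I) M] (φ : N →+ M) (hφ : Function.Surjective φ)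
    (hsmul : ∀ (r : R) x, φ (r • x) = Ideal.Quotient.mk I r • φ x)
    (hker : ∀ x, φ x = 0 ↔ x ∈ (I • ⊤ : Submodule R N)) :
    Nonempty ((N ⧸ (I • ⊤ : Submodule R N)) ≃ₗ[R ⧸ I] M) := by
  let ψ : (N ⧸ (I • ⊤ : Submodule R N)) →+ M :=
    QuotientAddGroup.lift (I • ⊤ : Submodule R N).toAddSubgroup φ fun x hx => (hker x).mpr hx
  have hψ : ∀ x : N, ψ (Submodule.Quotient.mk x) = φ x := fun _ => rfl
  let ψ' : (N ⧸ (I • ⊤ : Submodule R N)) →ₗ[R ⧸ I] M :=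
    { ψ with
      map_smul' := fun r x => by
        obtain ⟨r, rfl⟩ := Ideal.Quotient.mk_surjective r
        obtain ⟨x, rfl⟩ := Submodule.Quotient.mk_surjective _ x
        exact hsmul r x }
  refine ⟨LinearEquiv.ofBijective ψ' ⟨(injective_iff_map_eq_zero ψ').mpr fun x hx => ?_, fun y => ?_⟩⟩
  · obtain ⟨x, rfl⟩ := Submodule.Quotient.mk_surjective _ x
    exact (Submodule.Quotient.mk_eq_zero _).mpr ((hker x).mp hx)
  · obtain ⟨x, rfl⟩ := hφ y
    exact ⟨Submodule.Quotient.mk x, rfl⟩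

variable {R : Type u} [CommRing R]

/-- The projection of the total ring of fractions to the function field of the component cut out
by an idempotent `e`. -/
lemma exists_toFractionRing_quotient {P : Ideal R} [P.IsPrime] {e : R} (he : IsIdempotentElem e)
    (hPe : P = Ideal.span {e}) :
    ∃ q : FractionRing R →+* FractionRing (R ⧸ P), Function.Surjective q ∧
      (∀ r x, q (r • x) = Ideal.Quotient.mk P r • q x) ∧
      ∀ x, q x = 0 ↔ (1 - e) • x = 0 := by
  have hmk : ∀ r, Ideal.Quotient.mk P r = 0 ↔ (1 - e) * r = 0 := fun r => by
    rw [Ideal.Quotient.eq_zero_iff_mem, ← mem_span_idempotent_iff he, hPe]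
  have hle : R⁰ ≤ (R ⧸ P)⁰.comap (Ideal.Quotient.mk P) := fun s hs => by
    refine mem_nonZeroDivisors_of_ne_zero fun h => ?_
    have h1 := (mem_nonZeroDivisors_iff_right.mp hs) _ ((hmk s).mp h)
    have h2 : Ideal.Quotient.mk P 1 = 0 := by rw [hmk, h1, zero_mul]
    exact one_ne_zero h2
  let q : FractionRing R →+* FractionRing (R ⧸ P) := IsLocalization.map _ (Ideal.Quotient.mk P) hle
  have hq : ∀ r, q (algebraMap R _ r) = algebraMap (R ⧸ P) _ (Ideal.Quotient.mk P r) :=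
    fun r => IsLocalization.map_eq hle r
  have hinj := IsFractionRing.injective (R ⧸ P) (FractionRing (R ⧸ P))
  refine ⟨q, fun y => ?_, fun r x => by rw [Algebra.smul_def, map_mul, hq, Algebra.smul_def],
    fun x => ?_⟩
  · obtain ⟨⟨a, s⟩, h⟩ := IsLocalization.surj (R ⧸ P)⁰ y
    obtain ⟨a, rfl⟩ := Ideal.Quotient.mk_surjective a
    obtain ⟨s, hs⟩ := s
    obtain ⟨s, rfl⟩ := Ideal.Quotient.mk_surjective s
    have hP : (Ideal.span {e}).IsPrime := hPe ▸ inferInstance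
    have hs' : s ∉ Ideal.span {e} := by
      rw [← hPe, ← Ideal.Quotient.eq_zero_iff_mem]
      exact nonZeroDivisors.ne_zero hs
    -- `(1 - e) s + e` is a nonzerodivisor with the same image as `s`.
    let s' : R⁰ := ⟨(1 - e) * s + e, idempotent_mem_nonZeroDivisors he hs'⟩
    have hs'' : Ideal.Quotient.mk P s' = Ideal.Quotient.mk P s := by
      rw [← sub_eq_zero, ← map_sub, hmk]
      change (1 - e) * ((1 - e) * s + e - s) = 0
      linear_combination (s - 1) * he.eq
    refine ⟨IsLocalization.mk' _ a s', ?_⟩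
    have hs0 : algebraMap (R ⧸ P) (FractionRing (R ⧸ P)) (Ideal.Quotient.mk P s) ≠ 0 :=
      (map_ne_zero_iff _ hinj).mpr (nonZeroDivisors.ne_zero hs)
    refine mul_right_cancel₀ hs0 (Eq.trans (b := algebraMap _ _ (Ideal.Quotient.mk P a)) ?_ h.symm)
    rw [← hs'', ← hq, ← map_mul, IsLocalization.mk'_spec, hq]
  · obtain ⟨⟨a, s⟩, h⟩ := IsLocalization.surj R⁰ x
    have hs0 : q (algebraMap R _ s) ≠ 0 := by
      rw [hq]
      exact (map_ne_zero_iff _ hinj).mpr (nonZeroDivisors.ne_zero (hle s.2))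
    have hu : IsUnit (algebraMap R (FractionRing R) s) := IsLocalization.map_units _ s
    rw [← mul_left_inj' hs0, zero_mul, ← map_mul, h, hq, map_eq_zero_iff _ hinj, hmk,
      ← hu.mul_left_inj, zero_mul, Algebra.smul_def, mul_assoc, h, ← map_mul,
      map_eq_zero_iff _ (IsFractionRing.injective R (FractionRing R))]

/-- Every normal algebra essentially of finite type has a canonical divisor. -/
theorem exists_isCanonicalDivisor [IsNoetherianRing R] [IsNormalRing R] (k : Type u) [Field k]
    [Algebra k R] [Algebra.EssFiniteType k R] : ∃ K : WeilDivisor R, IsCanonicalDivisor k K := by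
  classical
  obtain ⟨T, e, hT, he, horth, hsum⟩ := exists_component_idempotents R
  have hprime : ∀ i : T, i.1.IsPrime := fun i => ((hT i).mp i.2).1.1
  have hess : ∀ i : T, Algebra.EssFiniteType k (R ⧸ i.1) := fun i =>
    Algebra.EssFiniteType.comp k R (R ⧸ i.1)
  choose M hfg hne hS2 hM using fun i : T =>
    exists_isCanonicalModuleOfConnected_submodule k (R ⧸ i.1) (FractionRing (R ⧸ i.1))
  choose q hq hqsmul hqker using fun i : T =>
    exists_toFractionRing_quotient (he i i.2).1 (he i i.2).2
  have hself : ∀ i : T, Ideal.Quotient.mk i.1 (e i) = 0 := fun i => by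
    rw [Ideal.Quotient.eq_zero_iff_mem]
    exact (he i i.2).2.ge (Ideal.mem_span_singleton_self _)
  have hother : ∀ i j : T, i ≠ j → Ideal.Quotient.mk j.1 (1 - e i) = 0 := fun i j hij => by
    rw [Ideal.Quotient.eq_zero_iff_mem]
    refine (he j j.2).2.ge ((mem_span_idempotent_iff (he j j.2).1).mpr ?_)
    exact horth j j.2 i i.2 fun h => hij (Subtype.ext h.symm)
  have hq1 : ∀ i x, q i ((1 - e i) • x) = q i x := fun i x => by
    rw [hqsmul, map_sub, hself, sub_zero, map_one, one_smul]
  have hq0 : ∀ i j x, i ≠ j → q j ((1 - e i) • x) = 0 := fun i j x hij => by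
    rw [hqsmul, hother i j hij, zero_smul]
  -- The functions whose restrictions to all components lie in the canonical fractional ideals there.
  let N : Submodule R (FractionRing R) :=
    { carrier := {x | ∀ i, q i x ∈ M i}
      zero_mem' := fun i => by rw [map_zero]; exact (M i).zero_mem
      add_mem' := fun ha hb i => by rw [map_add]; exact (M i).add_mem (ha i) (hb i)
      smul_mem' := fun r x hx i => by rw [hqsmul]; exact (M i).smul_mem _ (hx i) }
  have hlift : ∀ i, ∀ y ∈ M i, ∃ x ∈ N, q i x = y := fun i y hy => by
    obtain ⟨x, rfl⟩ := hq i y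
    refine ⟨(1 - e i) • x, fun j => ?_, hq1 i x⟩
    by_cases hij : i = j
    · subst hij
      rwa [hq1]
    · rw [hq0 i j x hij]
      exact (M j).zero_mem
  have hsum' : ∀ x : FractionRing R, x = ∑ i : T, (1 - e i) • x := fun x => by
    rw [← Finset.sum_smul, Finset.sum_coe_sort T fun P => 1 - e P, hsum, one_smul]
  have hNfg : N.FG := by
    have h1 : ∀ i : T, ∃ G : Finset (FractionRing R), (G : Set (FractionRing R)) ⊆ N ∧
        ∀ x ∈ N, (1 - e i) • x ∈ Submodule.span R (G : Set (FractionRing R)) := fun i => by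
      obtain ⟨s, hs⟩ := hfg i
      have h2 : ∀ y : FractionRing (R ⧸ i.1), ∃ x ∈ N, y ∈ M i → q i x = y := fun y => by
        by_cases hy : y ∈ M i
        · obtain ⟨x, hx, h⟩ := hlift i y hy
          exact ⟨x, hx, fun _ => h⟩
        · exact ⟨0, N.zero_mem, fun h => absurd h hy⟩
      choose ℓ hℓ hℓq using h2
      have h3 : ∀ y ∈ M i, ∃ z ∈ Submodule.span R (s.image ℓ : Set (FractionRing R)),
          q i z = y := fun y hy => by
        rw [← hs] at hy
        induction hy using Submodule.span_induction with
        | mem y hy =>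
          exact ⟨ℓ y, Submodule.subset_span (Finset.mem_coe.mpr (Finset.mem_image_of_mem _ hy)),
            hℓq y (hs ▸ Submodule.subset_span hy)⟩
        | zero => exact ⟨0, Submodule.zero_mem _, map_zero _⟩
        | add a b _ _ ha hb =>
          obtain ⟨⟨a', ha', rfl⟩, b', hb', rfl⟩ := And.intro ha hb
          exact ⟨a' + b', Submodule.add_mem _ ha' hb', map_add _ _ _⟩
        | smul c a _ ha =>
          obtain ⟨a', ha, rfl⟩ := ha
          obtain ⟨c, rfl⟩ := Ideal.Quotient.mk_surjective c
          exact ⟨c • a', Submodule.smul_mem _ c ha, hqsmul i c a'⟩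
      refine ⟨s.image ℓ, fun x hx => ?_, fun x hx => ?_⟩
      · obtain ⟨y, -, rfl⟩ := Finset.mem_image.mp (Finset.mem_coe.mp hx)
        exact hℓ y
      · obtain ⟨z, hz, h⟩ := h3 _ (hx i)
        have h4 : (1 - e i) • (x - z) = 0 := by rw [← hqker, map_sub, h, sub_self]
        rw [smul_sub, sub_eq_zero] at h4
        rw [h4]
        exact Submodule.smul_mem _ _ hz
    choose G hG hGx using h1
    refine ⟨Finset.univ.biUnion G, le_antisymm (Submodule.span_le.mpr fun x hx => ?_) fun x hx => ?_⟩
    · obtain ⟨i, -, hi⟩ := Finset.mem_biUnion.mp (Finset.mem_coe.mp hx)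
      exact hG i hi
    · rw [hsum' x]
      refine Submodule.sum_mem _ fun i _ => Submodule.span_mono ?_ (hGx i x hx)
      exact Finset.coe_subset.mpr (Finset.subset_biUnion_of_mem G (Finset.mem_univ i))
  obtain ⟨u, hu⟩ : ∃ u : (FractionRing R)ˣ, (u : FractionRing R) ∈ N := by
    choose y hy hy0 using hne
    choose v hv hvy using fun i => hlift i (y i) (hy i)
    have huN : ∑ i : T, (1 - e i) • v i ∈ N := N.sum_mem fun i _ => N.smul_mem _ (hv i)
    have huq : ∀ j, q j (∑ i : T, (1 - e i) • v i) = y j := fun j => by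
      rw [map_sum, Finset.sum_eq_single j, hq1, hvy]
      · exact fun i _ hij => hq0 i j _ hij
      · exact fun h => absurd (Finset.mem_univ j) h
    generalize ∑ i : T, (1 - e i) • v i = u at huN huq
    obtain ⟨⟨a, s⟩, has⟩ := IsLocalization.surj R⁰ u
    have hqalg : ∀ j r, q j (algebraMap R _ r) = algebraMap _ _ (Ideal.Quotient.mk j.1 r) :=
      fun j r => by
        rw [Algebra.algebraMap_eq_smul_one, hqsmul, map_one, ← Algebra.algebraMap_eq_smul_one]
    have hred := IsNormalRing.isReduced (R := R)
    have ha : a ∈ R⁰ := mem_nonZeroDivisors_of_notMem_minimalPrimes fun P hP haP => by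
      let j : T := ⟨P, (hT P).mpr hP⟩
      have h1 := congrArg (q j) has
      rw [map_mul, huq, hqalg, hqalg, Ideal.Quotient.eq_zero_iff_mem.mpr haP, map_zero] at h1
      refine (mul_ne_zero (hy0 j) ?_) h1
      rw [Ne, map_eq_zero_iff _ (IsFractionRing.injective (R ⧸ j.1) (FractionRing (R ⧸ j.1))),
        Ideal.Quotient.eq_zero_iff_mem]
      exact notMem_minimalPrimes_of_mem_nonZeroDivisors s.2 hP
    have h2 : IsUnit (u * algebraMap R (FractionRing R) s) := by
      rw [has]
      exact IsLocalization.map_units _ (⟨a, ha⟩ : R⁰)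
    exact ⟨(isUnit_of_mul_isUnit_left h2).unit, huN⟩
  have hNS2 : ∀ p q : Ideal R, p.IsPrime → q.IsPrime → q < p → (∃ t ∈ q, t ∈ R⁰) →
      ∀ y, (∀ r ∈ p, r • y ∈ N) → y ∈ N := by
    rintro p p' hp hp' hlt ⟨t, htp', ht⟩ y hy i
    -- On a component that does not meet `p`, the claim is clear because `1 - e i ∈ p`.
    by_cases hep : e i ∈ p
    · have hep' : e i ∈ p' := by
        by_contra h
        have h1 := hlt.le (one_sub_mem_of_notMem (he i i.2).1 h)
        exact hp.ne_top ((Ideal.eq_top_iff_one _).mpr (by simpa using p.add_mem h1 hep))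
      have hker : ∀ J : Ideal R, e i ∈ J → RingHom.ker (Ideal.Quotient.mk i.1) ≤ J := fun J hJ => by
        rw [Ideal.mk_ker, (he i i.2).2, Ideal.span_singleton_le_iff_mem]
        exact hJ
      have hsurj : Function.Surjective (Ideal.Quotient.mk i.1) := Ideal.Quotient.mk_surjective
      have hcomap : ∀ J : Ideal R, e i ∈ J →
          (J.map (Ideal.Quotient.mk i.1)).comap (Ideal.Quotient.mk i.1) = J := fun J hJ => by
        rw [Ideal.comap_map_of_surjective' _ hsurj, sup_eq_left]
        exact hker J hJ
      refine hS2 i (p.map (Ideal.Quotient.mk i.1)) (p'.map (Ideal.Quotient.mk i.1))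
        (Ideal.map_isPrime_of_surjective hsurj (hker p hep))
        (Ideal.map_isPrime_of_surjective hsurj (hker p' hep')) (fun h => ?_)
        (lt_of_le_of_ne (Ideal.map_mono hlt.le) fun h => hlt.ne ?_) _ fun r hr => ?_
      · have h1 := Ideal.mem_map_of_mem (Ideal.Quotient.mk i.1) htp'
        rw [h, Ideal.mem_bot, Ideal.Quotient.eq_zero_iff_mem] at h1
        exact notMem_minimalPrimes_of_mem_nonZeroDivisors ht ((hT _).mp i.2) h1
      · rw [← hcomap p' hep', h, hcomap p hep]
      · obtain ⟨s, hs, rfl⟩ := (Ideal.mem_map_iff_of_surjective _ hsurj).mp hr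
        rw [← hqsmul]
        exact hy s hs i
    · rw [← hq1]
      exact hy _ (one_sub_mem_of_notMem (he i i.2).1 hep) i
  obtain ⟨K, hK⟩ := exists_sections_eq hNfg hu hNS2
  refine ⟨K, ?_⟩
  rw [IsCanonicalDivisor, hK]
  intro e' he' hconn
  have hP := IsNormalRing.isPrime_span_idempotent he'
  have hPmin : Ideal.span {e'} ∈ minimalPrimes R := mem_minimalPrimes_of_forall_notMem fun r hr hr0 => by
    have h2 := (mem_nonZeroDivisors_iff_right.mp hr0) _ ((mem_span_idempotent_iff he').mp hr)
    exact hP.ne_top ((Ideal.eq_top_iff_one _).mpr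
      (by rw [sub_eq_zero.mp h2]; exact Ideal.mem_span_singleton_self e'))
  let i : T := ⟨Ideal.span {e'}, (hT _).mpr hPmin⟩
  have hker' : ∀ x, q i x = 0 ↔ (1 - e') • x = 0 := fun x => by
    rw [hqker]
    have h1 : (1 - e i) * e' = 0 := (mem_span_idempotent_iff (he i i.2).1).mp
      ((he i i.2).2 ▸ Ideal.mem_span_singleton_self e')
    have h2 : (1 - e') * e i = 0 := (mem_span_idempotent_iff he').mp
      ((he i i.2).2.ge (Ideal.mem_span_singleton_self (e i)))
    have h3 : e i = e' := by linear_combination h2 - h1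
    rw [h3]
  obtain ⟨ε⟩ := nonempty_linearEquiv_quotient (I := Ideal.span {e'}) (N := N) (M := M i)
    (AddMonoidHom.mk' (fun x => ⟨q i x, x.2 i⟩) fun x y => Subtype.ext (map_add _ _ _))
    (fun y => by
      obtain ⟨x, hx, h⟩ := hlift i y y.2
      exact ⟨⟨x, hx⟩, Subtype.ext h⟩)
    (fun r x => Subtype.ext (hqsmul i r x))
    (fun x => by
      rw [mem_span_singleton_smul_top_iff he', ← Subtype.coe_inj, ← Subtype.coe_inj]
      exact hker' x)
  exact IsCanonicalModuleOfConnected.congr (hM i) ε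

end Glue

/-! ### The cover -/

section Cover

lemma IsFiniteCover.of_injective {R S : Type u} [CommRing R] [CommRing S] [Algebra R S]
    [Module.Finite R S] (h : Function.Injective (algebraMap R S)) : IsFiniteCover R S := by
  have : FaithfulSMul R S := (faithfulSMul_iff_algebraMap_injective R S).mpr h
  exact ⟨inferInstance, Algebra.IsIntegral.comap_surjective R S⟩

variable {A : Type u} [CommRing A] [IsNoetherianRing A] [IsNormalRing A]

/-- For a canonical divisor `K`, the algebra `R ⊕ 𝒪(K)` is quasi-Gorenstein, because it is
isomorphic to its dual `Hom_R(R ⊕ 𝒪(K), 𝒪(K))`. -/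
lemma isQuasiGorenstein_twistedDouble (k : Type u) [Field k] [Algebra k A] (h2 : IsUnit (2 : A))
    {K : WeilDivisor A} (hK : IsCanonicalDivisor k K) {H : WeilDivisor A} {f : (FractionRing A)ˣ}
    (hH : H.IsReduced) (hfH : (H + 2 • K).IsDivOf f)
    {hf : ∀ b ∈ K.sections, ∀ y ∈ K.sections, ∃ c : A,
      algebraMap A (FractionRing A) c = b * y * f}
    [Algebra k (twistedDouble K f hf)] [IsScalarTower k A (twistedDouble K f hf)] :
    IsQuasiGorenstein k (twistedDouble K f hf) := by
  have := isNormalRing_twistedDouble h2 hH hfH (hf := hf)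
  have := isFractionRing_twistedDouble (hf := hf)
  refine isQuasiGorenstein_of_frobenius (R := A) (fun r hr => ?_) hK twistedDoubleSnd
    existsUnique_twistedDoubleSnd_mul
  have hu : IsUnit (algebraMap A (FractionRing A) r) :=
    IsLocalization.map_units _ (⟨r, hr⟩ : A⁰)
  rw [mem_nonZeroDivisors_iff_right]
  intro x hx
  have h1 : r • x = 0 := by rw [Algebra.smul_def, mul_comm, hx]
  have h3 : r • (x : QuadraticAlgebra (FractionRing A) f 0) = 0 := congrArg Subtype.val h1
  refine Subtype.ext (QuadraticAlgebra.ext ?_ ?_)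
  · have h4 := congrArg QuadraticAlgebra.re h3
    rw [QuadraticAlgebra.re_smul, Algebra.smul_def] at h4
    exact hu.mul_right_eq_zero.mp h4
  · have h4 := congrArg QuadraticAlgebra.im h3
    rw [QuadraticAlgebra.im_smul, Algebra.smul_def] at h4
    exact hu.mul_right_eq_zero.mp h4

end Cover

end QuasiGorenstein

theorem mainTheorem6 (k R : Type u) [Field k] [CommRing R] [Algebra k R]
    [Algebra.EssFiniteType k R] [IsNoetherianRing R] [IsNormalRing R] (hk : ringChar k ≠ 2) :
    ∃ (k' : Type u) (_ : Field k') (_ : Algebra k k') (_ : FiniteDimensional k k')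
      (_ : IsNoetherianRing (R ⊗[k] k')) (_ : IsNormalRing (R ⊗[k] k')),
      (Infinite k → Function.Bijective (algebraMap k k')) ∧
      (∃ K : WeilDivisor (R ⊗[k] k'), IsCanonicalDivisor k K) ∧
      ∀ K : WeilDivisor (R ⊗[k] k'), IsCanonicalDivisor k K →
        (∃ (H : WeilDivisor (R ⊗[k] k')) (f : (FractionRing (R ⊗[k] k'))ˣ),
          H.IsReduced ∧ (H + 2 • K).IsDivOf f) ∧
        ∀ (H : WeilDivisor (R ⊗[k] k')) (f : (FractionRing (R ⊗[k] k'))ˣ),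
          H.IsReduced → (H + 2 • K).IsDivOf f →
          ∃ (S : Type u) (_ : CommRing S) (_ : Algebra (R ⊗[k] k') S) (_ : Algebra R S)
            (_ : Algebra k S) (_ : IsScalarTower R (R ⊗[k] k') S)
            (_ : IsScalarTower k (R ⊗[k] k') S),
            IsTwistedDouble K f S ∧ IsNormalRing S ∧ IsQuasiGorenstein k S ∧
              IsFiniteCover (R ⊗[k] k') S ∧ IsFiniteCover R S := by
  let ε : R ≃+* R ⊗[k] k := (Algebra.TensorProduct.rid k R R).symm.toRingEquiv
  have hNoeth : IsNoetherianRing (R ⊗[k] k) := isNoetherianRing_of_ringEquiv R ε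
  have hNormal : IsNormalRing (R ⊗[k] k) := QuasiGorenstein.IsNormalRing.of_ringEquiv ε
  have hess : Algebra.EssFiniteType k (R ⊗[k] k) := Algebra.EssFiniteType.comp k R (R ⊗[k] k)
  have h2 : IsUnit (2 : R ⊗[k] k) := by
    have h := (IsUnit.mk0 (2 : k) (Ring.two_ne_zero hk)).map (algebraMap k (R ⊗[k] k))
    rwa [map_ofNat] at h
  -- No extension of the base field is needed.
  refine ⟨k, inferInstance, Algebra.id k, inferInstance, hNoeth, hNormal,
    fun _ => Function.bijective_id, QuasiGorenstein.exists_isCanonicalDivisor k, fun K hK =>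
    ⟨QuasiGorenstein.exists_isReduced_isDivOf (k := k) K, fun H f hH hfH => ?_⟩⟩
  have hf : ∀ b ∈ K.sections, ∀ y ∈ K.sections, ∃ c : R ⊗[k] k,
      algebraMap (R ⊗[k] k) (FractionRing (R ⊗[k] k)) c = b * y * f := fun b hb y hy =>
    QuasiGorenstein.exists_algebraMap_eq_mul_mul hH hfH hb hy
  let S := QuasiGorenstein.twistedDouble K f hf
  let _ : Algebra R S := ((algebraMap (R ⊗[k] k) S).comp (algebraMap R (R ⊗[k] k))).toAlgebra
  let _ : Algebra k S := ((algebraMap (R ⊗[k] k) S).comp (algebraMap k (R ⊗[k] k))).toAlgebra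
  have hR : IsScalarTower R (R ⊗[k] k) S :=
    IsScalarTower.of_algebraMap_eq (R := R) (S := R ⊗[k] k) (A := S) fun _ => rfl
  have hkS : IsScalarTower k (R ⊗[k] k) S :=
    IsScalarTower.of_algebraMap_eq (R := k) (S := R ⊗[k] k) (A := S) fun _ => rfl
  have hinj : Function.Injective (algebraMap (R ⊗[k] k) S) :=
    QuasiGorenstein.algebraMap_twistedDouble_injective
  have hinj' : Function.Injective (algebraMap R (R ⊗[k] k)) := ε.injective
  have : Module.Finite R S := Module.Finite.trans (R ⊗[k] k) S
  exact ⟨S, inferInstance, inferInstance, inferInstance, inferInstance, hR, hkS,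
    QuasiGorenstein.isTwistedDouble, QuasiGorenstein.isNormalRing_twistedDouble h2 hH hfH,
    QuasiGorenstein.isQuasiGorenstein_twistedDouble k h2 hK hH hfH,
    QuasiGorenstein.IsFiniteCover.of_injective hinj,
    QuasiGorenstein.IsFiniteCover.of_injective (hinj.comp hinj')⟩
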